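/- Let $q\in\mathbb C\setminus\{0,1\}$ and $\Theta=(\Theta_0,\Theta_1,\Theta_t,\Theta_\infty)\in(\mathbb C^*)^4$ with $$\Theta_0^2\neq1,\quad \Theta_1^2\neq 1,\quad \Theta_t^2\neq1,\quad \Theta_\infty^2\neq q .$$ Write $\overline\Theta_i=1/\Theta_i$ and let $t\in\mathbb C^*$ with $t\notin S_q:=\{\Theta_1^{\varepsilon_1}\Theta_t^{\varepsilon_t},\ \Theta_0^{\varepsilon_0}\Theta_\infty^{\varepsilon_\infty} : \varepsilon_i\in\{1,-1\}\}\cdot q^{\mathbb Z}$. Let $\mathfrak P_t$ be the blow up of $\mathbb P^1\times\mathbb P^1$, with standard coordinates $(y,z)$, at the eight distinct points $$\gamma_0^-=(0,t\Theta_0/q),\ \gamma_0^+=(0,t\overline\Theta_0/q),\ \gamma_1^-=(\overline\Theta_1,\infty),\ \gamma_1^+=(\Theta_1,\infty),$$ $$\gamma_t^-=(t\Theta_t,0),\ \gamma_t^+=(t\overline\Theta_t,0),\ \gamma_\infty^-=(\infty,\overline\Theta_\infty),\ \gamma_\infty^+=(\infty,\Theta_\infty/q),$$ and let $\mathcal F_i^\pm\subset\mathfrak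 P_t$ be the exceptional line over $\gamma_i^\pm$. Let $\mathbb F_2$ be the second Hirzebruch surface, with the four $\mathbb C^2$-charts $$(u_0,v_0)=(u,v),\quad (u_1,v_1)=(u,1/v),\quad (u_2,v_2)=(1/u,v/u^2),\quad (u_3,v_3)=(1/u,u^2/v),$$ and let $\widetilde{\mathfrak P}_t$ be the blow up of $\mathbb F_2$ at the eight distinct points given by $$\beta_0^-:(u,v)=\Big(0,\tfrac{t(\overline\Theta_0-1)}{q-1}\Big),\qquad \beta_0^+:(u,v)=\Big(0,\tfrac{t(\Theta_0-1)}{q-1}\Big),$$ $$\beta_1^-:(u,v)=\Big(\overline\Theta_1,\tfrac{(\overline\Theta_1-1)(t-\overline\Theta_1)}{q-1}\Big),\qquad \beta_1^+:(u,v)=\Big(\Theta_1,\tfrac{(\Theta_1-1)(t-\Theta_1)}{q-1}\Big),$$ $$\beta_t^-:(u,v)=\Big(t\Theta_t,-\tfrac{t(\Theta_t-1)(t\Theta_t-1)}{q-1}\Big),\qquad \beta_t^+:(u,v)=\Big(t\overline\Theta_t,-\tfrac{t(\overline\Theta_t-1)(t\overline\Theta_t-1)}{q-1}\Big),$$ $$\beta_\infty^-:(u_2,v_2)=\Big(0,\tfrac{\overline\Theta_\infty-1}{q-1}\Big),\qquad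 \beta_\infty^+:(u_2,v_2)=\Big(0,\tfrac{\Theta_\infty-q}{q(q-1)}\Big),$$ with exceptional lines $\mathcal E_i^\pm\subset\widetilde{\mathfrak P}_t$ over $\beta_i^\pm$. In $\mathbb P^1\times\mathbb P^1$ let $\mathcal V_t^+=\{y=t\overline\Theta_t\}$ and $\mathcal V_t^-=\{y=t\Theta_t\}$, and let $J^t\subset\mathfrak P_t$ be the union of the strict transforms of the four lines $\{z=0\}$, $\{z=\infty\}$, $\{y=0\}$, $\{y=\infty\}$. In $\mathbb F_2$ let $\mathcal D_t^+=\{u=t\overline\Theta_t\}$ and $\mathcal D_t^-=\{u=t\Theta_t\}$ (fibres of $\mathbb F_2\to\mathbb P^1$), and let $I^t\subset\widetilde{\mathfrak P}_t$ be the union of the strict transforms of $\{v=\infty\}$ (that is, $\{v_1=0\}\cup\{v_3=0\}$), of the fibres $\{u=0\}$ and $\{u=\infty\}$, and of the curve $\mathcal C$, the closure of $\{(u-1)(u-t)=(1-q)v\}$. Put $q\text{-}\mathrm{Oka}_t=\mathfrak P_t\setminus J^t$ and $q\text{-}\widetilde{\mathrm{Oka}}_t=\widetilde{\mathfrak P}_t\setminus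 I^t$. Then the birational map $\varphi:\mathfrak P_t\dashrightarrow\widetilde{\mathfrak P}_t$ given in standard coordinates by $$(y,z)\mapsto(u,v)=\left(y,\ \frac{(y-t\Theta_t)(y-t\overline\Theta_t)-q(y-1)(y-t)z}{q(q-1)z}\right)$$ extends to a biregular map $\mathfrak P_t\to\widetilde{\mathfrak P}_t$. This map sends, bijectively, - the strict transform of $\mathcal V_t^\pm$ onto $\mathcal E_t^\pm$, and $\mathcal F_t^\pm$ onto the strict transform of $\mathcal D_t^\pm$; - $\mathcal F_0^\pm$ onto $\mathcal E_0^\pm$, $\mathcal F_1^\pm$ onto $\mathcal E_1^\pm$, and $\mathcal F_\infty^\pm$ onto $\mathcal E_\infty^\mp$; - $J^t$ onto $I^t$; and therefore it restricts to an isomorphism $q\text{-}\mathrm{Oka}_t\to q\text{-}\widetilde{\mathrm{Oka}}_t$. -/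

import Mathlib

/-!
Complex algebraic surfaces are described by their points together with an atlas of charts
parametrised by Zariski open subsets of the affine plane, with transition maps given by
rational functions without poles. Zariski topology, regular maps, blow ups and open
subvarieties are defined for such surfaces.
-/

open MvPolynomial

noncomputable section

namespace QOkamoto

/-- The affine plane over the complex numbers. -/
abbrev A2 : Type := Fin 2 → ℂ

/-- The filter of Zariski neighbourhoods of a point of the affine plane; the principal open
sets `{g ≠ 0}` containing the point form a basis. -/
def zNhds (w : A2) : Filter A2 where
  sets := {U | ∃ g : MvPolynomial (Fin 2) ℂ, eval w g ≠ 0 ∧ ∀ x, eval x g ≠ 0 → x ∈ U}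
  univ_sets := ⟨1, by simp, by simp⟩
  sets_of_superset := by
    rintro U V ⟨g, h1, h2⟩ hUV
    exact ⟨g, h1, fun x hx => hUV (h2 x hx)⟩
  inter_sets := by
    rintro U V ⟨g, h1, h2⟩ ⟨g', h1', h2'⟩
    refine ⟨g * g', by simp [h1, h1'], fun x hx => ?_⟩
    rw [map_mul, mul_ne_zero_iff] at hx
    exact ⟨h2 x hx.1, h2' x hx.2⟩

/-- A function on the affine plane is regular at `w` if, on a Zariski neighbourhood of `w`, it is
a quotient of polynomials whose denominator does not vanish at `w`. -/
def RegAt (r : A2 → ℂ) (w : A2) : Prop :=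
  ∃ P g : MvPolynomial (Fin 2) ℂ, eval w g ≠ 0 ∧
    ∀ᶠ x in zNhds w, r x = eval x P / eval x g

/-- Near `w`, the map `f` (on the subset `D` of the plane) takes its values in the chart
parametrised by `b`, and its coordinates in that chart are regular functions. -/
def LocalRep {T : Type} {D D' : Set A2} (f : D → T) (b : D' → T) (w : D) : Prop :=
  ∃ r : A2 → A2, (∀ k, RegAt (fun x => r x k) w) ∧
    ∀ᶠ x in zNhds w, ∀ h : x ∈ D, ∃ h' : r x ∈ D', b ⟨r x, h'⟩ = f ⟨x, h⟩

/-- A (smooth, rational) complex algebraic surface given by an algebraic atlas. -/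
structure AlgSurface where
  /-- the points -/
  Pt : Type
  /-- the names of the charts -/
  Chart : Type
  /-- the part of the affine plane that parametrises a chart -/
  dom : Chart → Set A2
  /-- the parametrisations -/
  par : ∀ c, dom c → Pt
  dom_open : ∀ c, ∀ w ∈ dom c, dom c ∈ zNhds w
  par_inj : ∀ c, Function.Injective (par c)
  cover : ∀ x, ∃ c w, par c w = x
  compat : ∀ c d (w : dom c), par c w ∈ Set.range (par d) → LocalRep (par c) (par d) w

/-- A map between surfaces is regular if near every point it is given, in charts, by regular
functions. -/
def IsRegularMap (X Y : AlgSurface) (f : X.Pt → Y.Pt) : Prop :=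
  ∀ x, ∃ (c : X.Chart) (d : Y.Chart) (w : X.dom c),
    X.par c w = x ∧ LocalRep (fun v => f (X.par c v)) (Y.par d) w

/-- A biregular map: a bijection which is regular together with its inverse. -/
structure Biregular (X Y : AlgSurface) extends X.Pt ≃ Y.Pt where
  regular_toFun : IsRegularMap X Y toFun
  regular_invFun : IsRegularMap Y X invFun

/-- The Zariski topology of a surface. -/
instance zariski (X : AlgSurface) : TopologicalSpace X.Pt where
  IsOpen U := ∀ c (w : X.dom c), X.par c w ∈ U →
    ∀ᶠ x in zNhds w, ∀ h : x ∈ X.dom c, X.par c ⟨x, h⟩ ∈ U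
  isOpen_univ := by simp
  isOpen_inter := by
    intro U V hU hV c w hw
    filter_upwards [hU c w hw.1, hV c w hw.2] with x h1 h2 h
    exact ⟨h1 h, h2 h⟩
  isOpen_sUnion := by
    rintro S hS c w ⟨U, hU, hw⟩
    filter_upwards [hS U hU c w hw] with x h1 h
    exact ⟨U, hU, h1 h⟩

/-! ### Facts on regular functions that the constructions need -/

theorem mem_zNhds_self {w : A2} {p : A2 → Prop} (h : ∀ᶠ x in zNhds w, p x) : p w := by
  obtain ⟨g, h1, h2⟩ := h
  exact h2 w h1

theorem zNhds_ne (w : A2) (g : MvPolynomial (Fin 2) ℂ) (h : eval w g ≠ 0) :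
    ∀ᶠ x in zNhds w, eval x g ≠ 0 := ⟨g, h, fun _ hx => hx⟩

theorem RegAt.congr {r s : A2 → ℂ} {w : A2} (hr : RegAt r w)
    (h : ∀ᶠ x in zNhds w, s x = r x) : RegAt s w := by
  obtain ⟨P, g, hg, hP⟩ := hr
  refine ⟨P, g, hg, ?_⟩
  filter_upwards [hP, h] with x h1 h2
  rw [h2, h1]

theorem RegAt.poly (P : MvPolynomial (Fin 2) ℂ) (w : A2) : RegAt (fun x => eval x P) w :=
  ⟨P, 1, by simp, by simp⟩

theorem RegAt.const (a : ℂ) (w : A2) : RegAt (fun _ => a) w :=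
  ⟨C a, 1, by simp, by simp⟩

theorem RegAt.coord (k : Fin 2) (w : A2) : RegAt (fun x => x k) w :=
  ⟨X k, 1, by simp, by simp⟩

theorem RegAt.add {r s : A2 → ℂ} {w : A2} (hr : RegAt r w) (hs : RegAt s w) :
    RegAt (fun x => r x + s x) w := by
  obtain ⟨P, g, hg, hP⟩ := hr
  obtain ⟨P', g', hg', hP'⟩ := hs
  refine ⟨P * g' + P' * g, g * g', by simp [hg, hg'], ?_⟩
  filter_upwards [hP, hP', zNhds_ne w g hg, zNhds_ne w g' hg'] with x h1 h2 h3 h4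
  rw [h1, h2]
  simp only [map_add, map_mul]
  field_simp

theorem RegAt.mul {r s : A2 → ℂ} {w : A2} (hr : RegAt r w) (hs : RegAt s w) :
    RegAt (fun x => r x * s x) w := by
  obtain ⟨P, g, hg, hP⟩ := hr
  obtain ⟨P', g', hg', hP'⟩ := hs
  refine ⟨P * P', g * g', by simp [hg, hg'], ?_⟩
  filter_upwards [hP, hP', zNhds_ne w g hg, zNhds_ne w g' hg'] with x h1 h2 h3 h4
  rw [h1, h2]
  simp only [map_mul]
  field_simp

theorem RegAt.sub {r s : A2 → ℂ} {w : A2} (hr : RegAt r w) (hs : RegAt s w) :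
    RegAt (fun x => r x - s x) w := by
  refine (hr.add ((RegAt.const (-1) w).mul hs)).congr (Filter.Eventually.of_forall fun x => ?_)
  ring

theorem RegAt.pow {r : A2 → ℂ} {w : A2} (hr : RegAt r w) (n : ℕ) :
    RegAt (fun x => r x ^ n) w := by
  induction n with
  | zero => simpa using RegAt.const 1 w
  | succ n ih => simpa [pow_succ] using ih.mul hr

theorem RegAt.eventually_ne {r : A2 → ℂ} {w : A2} (hr : RegAt r w) (h : r w ≠ 0) :
    ∀ᶠ x in zNhds w, r x ≠ 0 := by
  obtain ⟨P, g, hg, hP⟩ := hr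
  have hw := mem_zNhds_self hP
  have hPw : eval w P ≠ 0 := fun h0 => h (by rw [hw, h0, zero_div])
  filter_upwards [hP, zNhds_ne w g hg, zNhds_ne w P hPw] with x h1 h2 h3
  rw [h1]
  exact div_ne_zero h3 h2

theorem RegAt.inv {r : A2 → ℂ} {w : A2} (hr : RegAt r w) (h : r w ≠ 0) :
    RegAt (fun x => (r x)⁻¹) w := by
  obtain ⟨P, g, hg, hP⟩ := hr
  have hw := mem_zNhds_self hP
  have hPw : eval w P ≠ 0 := fun h0 => h (by rw [hw, h0, zero_div])
  refine ⟨g, P, hPw, ?_⟩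
  filter_upwards [hP] with x h1
  rw [h1, inv_div]

theorem RegAt.div {r s : A2 → ℂ} {w : A2} (hr : RegAt r w) (hs : RegAt s w) (h : s w ≠ 0) :
    RegAt (fun x => r x / s x) w := by
  simpa [div_eq_mul_inv] using hr.mul (hs.inv h)

theorem RegAt.polyComp {r : A2 → A2} {w : A2} (hr : ∀ k, RegAt (fun x => r x k) w)
    (P : MvPolynomial (Fin 2) ℂ) : RegAt (fun x => eval (r x) P) w := by
  induction P using MvPolynomial.induction_on with
  | C a => simpa using RegAt.const a w
  | add p q hp hq => simpa using hp.add hq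
  | mul_X p k hp => simpa using hp.mul (hr k)

theorem tendsto_zNhds {r : A2 → A2} {w : A2} (hr : ∀ k, RegAt (fun x => r x k) w) :
    Filter.Tendsto r (zNhds w) (zNhds (r w)) := by
  rintro U ⟨g, h1, h2⟩
  have := (RegAt.polyComp hr g).eventually_ne h1
  exact this.mono fun x hx => h2 _ hx

theorem RegAt.comp {r : A2 → A2} {s : A2 → ℂ} {w : A2} (hr : ∀ k, RegAt (fun x => r x k) w)
    (hs : RegAt s (r w)) : RegAt (fun x => s (r x)) w := by
  obtain ⟨P, g, hg, hP⟩ := hs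
  refine ((RegAt.polyComp hr P).div (RegAt.polyComp hr g) hg).congr ?_
  exact tendsto_zNhds hr hP

theorem LocalRep.trans {T : Type} {D D' D'' : Set A2} {f : D → T} {b : D' → T} {e : D'' → T}
    {w : D} (h1 : LocalRep f b w) (h2 : ∀ w', b w' = f w → LocalRep b e w') :
    LocalRep f e w := by
  obtain ⟨r, hr, h⟩ := h1
  obtain ⟨hm, hf⟩ := mem_zNhds_self h w.2
  obtain ⟨s, hs, h'⟩ := h2 ⟨r w, hm⟩ hf
  refine ⟨fun x => s (r x), fun k => RegAt.comp hr (hs k), ?_⟩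
  filter_upwards [h, tendsto_zNhds hr h'] with x hx hx' hD
  obtain ⟨m, e1⟩ := hx hD
  obtain ⟨m', e2⟩ := hx' m
  exact ⟨m', e2.trans e1⟩

/-! ### Open subvarieties -/

/-- The open subvariety with point set `U`. -/
def openSub (X : AlgSurface) (U : Set X.Pt) (hU : IsOpen U) : AlgSurface where
  Pt := U
  Chart := X.Chart
  dom c := {w | ∃ h : w ∈ X.dom c, X.par c ⟨w, h⟩ ∈ U}
  par c w := ⟨X.par c ⟨w.1, w.2.1⟩, w.2.2⟩
  dom_open := by
    rintro c w ⟨h, hw⟩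
    filter_upwards [hU c ⟨w, h⟩ hw, X.dom_open c w h] with x h1 h2
    exact ⟨h2, h1 h2⟩
  par_inj := by
    intro c w w' h
    have := X.par_inj c (congrArg Subtype.val h)
    exact Subtype.ext (Subtype.mk.inj this)
  cover := by
    rintro ⟨x, hx⟩
    obtain ⟨c, w, rfl⟩ := X.cover x
    exact ⟨c, ⟨w.1, w.2, hx⟩, rfl⟩
  compat := by
    rintro c d ⟨w, hw, hw'⟩ ⟨v, hv⟩
    obtain ⟨r, hr, h⟩ := X.compat c d ⟨w, hw⟩ ⟨⟨v.1, v.2.1⟩, congrArg Subtype.val hv⟩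
    refine ⟨r, hr, ?_⟩
    filter_upwards [h] with x hx hD
    obtain ⟨m, e⟩ := hx hD.1
    exact ⟨⟨m, by rw [e]; exact hD.2⟩, Subtype.ext e⟩

/-- The inclusion of an open subvariety. -/
def inclusion (X : AlgSurface) (U : Set X.Pt) (hU : IsOpen U) : (openSub X U hU).Pt → X.Pt :=
  Subtype.val

/-! ### Blow ups -/

/-- The direction vector `(1, w 1)` for `k = 0`, respectively `(w 0, 1)` for `k = 1`. -/
def dir (k : Fin 2) (w : A2) : A2 := Function.update w k 1

theorem dir_ne_zero (k : Fin 2) (w : A2) : dir k w ≠ 0 := fun h => by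
  have := congrFun h k
  simp [dir] at this

/-- The two affine charts of the blow up of the affine plane in `a`: the map
`(s, m) ↦ a + s • (1, m)` for `k = 0`, and `(m, s) ↦ a + s • (m, 1)` for `k = 1`. -/
def blowMap (a : A2) (k : Fin 2) (w : A2) : A2 := a + w k • dir k w

theorem regAt_blowMap (a : A2) (k : Fin 2) (w : A2) (l : Fin 2) :
    RegAt (fun x => blowMap a k x l) w := by
  refine (RegAt.const (a l) w).add ((RegAt.coord k w).mul ?_)
  by_cases h : l = k
  · subst h
    simpa [dir] using RegAt.const 1 w
  · simpa [dir, h] using RegAt.coord l w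

theorem blowMap_eq_iff (a : A2) (k : Fin 2) (w : A2) : blowMap a k w = a ↔ w k = 0 := by
  rw [blowMap, add_eq_left, smul_eq_zero, or_iff_left (dir_ne_zero k w)]

section BlowUp

variable (X : AlgSurface) {I : Type} (p : I → (c : X.Chart) × X.dom c)

/-- The centres of a blow up: each of them is given by its coordinates in some chart. -/
def centre (i : I) : X.Pt := X.par (p i).1 (p i).2

/-- Points of the blow up: each centre is replaced by the projective line of tangent directions,
read in the chart in which the centre was given. -/
def BlowUpPt : Type := {x : X.Pt // ∀ i, x ≠ centre X p i} ⊕ (I × Projectivization ℂ A2)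

/-- Domains of the charts of the blow up: the charts of `X` without the centres, and two
charts for each centre. -/
def blowUpDom : X.Chart ⊕ (I × Fin 2) → Set A2
  | .inl c => {w | ∃ h : w ∈ X.dom c, ∀ j, X.par c ⟨w, h⟩ ≠ centre X p j}
  | .inr (i, k) => {w | ∃ h : blowMap (p i).2 k w ∈ X.dom (p i).1,
      w k ≠ 0 → ∀ j, X.par (p i).1 ⟨_, h⟩ ≠ centre X p j}

open Classical in
/-- Charts of the blow up. -/
def blowUpPar : ∀ c : X.Chart ⊕ (I × Fin 2), blowUpDom X p c → BlowUpPt X p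
  | .inl c => fun w => .inl ⟨X.par c ⟨w.1, w.2.1⟩, w.2.2⟩
  | .inr (i, k) => fun w =>
      if h : w.1 k = 0 then .inr (i, Projectivization.mk ℂ (dir k w.1) (dir_ne_zero k w.1))
      else .inl ⟨X.par (p i).1 ⟨_, w.2.1⟩, w.2.2 h⟩


variable {X p}

theorem eventually_par_ne {c : X.Chart} {w : A2} {h : w ∈ X.dom c} {y : X.Pt}
    (hy : X.par c ⟨w, h⟩ ≠ y) :
    ∀ᶠ x in zNhds w, ∀ h : x ∈ X.dom c, X.par c ⟨x, h⟩ ≠ y := by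
  by_cases hr : y ∈ Set.range (X.par c)
  · obtain ⟨v, rfl⟩ := hr
    have hv : w ≠ v.1 := fun e => hy (congrArg _ (Subtype.ext e))
    obtain ⟨k, hk⟩ := Function.ne_iff.1 hv
    have := ((RegAt.coord k w).sub (RegAt.const (v.1 k) w)).eventually_ne (sub_ne_zero.2 hk)
    filter_upwards [this] with x hx hD e
    have e' := X.par_inj c e
    exact hx (by rw [← e', sub_self])
  · exact Filter.Eventually.of_forall fun x hD e => hr ⟨_, e⟩

theorem blowUpDom_open [Finite I] (c : X.Chart ⊕ (I × Fin 2)) :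
    ∀ w ∈ blowUpDom X p c, blowUpDom X p c ∈ zNhds w := by
  rcases c with c | ⟨i, k⟩
  · rintro w ⟨h, hw⟩
    filter_upwards [X.dom_open c w h,
      Filter.eventually_all.2 fun j => eventually_par_ne (hw j)] with x h1 h2
    exact ⟨h1, fun j => h2 j h1⟩
  · rintro w ⟨h, hw⟩
    have ht := tendsto_zNhds (regAt_blowMap (p i).2 k w)
    have key : ∀ j, ∀ᶠ x in zNhds w, ∀ h : blowMap (p i).2 k x ∈ X.dom (p i).1,
        x k ≠ 0 → X.par (p i).1 ⟨_, h⟩ ≠ centre X p j := by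
      intro j
      by_cases hj : X.par (p i).1 ⟨_, h⟩ = centre X p j
      · have hk : w k = 0 := by
          by_contra hk
          exact hw hk j hj
        refine Filter.Eventually.of_forall fun x hD hx e => hx ?_
        rw [← hj] at e
        have e' := Subtype.mk.inj (X.par_inj _ e)
        rwa [(blowMap_eq_iff _ k w).2 hk, blowMap_eq_iff] at e'
      · exact (ht.eventually (eventually_par_ne hj)).mono fun x hx hD _ => hx hD
    filter_upwards [ht (X.dom_open _ _ h), Filter.eventually_all.2 key] with x h1 h2
    exact ⟨h1, fun hx j => h2 j h1 hx⟩

theorem blowUpPar_exc {i : I} {k : Fin 2} (w : blowUpDom X p (.inr (i, k))) (h : w.1 k = 0) :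
    blowUpPar X p (.inr (i, k)) w =
      .inr (i, Projectivization.mk ℂ (dir k w.1) (dir_ne_zero k w.1)) := dif_pos h

theorem blowUpPar_gen {i : I} {k : Fin 2} (w : blowUpDom X p (.inr (i, k))) (h : w.1 k ≠ 0) :
    blowUpPar X p (.inr (i, k)) w =
      .inl ⟨X.par (p i).1 ⟨blowMap (p i).2 k w.1, w.2.1⟩, w.2.2 h⟩ := dif_neg h

theorem blowMap_inj {a : A2} {k : Fin 2} {w w' : A2} (hw : w k ≠ 0)
    (h : blowMap a k w = blowMap a k w') : w = w' := by
  have h1 : w k = w' k := by simpa [blowMap, dir] using congrFun h k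
  funext l
  by_cases hl : l = k
  · rw [hl, h1]
  · have := congrFun h l
    simp only [blowMap, dir, Pi.add_apply, Pi.smul_apply, smul_eq_mul, add_right_inj,
      Function.update_of_ne hl, ← h1] at this
    exact mul_left_cancel₀ hw this

theorem blowUpPar_inj (c : X.Chart ⊕ (I × Fin 2)) : Function.Injective (blowUpPar X p c) := by
  rcases c with c | ⟨i, k⟩
  · intro w w' h
    have h1 := X.par_inj c (congrArg Subtype.val (Sum.inl.inj h))
    exact Subtype.ext (Subtype.mk.inj h1)
  · intro w w' h
    by_cases hw : w.1 k = 0 <;> by_cases hw' : w'.1 k = 0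
    · rw [blowUpPar_exc w hw, blowUpPar_exc w' hw'] at h
      have h1 := (Prod.mk.inj (Sum.inr.inj h)).2
      rw [Projectivization.mk_eq_mk_iff'] at h1
      obtain ⟨a, ha⟩ := h1
      have ha1 : a = 1 := by simpa [dir] using congrFun ha k
      subst ha1
      rw [one_smul] at ha
      refine Subtype.ext (funext fun l => ?_)
      by_cases hl : l = k
      · rw [hl, hw, hw']
      · simpa [dir, hl] using (congrFun ha l).symm
    · rw [blowUpPar_exc w hw, blowUpPar_gen w' hw'] at h
      cases h
    · rw [blowUpPar_gen w hw, blowUpPar_exc w' hw'] at h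
      cases h
    · rw [blowUpPar_gen w hw, blowUpPar_gen w' hw'] at h
      have h1 := X.par_inj _ (congrArg Subtype.val (Sum.inl.inj h))
      exact Subtype.ext (blowMap_inj hw (Subtype.mk.inj h1))

theorem blowUp_cover (x : BlowUpPt X p) : ∃ c w, blowUpPar X p c w = x := by
  rcases x with ⟨x, hx⟩ | ⟨i, l⟩
  · obtain ⟨c, w, rfl⟩ := X.cover x
    exact ⟨.inl c, ⟨w.1, w.2, hx⟩, rfl⟩
  · induction l using Projectivization.ind with
    | h v hv =>
      obtain ⟨k, hk⟩ := Function.ne_iff.1 hv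
      let w : A2 := Function.update ((v k)⁻¹ • v) k 0
      have hw : w k = 0 := by simp [w]
      have hb : blowMap (p i).2 k w = (p i).2 := (blowMap_eq_iff _ _ _).2 hw
      refine ⟨.inr (i, k), ⟨w, by rw [hb]; exact (p i).2.2, fun h => absurd hw h⟩, ?_⟩
      rw [blowUpPar_exc _ hw]
      congr 2
      rw [Projectivization.mk_eq_mk_iff']
      refine ⟨(v k)⁻¹, funext fun l => ?_⟩
      by_cases hl : l = k
      · subst hl
        simpa [dir] using inv_mul_cancel₀ hk
      · simp [dir, w, hl]

theorem blowUp_compat_inl (c d : X.Chart) (w : blowUpDom X p (.inl c))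
    (h : blowUpPar X p (.inl c) w ∈ Set.range (blowUpPar X p (.inl d))) :
    LocalRep (blowUpPar X p (.inl c)) (blowUpPar X p (.inl d)) w := by
  obtain ⟨w, hw, hw'⟩ := w
  obtain ⟨v, hv⟩ := h
  have hv' := congrArg Subtype.val (Sum.inl.inj hv)
  obtain ⟨r, hr, h⟩ := X.compat c d ⟨w, hw⟩ ⟨⟨v.1, v.2.1⟩, hv'⟩
  refine ⟨r, hr, ?_⟩
  filter_upwards [h] with x hx hD
  obtain ⟨m, e⟩ := hx hD.1
  exact ⟨⟨m, by rw [e]; exact hD.2⟩, congrArg Sum.inl (Subtype.ext e)⟩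

theorem blowUp_compat_down (i : I) (k : Fin 2) (w : blowUpDom X p (.inr (i, k)))
    (h : w.1 k ≠ 0) :
    LocalRep (blowUpPar X p (.inr (i, k))) (blowUpPar X p (.inl (p i).1)) w := by
  refine ⟨blowMap (p i).2 k, regAt_blowMap _ k _, ?_⟩
  filter_upwards [(RegAt.coord k w.1).eventually_ne h] with x hx hD
  exact ⟨⟨hD.1, hD.2 hx⟩, (blowUpPar_gen ⟨x, hD⟩ hx).symm⟩

theorem blowUp_compat_up (i : I) (k : Fin 2) (v : blowUpDom X p (.inl (p i).1))
    (h : v.1 k ≠ (p i).2.1 k) :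
    LocalRep (blowUpPar X p (.inl (p i).1)) (blowUpPar X p (.inr (i, k))) v := by
  set a : A2 := (p i).2.1 with ha
  have hk : RegAt (fun x => x k - a k) v.1 := (RegAt.coord k _).sub (RegAt.const _ _)
  refine ⟨fun x => Function.update (fun l => (x l - a l) / (x k - a k)) k (x k - a k),
    fun l => ?_, ?_⟩
  · by_cases hl : l = k
    · subst hl
      simpa using hk
    · simpa [hl] using
        ((RegAt.coord l v.1).sub (RegAt.const (a l) _)).div hk (sub_ne_zero.2 h)
  · filter_upwards [hk.eventually_ne (sub_ne_zero.2 h)] with x hx hD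
    have hb : blowMap (p i).2 k
        (Function.update (fun l => (x l - a l) / (x k - a k)) k (x k - a k)) = x := by
      funext l
      by_cases hl : l = k
      · subst hl
        simp [blowMap, dir, ← ha]
      · simp only [blowMap, dir, ← ha, Pi.add_apply, Pi.smul_apply, Function.update_self,
          Function.update_of_ne hl, smul_eq_mul]
        field_simp
        ring
    have hmem : Function.update (fun l => (x l - a l) / (x k - a k)) k (x k - a k) ∈
        blowUpDom X p (.inr (i, k)) := by
      obtain ⟨h1, h2⟩ := hD
      refine ⟨by rw [hb]; exact h1, fun _ => ?_⟩
      simpa only [hb] using h2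
    refine ⟨hmem, ?_⟩
    rw [blowUpPar_gen ⟨_, hmem⟩ (by simpa using hx)]
    exact congrArg Sum.inl (Subtype.ext (congrArg (X.par (p i).1) (Subtype.ext hb)))

theorem LocalRep.refl {T : Type} {D : Set A2} (f : D → T) (w : D) : LocalRep f f w :=
  ⟨id, fun k => RegAt.coord k _, Filter.Eventually.of_forall fun _ h => ⟨h, rfl⟩⟩

theorem blowUp_compat_exc (i : I) (k k' : Fin 2) (w : blowUpDom X p (.inr (i, k)))
    (hw : w.1 k = 0)
    (h : blowUpPar X p (.inr (i, k)) w ∈ Set.range (blowUpPar X p (.inr (i, k')))) :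
    LocalRep (blowUpPar X p (.inr (i, k))) (blowUpPar X p (.inr (i, k'))) w := by
  by_cases hkk : k = k'
  · subst hkk
    exact LocalRep.refl _ _
  have h2 : ∀ l, l = k ∨ l = k' := by omega
  obtain ⟨v, hv⟩ := h
  rw [blowUpPar_exc w hw] at hv
  have hv0 : v.1 k' = 0 := by
    by_contra hv0
    rw [blowUpPar_gen v hv0] at hv
    cases hv
  rw [blowUpPar_exc v hv0] at hv
  have hm : w.1 k' ≠ 0 := by
    intro h0
    have h1 := (Prod.mk.inj (Sum.inr.inj hv)).2
    rw [Projectivization.mk_eq_mk_iff'] at h1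
    obtain ⟨c, hc⟩ := h1
    have := congrFun hc k'
    simp [dir, Ne.symm hkk, h0] at this
  let r : A2 → A2 := fun x => Function.update (fun _ => (x k')⁻¹) k' (x k * x k')
  have hb : ∀ x : A2, x k' ≠ 0 → blowMap (p i).2 k' (r x) = blowMap (p i).2 k x := by
    intro x hx
    funext l
    rcases h2 l with rfl | rfl
    · simp [blowMap, dir, r, hkk, hx]
    · simp [blowMap, dir, r, Ne.symm hkk]
  refine ⟨r, fun l => ?_, ?_⟩
  · rcases h2 l with rfl | rfl
    · simpa [r, hkk] using (RegAt.coord k' w.1).inv hm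
    · simpa [r] using (RegAt.coord k w.1).mul (RegAt.coord l w.1)
  · filter_upwards [(RegAt.coord k' w.1).eventually_ne hm] with x hx hD
    have hmem : r x ∈ blowUpDom X p (.inr (i, k')) := by
      obtain ⟨h1, h2⟩ := hD
      refine ⟨by rw [hb x hx]; exact h1, fun hr => ?_⟩
      have hxk : x k ≠ 0 := fun h0 => hr (by simp [r, h0])
      simpa only [hb x hx] using h2 hxk
    refine ⟨hmem, ?_⟩
    by_cases hxk : x k = 0
    · rw [blowUpPar_exc ⟨x, hD⟩ hxk, blowUpPar_exc ⟨_, hmem⟩ (by simp [r, hxk])]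
      congr 2
      rw [Projectivization.mk_eq_mk_iff']
      refine ⟨(x k')⁻¹, funext fun l => ?_⟩
      rcases h2 l with rfl | rfl
      · simp [dir, r, hkk]
      · simp [dir, Ne.symm hkk, hx]
    · rw [blowUpPar_gen ⟨x, hD⟩ hxk, blowUpPar_gen ⟨_, hmem⟩ (by simp [r, hxk, hx])]
      exact congrArg Sum.inl (Subtype.ext (congrArg (X.par (p i).1) (Subtype.ext (hb x hx))))

theorem blowUp_compat_inl_inr (c : X.Chart) (i : I) (k : Fin 2) (w : blowUpDom X p (.inl c))
    (h : blowUpPar X p (.inl c) w ∈ Set.range (blowUpPar X p (.inr (i, k)))) :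
    LocalRep (blowUpPar X p (.inl c)) (blowUpPar X p (.inr (i, k))) w := by
  obtain ⟨v, hv⟩ := h
  have hv0 : v.1 k ≠ 0 := by
    intro hv0
    rw [blowUpPar_exc v hv0] at hv
    cases hv
  rw [blowUpPar_gen v hv0] at hv
  refine (blowUp_compat_inl c (p i).1 w ⟨⟨_, v.2.1, v.2.2 hv0⟩, hv⟩).trans fun w' hw' => ?_
  refine blowUp_compat_up i k w' ?_
  have e := X.par_inj _ (congrArg Subtype.val (Sum.inl.inj (hv.trans hw'.symm)))
  have e' := congrFun (Subtype.mk.inj e) k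
  rw [← e']
  simpa [blowMap, dir] using hv0

theorem blowUp_compat (c d : X.Chart ⊕ (I × Fin 2)) (w : blowUpDom X p c)
    (h : blowUpPar X p c w ∈ Set.range (blowUpPar X p d)) :
    LocalRep (blowUpPar X p c) (blowUpPar X p d) w := by
  rcases c with c | ⟨i, k⟩
  · rcases d with d | ⟨j, l⟩
    · exact blowUp_compat_inl c d w h
    · exact blowUp_compat_inl_inr c j l w h
  · by_cases hw : w.1 k = 0
    · rcases d with d | ⟨j, l⟩
      · obtain ⟨v, hv⟩ := h
        rw [blowUpPar_exc w hw] at hv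
        cases hv
      · have hij : i = j := by
          obtain ⟨v, hv⟩ := h
          rw [blowUpPar_exc w hw] at hv
          by_cases hv0 : v.1 l = 0
          · rw [blowUpPar_exc v hv0] at hv
            exact (Prod.mk.inj (Sum.inr.inj hv)).1.symm
          · rw [blowUpPar_gen v hv0] at hv
            cases hv
        subst hij
        exact blowUp_compat_exc i k l w hw h
    · refine (blowUp_compat_down i k w hw).trans fun w' hw' => ?_
      rw [← hw'] at h
      rcases d with d | ⟨j, l⟩
      · exact blowUp_compat_inl _ d w' h
      · exact blowUp_compat_inl_inr _ j l w' h

variable (X p)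

/-- The blow up of the surface `X` at the points `centre X p i`, for pairwise distinct centres. -/
def blowUp [Finite I] : AlgSurface where
  Pt := BlowUpPt X p
  Chart := X.Chart ⊕ (I × Fin 2)
  dom := blowUpDom X p
  par := blowUpPar X p
  dom_open := blowUpDom_open
  par_inj := blowUpPar_inj
  cover := blowUp_cover
  compat := blowUp_compat

variable [Finite I]

/-- The blow down map. -/
def blowDown : (blowUp X p).Pt → X.Pt
  | .inl x => x.1
  | .inr (i, _) => centre X p i

/-- The exceptional line over the `i`-th centre. -/
def exceptional (i : I) : Set (blowUp X p).Pt :=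
  Set.range fun l : Projectivization ℂ A2 => (.inr (i, l) : BlowUpPt X p)

/-- The strict transform of a curve: the Zariski closure of the preimage of the curve without
the centres. -/
def strictTransform (Z : Set X.Pt) : Set (blowUp X p).Pt :=
  closure (blowDown X p ⁻¹' (Z \ Set.range (centre X p)))

end BlowUp

/-! ### Hirzebruch surfaces -/

/-- Homogeneous coordinates `(u, w)` on the `n`-th Hirzebruch surface. -/
def HirzCoord : Type := {x : A2 × A2 // x.1 ≠ 0 ∧ x.2 ≠ 0}

/-- Two homogeneous coordinates are equivalent if they differ by the action
`(λ, μ) • (u, w) = (λ u 0, λ u 1, λ ^ n μ w 0, μ w 1)` of the two-dimensional torus. -/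
def hirzSetoid (n : ℕ) : Setoid HirzCoord where
  r x y := ∃ s m : ℂ, s ≠ 0 ∧ m ≠ 0 ∧ y.1.1 = s • x.1.1 ∧
    y.1.2 0 = s ^ n * m * x.1.2 0 ∧ y.1.2 1 = m * x.1.2 1
  iseqv := by
    refine ⟨fun x => ⟨1, 1, by simp⟩, ?_, ?_⟩
    · rintro x y ⟨s, m, hs, hm, h1, h2, h3⟩
      refine ⟨s⁻¹, m⁻¹, inv_ne_zero hs, inv_ne_zero hm, ?_, ?_, ?_⟩
      · rw [h1, smul_smul, inv_mul_cancel₀ hs, one_smul]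
      · rw [h2, inv_pow]
        field_simp
      · rw [h3]
        field_simp
    · rintro x y z ⟨s, m, hs, hm, h1, h2, h3⟩ ⟨s', m', hs', hm', h1', h2', h3'⟩
      refine ⟨s' * s, m' * m, mul_ne_zero hs' hs, mul_ne_zero hm' hm, ?_, ?_, ?_⟩
      · rw [h1', h1, smul_smul]
      · rw [h2', h2]
        ring
      · rw [h3', h3]
        ring

/-- Homogeneous coordinates of the point with coordinates `x` in the chart with number `c`. The
coordinates of the four charts are, in terms of the standard coordinates `(u, v)` of chart `0`:
`(u, v)`, `(u, 1 / v)`, `(1 / u, v / u ^ n)` and `(1 / u, u ^ n / v)`. -/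
def hirzHom (c : Fin 4) (x : A2) : HirzCoord :=
  ⟨![(![x 0, 1], ![x 1, 1]), (![x 0, 1], ![1, x 1]), (![1, x 0], ![x 1, 1]),
    (![1, x 0], ![1, x 1])] c, by fin_cases c <;> simp⟩

/-- The parametrisations of the four charts. -/
def hirzPar (n : ℕ) (c : Fin 4) (x : A2) : Quotient (hirzSetoid n) :=
  Quotient.mk _ (hirzHom c x)

theorem hirzPar_eq_iff (n : ℕ) (c d : Fin 4) (x y : A2) :
    hirzPar n c x = hirzPar n d y ↔ ∃ s m : ℂ, s ≠ 0 ∧ m ≠ 0 ∧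
      (hirzHom d y).1.1 = s • (hirzHom c x).1.1 ∧
      (hirzHom d y).1.2 0 = s ^ n * m * (hirzHom c x).1.2 0 ∧
      (hirzHom d y).1.2 1 = m * (hirzHom c x).1.2 1 := Quotient.eq

theorem hirzPar_inj (n : ℕ) (c : Fin 4) : Function.Injective (hirzPar n c) := by
  intro x y h
  obtain ⟨s, m, hs, hm, h1, h2, h3⟩ := (hirzPar_eq_iff n c c x y).1 h
  have h10 := congrFun h1 0
  have h11 := congrFun h1 1
  have hs1 : s = 1 := by
    fin_cases c <;> first | simpa [hirzHom] using h11.symm | simpa [hirzHom] using h10.symm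
  subst hs1
  have hm1 : m = 1 := by
    fin_cases c <;> first | simpa [hirzHom] using h3.symm | simpa [hirzHom] using h2.symm
  subst hm1
  funext k
  fin_cases c <;> simp [hirzHom] at h10 h11 h2 h3 <;> fin_cases k <;> simp [*]

theorem A2_ne_zero (v : A2) (hv : v ≠ 0) : v 0 ≠ 0 ∨ v 1 ≠ 0 := by
  by_contra! h
  exact hv (funext fun k => by fin_cases k <;> simp [h])

theorem hirzPar_cover (n : ℕ) (z : Quotient (hirzSetoid n)) : ∃ c x, hirzPar n c x = z := by
  induction z using Quotient.inductionOn with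
  | h z =>
    obtain ⟨⟨u, w⟩, hu, hw⟩ := z
    rcases A2_ne_zero u hu with h | h <;> rcases A2_ne_zero w hw with h' | h'
    · refine ⟨3, ![u 1 / u 0, u 0 ^ n * w 1 / w 0], Quotient.sound
        ⟨u 0, w 0 / u 0 ^ n, h, div_ne_zero h' (pow_ne_zero n h), ?_, ?_, ?_⟩⟩
      · funext k
        fin_cases k <;> simp [hirzHom]
        field_simp
      · simp [hirzHom]
        field_simp
      · simp [hirzHom]
        field_simp
    · refine ⟨2, ![u 1 / u 0, w 0 / (u 0 ^ n * w 1)], Quotient.sound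
        ⟨u 0, w 1, h, h', ?_, ?_, ?_⟩⟩
      · funext k
        fin_cases k <;> simp [hirzHom]
        field_simp
      · simp [hirzHom]
        field_simp
      · simp [hirzHom]
    · refine ⟨1, ![u 0 / u 1, u 1 ^ n * w 1 / w 0], Quotient.sound
        ⟨u 1, w 0 / u 1 ^ n, h, div_ne_zero h' (pow_ne_zero n h), ?_, ?_, ?_⟩⟩
      · funext k
        fin_cases k <;> simp [hirzHom]
        field_simp
      · simp [hirzHom]
        field_simp
      · simp [hirzHom]
        field_simp
    · refine ⟨0, ![u 0 / u 1, w 0 / (u 1 ^ n * w 1)], Quotient.sound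
        ⟨u 1, w 1, h, h', ?_, ?_, ?_⟩⟩
      · funext k
        fin_cases k <;> simp [hirzHom]
        field_simp
      · simp [hirzHom]
        field_simp
      · simp [hirzHom]

theorem hirz_compat (n : ℕ) (c d : Fin 4) (w : (Set.univ : Set A2))
    (h : hirzPar n c w ∈ Set.range fun x : (Set.univ : Set A2) => hirzPar n d x) :
    LocalRep (fun x : (Set.univ : Set A2) => hirzPar n c x)
      (fun x : (Set.univ : Set A2) => hirzPar n d x) w := by
  obtain ⟨⟨y, _⟩, hy⟩ := h
  obtain ⟨w, hw⟩ := w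
  obtain ⟨s, m, hs, hm, h1, h2, h3⟩ := (hirzPar_eq_iff n c d w y).1 hy.symm
  have h10 := congrFun h1 0
  have h11 := congrFun h1 1
  -- the first coordinate, the factor of the torus and its regularity
  obtain ⟨l, r₀, hl, hr₀, hl0, hu⟩ : ∃ l r₀ : A2 → ℂ, RegAt l w ∧ RegAt r₀ w ∧
      (∀ᶠ x in zNhds w, l x ≠ 0) ∧ ∀ᶠ x in zNhds w, ∀ r₁ : ℂ,
        (hirzHom d ![r₀ x, r₁]).1.1 = l x • (hirzHom c x).1.1 := by
    by_cases hcd : (c < 2 ↔ d < 2)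
    · refine ⟨fun _ => 1, fun x => x 0, RegAt.const 1 w, RegAt.coord 0 w, by simp,
        Filter.Eventually.of_forall fun x r₁ => ?_⟩
      fin_cases c <;> fin_cases d <;> first | (simp [hirzHom]; done) | simp at hcd
    · have hw0 : w 0 ≠ 0 := by
        intro h0
        fin_cases c <;> fin_cases d <;>
          first | (simp at hcd; done) | simp [hirzHom, h0] at h10 h11
      refine ⟨fun x => (x 0)⁻¹, fun x => (x 0)⁻¹, (RegAt.coord 0 w).inv hw0,
        (RegAt.coord 0 w).inv hw0, ?_, ?_⟩ <;>
        filter_upwards [(RegAt.coord 0 w).eventually_ne hw0] with x hx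
      · exact inv_ne_zero hx
      · intro r₁
        fin_cases c <;> fin_cases d <;> first | (simp [hirzHom, hx]; done) | simp at hcd
  have hln := hl.pow n
  have hln0 : l w ^ n ≠ 0 := pow_ne_zero n (mem_zNhds_self hl0)
  -- the second coordinate and the second factor of the torus
  obtain ⟨k, r₁, hr₁, hk⟩ : ∃ k r₁ : A2 → ℂ, RegAt r₁ w ∧ ∀ᶠ x in zNhds w, k x ≠ 0 ∧
      ∀ r₀ : ℂ, (hirzHom d ![r₀, r₁ x]).1.2 0 = l x ^ n * k x * (hirzHom c x).1.2 0 ∧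
        (hirzHom d ![r₀, r₁ x]).1.2 1 = k x * (hirzHom c x).1.2 1 := by
    have x1 := RegAt.coord 1 w
    have hw1 : (c = 0 ∨ c = 2) → (d = 1 ∨ d = 3) → w 1 ≠ 0 := by
      intro hc hd h0
      rcases hc with rfl | rfl <;> rcases hd with rfl | rfl <;> simp [hirzHom, h0] at h2
    have hw1' : (c = 1 ∨ c = 3) → (d = 0 ∨ d = 2) → w 1 ≠ 0 := by
      intro hc hd h0
      rcases hc with rfl | rfl <;> rcases hd with rfl | rfl <;> simp [hirzHom, h0] at h3
    have hc : (c = 0 ∨ c = 2) ∨ (c = 1 ∨ c = 3) := by omega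
    have hd : (d = 0 ∨ d = 2) ∨ (d = 1 ∨ d = 3) := by omega
    rcases hc with hc | hc <;> rcases hd with hd | hd
    · refine ⟨fun _ => 1, fun x => l x ^ n * x 1, hln.mul x1,
        Filter.Eventually.of_forall fun x => ⟨one_ne_zero, fun r₀ => ?_⟩⟩
      rcases hc with rfl | rfl <;> rcases hd with rfl | rfl <;> simp [hirzHom]
    · have h := hw1 hc hd
      refine ⟨fun x => (l x ^ n * x 1)⁻¹, fun x => (l x ^ n * x 1)⁻¹,
        (hln.mul x1).inv (mul_ne_zero hln0 h), ?_⟩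
      filter_upwards [hl0, x1.eventually_ne h] with x hx hx1
      refine ⟨inv_ne_zero (mul_ne_zero (pow_ne_zero n hx) hx1), fun r₀ => ?_⟩
      rcases hc with rfl | rfl <;> rcases hd with rfl | rfl <;> simp [hirzHom] <;> field_simp
    · have h := hw1' hc hd
      refine ⟨fun x => (x 1)⁻¹, fun x => l x ^ n * (x 1)⁻¹, hln.mul (x1.inv h), ?_⟩
      filter_upwards [x1.eventually_ne h] with x hx1
      refine ⟨inv_ne_zero hx1, fun r₀ => ?_⟩
      rcases hc with rfl | rfl <;> rcases hd with rfl | rfl <;> simp [hirzHom, hx1]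
    · refine ⟨fun x => (l x ^ n)⁻¹, fun x => (l x ^ n)⁻¹ * x 1, (hln.inv hln0).mul x1, ?_⟩
      filter_upwards [hl0] with x hx
      refine ⟨inv_ne_zero (pow_ne_zero n hx), fun r₀ => ?_⟩
      rcases hc with rfl | rfl <;> rcases hd with rfl | rfl <;> simp [hirzHom, hx]
  refine ⟨fun x => ![r₀ x, r₁ x], fun k => by fin_cases k <;> assumption, ?_⟩
  filter_upwards [hl0, hu, hk] with x hx hx0 hx1 _
  exact ⟨trivial, ((hirzPar_eq_iff n c d x _).2
    ⟨l x, k x, hx, hx1.1, hx0 _, (hx1.2 _).1, (hx1.2 _).2⟩).symm⟩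

/-- The `n`-th Hirzebruch surface; for `n = 0` this is the product of two projective lines. -/
def hirz (n : ℕ) : AlgSurface where
  Pt := Quotient (hirzSetoid n)
  Chart := Fin 4
  dom _ := Set.univ
  par c x := hirzPar n c x
  dom_open _ _ _ := Filter.univ_mem
  par_inj c x y h := Subtype.ext (hirzPar_inj n c h)
  cover z := by
    obtain ⟨c, x, h⟩ := hirzPar_cover n z
    exact ⟨c, ⟨x, trivial⟩, h⟩
  compat := hirz_compat n

/-- The point of the `n`-th Hirzebruch surface with coordinates `(x, y)` in the chart with
number `c`, as a chart together with coordinates. -/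
def chartPt (n : ℕ) (c : Fin 4) (x y : ℂ) : (c : (hirz n).Chart) × (hirz n).dom c :=
  ⟨c, ⟨![x, y], trivial⟩⟩

/-- The point with coordinates `(x, y)` in the chart with number `c`. -/
def hirzPt (n : ℕ) (c : Fin 4) (x y : ℂ) : (hirz n).Pt :=
  (hirz n).par (chartPt n c x y).1 (chartPt n c x y).2

/-- The set of points whose coordinates in the chart with number `c` satisfy a condition. -/
def chartLocus (n : ℕ) (c : Fin 4) (f : ℂ → ℂ → Prop) : Set (hirz n).Pt :=
  {P | ∃ x y, f x y ∧ P = hirzPt n c x y}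

/-- The line where the first standard coordinate is equal to `a`. -/
def vLine (n : ℕ) (a : ℂ) : Set (hirz n).Pt :=
  chartLocus n 0 (fun x _ => x = a) ∪ chartLocus n 1 (fun x _ => x = a)

/-- The line where the first standard coordinate is infinite. -/
def vLineInf (n : ℕ) : Set (hirz n).Pt :=
  chartLocus n 2 (fun x _ => x = 0) ∪ chartLocus n 3 (fun x _ => x = 0)

/-- The curve where the second standard coordinate vanishes. -/
def hLineZero (n : ℕ) : Set (hirz n).Pt :=
  chartLocus n 0 (fun _ y => y = 0) ∪ chartLocus n 2 (fun _ y => y = 0)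

/-- The curve where the second standard coordinate is infinite. -/
def hLineInf (n : ℕ) : Set (hirz n).Pt :=
  chartLocus n 1 (fun _ y => y = 0) ∪ chartLocus n 3 (fun _ y => y = 0)

/-! ### The two families of surfaces -/

/-- The set `{0, 1, t, ∞}` of indices. -/
inductive Idx : Type
  | zero
  | one
  | t
  | inf

instance : Finite Idx :=
  Finite.of_surjective (fun k : Fin 4 => ![Idx.zero, Idx.one, Idx.t, Idx.inf] k) (by
    rintro (_ | _ | _ | _)
    exacts [⟨0, rfl⟩, ⟨1, rfl⟩, ⟨2, rfl⟩, ⟨3, rfl⟩])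

/-- The set of excluded values of `t`. -/
def excludedSet (q : ℂ) (Θ : Idx → ℂ) : Set ℂ :=
  {s | ∃ e e' k : ℤ, (e = 1 ∨ e = -1) ∧ (e' = 1 ∨ e' = -1) ∧
    (s = Θ .one ^ e * Θ .t ^ e' * q ^ k ∨ s = Θ .zero ^ e * Θ .inf ^ e' * q ^ k)}

section Surfaces

variable (q t : ℂ) (Θ : Idx → ℂ)

/-- The points `γ_i^±` of the product of two projective lines; `true` stands for `+`. -/
def gammaPt : Idx × Bool → (c : (hirz 0).Chart) × (hirz 0).dom c
  | (.zero, false) => chartPt 0 0 0 (t * Θ .zero / q)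
  | (.zero, true) => chartPt 0 0 0 (t * (Θ .zero)⁻¹ / q)
  | (.one, false) => chartPt 0 1 (Θ .one)⁻¹ 0
  | (.one, true) => chartPt 0 1 (Θ .one) 0
  | (.t, false) => chartPt 0 0 (t * Θ .t) 0
  | (.t, true) => chartPt 0 0 (t * (Θ .t)⁻¹) 0
  | (.inf, false) => chartPt 0 2 0 (Θ .inf)⁻¹
  | (.inf, true) => chartPt 0 2 0 (Θ .inf / q)

/-- The points `β_i^±` of the second Hirzebruch surface; `true` stands for `+`. -/
def betaPt : Idx × Bool → (c : (hirz 2).Chart) × (hirz 2).dom c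
  | (.zero, false) => chartPt 2 0 0 (t * ((Θ .zero)⁻¹ - 1) / (q - 1))
  | (.zero, true) => chartPt 2 0 0 (t * (Θ .zero - 1) / (q - 1))
  | (.one, false) =>
      chartPt 2 0 (Θ .one)⁻¹ (((Θ .one)⁻¹ - 1) * (t - (Θ .one)⁻¹) / (q - 1))
  | (.one, true) => chartPt 2 0 (Θ .one) ((Θ .one - 1) * (t - Θ .one) / (q - 1))
  | (.t, false) =>
      chartPt 2 0 (t * Θ .t) (-(t * (Θ .t - 1) * (t * Θ .t - 1) / (q - 1)))
  | (.t, true) =>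
      chartPt 2 0 (t * (Θ .t)⁻¹) (-(t * ((Θ .t)⁻¹ - 1) * (t * (Θ .t)⁻¹ - 1) / (q - 1)))
  | (.inf, false) => chartPt 2 2 0 (((Θ .inf)⁻¹ - 1) / (q - 1))
  | (.inf, true) => chartPt 2 2 0 ((Θ .inf - q) / (q * (q - 1)))

/-- The surface `P_t` of Sakai. -/
abbrev sakaiSurface : AlgSurface := blowUp (hirz 0) (gammaPt q t Θ)

/-- The surface obtained from the second Hirzebruch surface. -/
abbrev modSurface : AlgSurface := blowUp (hirz 2) (betaPt q t Θ)

/-- The first coordinate of `γ_t^±` and of `β_t^±`. -/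
def tNode : Bool → ℂ
  | false => t * Θ .t
  | true => t * (Θ .t)⁻¹

/-- The curve in the second Hirzebruch surface with equation `(u - 1) (u - t) = (1 - q) v`. -/
def curveC : Set (hirz 2).Pt :=
  chartLocus 2 0 (fun u v => (u - 1) * (u - t) = (1 - q) * v) ∪
  chartLocus 2 1 (fun u v => (u - 1) * (u - t) * v = 1 - q) ∪
  chartLocus 2 3 (fun u v => (1 - u) * (1 - t * u) * v = 1 - q)

/-- The set `J^t`. -/
def setJ : Set (sakaiSurface q t Θ).Pt :=
  strictTransform (hirz 0) (gammaPt q t Θ) (hLineZero 0) ∪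
  strictTransform (hirz 0) (gammaPt q t Θ) (hLineInf 0) ∪
  strictTransform (hirz 0) (gammaPt q t Θ) (vLine 0 0) ∪
  strictTransform (hirz 0) (gammaPt q t Θ) (vLineInf 0)

/-- The set `I^t`. -/
def setI : Set (modSurface q t Θ).Pt :=
  strictTransform (hirz 2) (betaPt q t Θ) (hLineInf 2) ∪
  strictTransform (hirz 2) (betaPt q t Θ) (vLine 2 0) ∪
  strictTransform (hirz 2) (betaPt q t Θ) (vLineInf 2) ∪
  strictTransform (hirz 2) (betaPt q t Θ) (curveC q t)

theorem isOpen_compl_setJ : IsOpen (setJ q t Θ)ᶜ :=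
  (((isClosed_closure.union isClosed_closure).union isClosed_closure).union
    isClosed_closure).isOpen_compl

theorem isOpen_compl_setI : IsOpen (setI q t Θ)ᶜ :=
  (((isClosed_closure.union isClosed_closure).union isClosed_closure).union
    isClosed_closure).isOpen_compl

/-- The `q`-Okamoto space. -/
def qOka : AlgSurface := openSub (sakaiSurface q t Θ) (setJ q t Θ)ᶜ (isOpen_compl_setJ q t Θ)

/-- The modified `q`-Okamoto space. -/
def qOkaMod : AlgSurface := openSub (modSurface q t Θ) (setI q t Θ)ᶜ (isOpen_compl_setI q t Θ)

/-- The inclusion of the `q`-Okamoto space. -/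
def qOkaIncl : (qOka q t Θ).Pt → (sakaiSurface q t Θ).Pt :=
  inclusion _ _ (isOpen_compl_setJ q t Θ)

/-- The inclusion of the modified `q`-Okamoto space. -/
def qOkaModIncl : (qOkaMod q t Θ).Pt → (modSurface q t Θ).Pt :=
  inclusion _ _ (isOpen_compl_setI q t Θ)

end Surfaces

end QOkamoto

end

open QOkamoto

/-! The map preserves the first coordinate, and on each fibre it is a fractional linear map in the
second. Put A(y) = (y - tΘ_t)(y - t/Θ_t), B(y) = (y - 1)(y - t) and D = (q - 1)v + B, so that D = 0
is the curve C. The graph is q z D = A(y), and `Corr` is this equation in homogeneous coordinates. A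
and B have degree 2 and v has weight 2 on the second Hirzebruch surface, so the equation keeps its
shape at y = ∞, where A and B both become 1. The fractional linear map degenerates only where A = 0,
that is, on the two fibres through γ_t^±. Elsewhere the correspondence is a local isomorphism
exchanging z = 0 with v = ∞ and z = ∞ with C. It carries the six remaining γ's to the six remaining
β's, with a swap of sign at infinity, and a local isomorphism lifts to the blow ups of corresponding
points.

Near a degenerate fibre y = y₀ the equation is z D = (y - y₀) times a unit. This is an elementary
transformation: blowing up (y₀, 0) and contracting the old fibre to the point of C over y₀ gives the
other side. Since both points are blown up, the map becomes an isomorphism there too, exchanging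
each fibre with the opposite exceptional line.

Points are handled through germs. `Extends` says that a pair of points lies on the graph of a
regular germ which generically satisfies a given relation. Both blow ups are separated
(`hirz_isSeparated`, `blowUp_isSeparated`), so such a germ has only one value at a point. If germs
exist at every point in both directions, they glue to mutually inverse regular maps
(`exists_biregular`). Existence of germs is checked in charts: `LocalIso` off the degenerate fibres,
the lemmas on `IsNode` on them.

About the resulting map Φ, only one fact is used afterwards: P and Φ(P) blow down to corresponding
points (`corr_of_extends`). Uniqueness of the partner of a point (`Corr.unique_right`,
`Corr.unique_left`) then gives the formula and the six exceptional lines. Strict transforms are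
treated as closures of their parts off the degenerate fibres, since Φ is a homeomorphism. On the
degenerate fibres the equation says P = γ or Q = β, and irreducibility of an exceptional line
decides which of two closed sets contains it. -/

open MvPolynomial

noncomputable section

namespace QOkamoto

section

/-! ### Generic points of the plane -/

/-- The filter of sets that contain a nonempty Zariski open subset of the affine plane. -/
def genericFilter : Filter A2 where
  sets := {U | ∃ g : MvPolynomial (Fin 2) ℂ, g ≠ 0 ∧ ∀ x, eval x g ≠ 0 → x ∈ U}
  univ_sets := ⟨1, one_ne_zero, by simp⟩
  sets_of_superset := by
    rintro U V ⟨g, h1, h2⟩ hUV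
    exact ⟨g, h1, fun x hx => hUV (h2 x hx)⟩
  inter_sets := by
    rintro U V ⟨g, h1, h2⟩ ⟨g', h1', h2'⟩
    refine ⟨g * g', mul_ne_zero h1 h1', fun x hx => ?_⟩
    rw [map_mul, mul_ne_zero_iff] at hx
    exact ⟨h2 x hx.1, h2' x hx.2⟩

instance : genericFilter.NeBot := by
  refine ⟨fun h => ?_⟩
  obtain ⟨g, h1, h2⟩ : (∅ : Set A2) ∈ genericFilter := by rw [h]; trivial
  refine h1 (MvPolynomial.funext fun x => ?_)
  by_contra hx
  exact h2 x (by simpa using hx)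

theorem genericFilter_le (w : A2) : genericFilter ≤ zNhds w := by
  rintro U ⟨g, h1, h2⟩
  exact ⟨g, fun h => h1 (by simp [h]), h2⟩

theorem RegAt.generic_ne {r : A2 → ℂ} {w : A2} (hr : RegAt r w) (h : r w ≠ 0) :
    ∀ᶠ x in genericFilter, r x ≠ 0 := genericFilter_le w (hr.eventually_ne h)

/-- Nonempty Zariski open sets of the plane are dense: a difference that is nonzero at one point
would be nonzero generically. All closed conditions below are carried from generic points to special
ones in this way. -/
theorem RegAt.eq_of_generic {r s : A2 → ℂ} {w : A2} (hr : RegAt r w) (hs : RegAt s w)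
    (h : ∀ᶠ x in genericFilter, r x = s x) : r w = s w := by
  by_contra hne
  obtain ⟨x, h1, h2⟩ := (((hr.sub hs).generic_ne (sub_ne_zero.2 hne)).and h).exists
  exact h1 (sub_eq_zero.2 h2)

theorem generic_coord_ne (k : Fin 2) (a : ℂ) : ∀ᶠ x : A2 in genericFilter, x k ≠ a := by
  have := ((RegAt.coord k (fun _ => a + 1)).sub (RegAt.const a _)).generic_ne (by simp)
  exact this.mono fun x hx => sub_ne_zero.1 hx

theorem RegAt.eventually {r : A2 → ℂ} {w : A2} (hr : RegAt r w) :
    ∀ᶠ x in zNhds w, RegAt r x := by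
  obtain ⟨P, g, hg, h, h1, h2⟩ := hr
  filter_upwards [zNhds_ne w g hg, zNhds_ne w h h1] with x hx hx'
  exact ⟨P, g, hx, h, hx', h2⟩

/-- A regular map with a regular local section is dominant. -/
theorem tendsto_generic {r s : A2 → A2} {w : A2} (hr : ∀ k, RegAt (fun x => r x k) w)
    (hs : ∀ k, RegAt (fun x => s x k) (r w)) (hw : s (r w) = w)
    (h : ∀ᶠ y in zNhds (r w), r (s y) = y) :
    Filter.Tendsto r genericFilter genericFilter := by
  rintro U ⟨g, h1, h2⟩
  have hgr := RegAt.polyComp hr g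
  -- If the pullback of `g` vanished near `w`, composing with the section `s` would make `g` itself
  -- vanish near `r w`, hence generically.
  by_cases h0 : ∀ᶠ x in zNhds w, eval (r x) g = 0
  · exfalso
    have ht := tendsto_zNhds hs
    rw [hw] at ht
    have h3 : ∀ᶠ y in genericFilter, eval y g = 0 := by
      refine genericFilter_le (r w) ?_
      filter_upwards [ht h0, h] with y hy hy'
      simpa only [Set.mem_preimage, Set.mem_ofPred_eq, hy'] using hy
    have h4 : ∀ᶠ y in genericFilter, eval y g ≠ 0 := ⟨g, h1, fun _ hx => hx⟩
    obtain ⟨y, hy, hy'⟩ := (h3.and h4).exists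
    exact hy' hy
  -- The point of nonvanishing must be one where the pullback is still regular. Such a point exists
  -- because regularity holds throughout a neighbourhood of `w`.
  · obtain ⟨x, hx, hx'⟩ : ∃ x, RegAt (fun x => eval (r x) g) x ∧ eval (r x) g ≠ 0 := by
      by_contra! hc
      exact h0 (hgr.eventually.mono fun x hx => hc x hx)
    exact (hx.generic_ne hx').mono fun x hx => h2 _ hx

/-! ### Extension of generically defined maps -/

/-- Regular maps into the surface that agree generically agree. -/
def IsSeparated (Y : AlgSurface) : Prop :=
  ∀ (d d' : Y.Chart) (w : A2) (r r' : A2 → A2), (∀ k, RegAt (fun x => r x k) w) →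
    (∀ k, RegAt (fun x => r' x k) w) → ∀ (h : r w ∈ Y.dom d) (h' : r' w ∈ Y.dom d'),
    (∀ᶠ x in genericFilter, ∃ (hx : r x ∈ Y.dom d) (hx' : r' x ∈ Y.dom d'),
      Y.par d ⟨r x, hx⟩ = Y.par d' ⟨r' x, hx'⟩) →
    Y.par d ⟨r w, h⟩ = Y.par d' ⟨r' w, h'⟩

/-- The pair `(P, Q)` lies on the graph of a regular map, defined near `P`, whose generic points
satisfy the relation `ρ`. -/
def Extends (X Y : AlgSurface) (ρ : X.Pt → Y.Pt → Prop) (P : X.Pt) (Q : Y.Pt) : Prop :=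
  ∃ (c : X.Chart) (d : Y.Chart) (w : X.dom c) (r : A2 → A2) (h : r w ∈ Y.dom d),
    (∀ k, RegAt (fun x => r x k) w) ∧ X.par c w = P ∧ Y.par d ⟨r w, h⟩ = Q ∧
    ∀ᶠ x in genericFilter, ∃ (hx : x ∈ X.dom c) (hx' : r x ∈ Y.dom d),
      ρ (X.par c ⟨x, hx⟩) (Y.par d ⟨r x, hx'⟩)

/-- After a change of chart on the source, the two germs are defined near the same point and agree
generically, because the relation is single valued. Separatedness of the target gives equality at
the point itself. -/
theorem Extends.unique {X Y : AlgSurface} (hY : IsSeparated Y) {ρ : X.Pt → Y.Pt → Prop}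
    (hρ : ∀ P Q Q', ρ P Q → ρ P Q' → Q = Q') {P : X.Pt} {Q Q' : Y.Pt}
    (h1 : Extends X Y ρ P Q) (h2 : Extends X Y ρ P Q') : Q = Q' := by
  obtain ⟨c, d, w, r, h, hr, rfl, rfl, hg⟩ := h1
  obtain ⟨c', d', w', r', h', hr', hP, rfl, hg'⟩ := h2
  obtain ⟨s, hs, hs1⟩ := X.compat c c' w ⟨w', hP⟩
  obtain ⟨s', hs', hs1'⟩ := X.compat c' c w' ⟨w, hP.symm⟩
  have hsw : s w = w' := by
    obtain ⟨m, e⟩ := mem_zNhds_self hs1 w.2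
    exact congrArg Subtype.val (X.par_inj c' (e.trans hP.symm))
  have hsw' : s' w' = w := by
    obtain ⟨m, e⟩ := mem_zNhds_self hs1' w'.2
    exact congrArg Subtype.val (X.par_inj c (e.trans hP))
  -- The second germ satisfies the relation only at generic points of its own chart, so the
  -- transition map has to send generic points to generic points; its inverse transition supplies
  -- the section needed for that.
  have ht : Filter.Tendsto s genericFilter genericFilter := by
    refine tendsto_generic (w := w) hs (s := s') (by rwa [hsw]) (by rw [hsw, hsw']) ?_
    have ht' := tendsto_zNhds hs'
    rw [hsw'] at ht'
    rw [hsw]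
    filter_upwards [hs1', ht' hs1, X.dom_open c' _ w'.2] with y hy hy' hyc
    obtain ⟨m, e⟩ := hy hyc
    obtain ⟨m', e'⟩ := hy' m
    exact congrArg Subtype.val (X.par_inj c' (e'.trans e))
  have key := hY d d' w r (fun x => r' (s x)) hr
    (fun k => RegAt.comp (s := fun x => r' x k) hs (by rw [hsw]; exact hr' k)) h
    (by rw [hsw]; exact h') ?_
  · rw [key]
    congr 1
    exact Subtype.ext (congrArg r' hsw)
  · filter_upwards [hg, ht hg', genericFilter_le _ hs1] with x hx hx' hxs
    obtain ⟨m, m', e⟩ := hx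
    obtain ⟨n, n', e'⟩ := hx'
    obtain ⟨l, el⟩ := hxs m
    rw [el] at e'
    exact ⟨m', n', hρ _ _ _ e e'⟩

/-- A germ at `P` is also a germ at each nearby point. Uniqueness of its value there shows that the
same formula represents `f` on a whole neighbourhood. -/
theorem isRegularMap_of_extends {X Y : AlgSurface} (hY : IsSeparated Y)
    {ρ : X.Pt → Y.Pt → Prop} (hρ : ∀ P Q Q', ρ P Q → ρ P Q' → Q = Q') {f : X.Pt → Y.Pt}
    (hf : ∀ P, Extends X Y ρ P (f P)) : IsRegularMap X Y f := by
  intro P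
  obtain ⟨c, d, w, r, h, hr, hP, hQ, hg⟩ := hf P
  refine ⟨c, d, w, hP, r, hr, ?_⟩
  filter_upwards [Filter.eventually_all.2 fun k => (hr k).eventually,
    tendsto_zNhds hr (Y.dom_open d _ h)] with x hx hx' hD
  exact ⟨hx', Extends.unique hY hρ ⟨c, d, ⟨x, hD⟩, r, hx', hx, rfl, rfl, hg⟩ (hf _)⟩

/-- The definition of regularity grants only some chart at each point; composing with a transition
map allows the source chart to be prescribed. -/
theorem IsRegularMap.localRep {X Y : AlgSurface} {f : X.Pt → Y.Pt} (hf : IsRegularMap X Y f)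
    (c : X.Chart) (w : X.dom c) :
    ∃ d, LocalRep (fun v => f (X.par c v)) (Y.par d) w := by
  obtain ⟨c', d, w', hw, r, hr, h⟩ := hf (X.par c w)
  obtain ⟨s, hs, h'⟩ := X.compat c c' w ⟨w', hw⟩
  have hsw : s w = w' := by
    obtain ⟨m, e⟩ := mem_zNhds_self h' w.2
    exact congrArg Subtype.val (X.par_inj c' (e.trans hw.symm))
  rw [← hsw] at hr h
  refine ⟨d, fun x => r (s x), fun k => RegAt.comp (s := fun x => r x k) hs (hr k), ?_⟩
  filter_upwards [h', tendsto_zNhds hs h] with x hx hx' hD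
  obtain ⟨m, e⟩ := hx hD
  obtain ⟨m', e'⟩ := hx' m
  exact ⟨m', e'.trans (congrArg f e)⟩

theorem isOpen_zariski {X : AlgSurface} {U : Set X.Pt} :
    IsOpen U ↔ ∀ c (w : X.dom c), X.par c w ∈ U →
      ∀ᶠ x in zNhds w, ∀ h : x ∈ X.dom c, X.par c ⟨x, h⟩ ∈ U := Iff.rfl

theorem IsRegularMap.continuous {X Y : AlgSurface} {f : X.Pt → Y.Pt}
    (hf : IsRegularMap X Y f) : Continuous f := by
  refine continuous_def.2 fun U hU => isOpen_zariski.2 fun c w hw => ?_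
  obtain ⟨d, r, hr, h⟩ := hf.localRep c w
  obtain ⟨m, e⟩ := mem_zNhds_self h w.2
  have hw' : Y.par d ⟨r w, m⟩ ∈ U := e.symm ▸ hw
  refine (h.and (tendsto_zNhds hr (isOpen_zariski.1 hU d ⟨r w, m⟩ hw'))).mono ?_
  rintro x ⟨hx, hx'⟩ hD
  obtain ⟨m', e'⟩ := hx hD
  have hU' := hx' m'
  rw [e'] at hU'
  exact hU'

/-- The composite and the identity are regular and agree generically, so separatedness makes them
agree at `w`. -/
theorem leftInverse_of_generic {X Y : AlgSurface} (hX : IsSeparated X) {f : X.Pt → Y.Pt}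
    {g : Y.Pt → X.Pt} (hf : IsRegularMap X Y f) (hg : IsRegularMap Y X g) {c : X.Chart}
    (w : X.dom c) (h : ∀ᶠ x in genericFilter, ∀ hx : x ∈ X.dom c,
      g (f (X.par c ⟨x, hx⟩)) = X.par c ⟨x, hx⟩) : g (f (X.par c w)) = X.par c w := by
  obtain ⟨d, r, hr, h1⟩ := hf.localRep c w
  obtain ⟨m, e⟩ := mem_zNhds_self h1 w.2
  obtain ⟨c', r', hr', h2⟩ := hg.localRep d ⟨r w, m⟩
  obtain ⟨m', e'⟩ := mem_zNhds_self h2 m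
  refine (congrArg g e).symm.trans (e'.symm.trans ?_)
  refine hX c' c w (fun x => r' (r x)) (fun x => x)
    (fun k => RegAt.comp (s := fun x => r' x k) hr (hr' k)) (fun k => RegAt.coord k _) m' w.2 ?_
  filter_upwards [h, genericFilter_le _ (X.dom_open c w w.2), genericFilter_le _ h1,
    genericFilter_le _ (tendsto_zNhds hr h2)] with x hx hD hx1 hx2
  obtain ⟨n, en⟩ := hx1 hD
  obtain ⟨n', en'⟩ := hx2 n
  exact ⟨n', hD, en'.trans ((congrArg g en).trans (hx hD))⟩

/-- A generically defined correspondence that extends to a regular map in both directions is a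
biregular map. -/
theorem exists_biregular {X Y : AlgSurface} (hX : IsSeparated X) (hY : IsSeparated Y)
    {ρ : X.Pt → Y.Pt → Prop} (hρ : ∀ P Q Q', ρ P Q → ρ P Q' → Q = Q')
    (hρ' : ∀ P P' Q, ρ P Q → ρ P' Q → P = P')
    (h1 : ∀ P, ∃ Q, Extends X Y ρ P Q) (h2 : ∀ Q, ∃ P, Extends Y X (flip ρ) Q P)
    (h3 : ∀ P Q, ρ P Q → Extends X Y ρ P Q ∧ Extends Y X (flip ρ) Q P) :
    ∃ Φ : Biregular X Y, ∀ P, Extends X Y ρ P (Φ.toEquiv P) := by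
  choose f hf using h1
  choose g hg using h2
  have hρf : ∀ Q P P', flip ρ Q P → flip ρ Q P' → P = P' := fun Q P P' h h' => hρ' _ _ _ h h'
  have hfr := isRegularMap_of_extends hY hρ hf
  have hgr := isRegularMap_of_extends hX hρf hg
  -- By `h3`, a related pair lies on the graphs of both maps, so `f` and `g` invert each other at
  -- generic points of the charts supplied by the germs.
  have hfρ : ∀ P Q, ρ P Q → f P = Q := fun P Q h => (hf P).unique hY hρ (h3 P Q h).1
  have hgρ : ∀ P Q, ρ P Q → g Q = P := fun P Q h => (hg Q).unique hX hρf (h3 P Q h).2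
  refine ⟨⟨⟨f, g, fun P => ?_, fun Q => ?_⟩, hfr, hgr⟩, hf⟩
  · obtain ⟨c, d, w, r, h, hr, rfl, hQ, he⟩ := hf P
    refine leftInverse_of_generic hX hfr hgr w (he.mono fun x hx hD => ?_)
    obtain ⟨m, m', e⟩ := hx
    rw [hfρ _ _ e, hgρ _ _ e]
  · obtain ⟨c, d, w, r, h, hr, rfl, hQ, he⟩ := hg Q
    refine leftInverse_of_generic hY hgr hfr w (he.mono fun x hx hD => ?_)
    obtain ⟨m, m', e⟩ := hx
    rw [hgρ _ _ e, hfρ _ _ e]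

/-! ### Biregular maps and open subvarieties -/

theorem Biregular.continuous {X Y : AlgSurface} (Φ : Biregular X Y) : Continuous Φ.toEquiv :=
  IsRegularMap.continuous Φ.regular_toFun

theorem Biregular.continuous_symm {X Y : AlgSurface} (Φ : Biregular X Y) :
    Continuous Φ.toEquiv.symm :=
  IsRegularMap.continuous Φ.regular_invFun

/-- A biregular map as a homeomorphism. -/
def Biregular.toHomeomorph {X Y : AlgSurface} (Φ : Biregular X Y) : X.Pt ≃ₜ Y.Pt where
  toEquiv := Φ.toEquiv
  continuous_toFun := Φ.continuous
  continuous_invFun := Φ.continuous_symm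

theorem IsRegularMap.restrict {X Y : AlgSurface} {f : X.Pt → Y.Pt} (hf : IsRegularMap X Y f)
    {U : Set X.Pt} {V : Set Y.Pt} (hU : IsOpen U) (hV : IsOpen V) (h : ∀ P ∈ U, f P ∈ V) :
    IsRegularMap (openSub X U hU) (openSub Y V hV) fun P => ⟨f P.1, h P.1 P.2⟩ := by
  rintro ⟨P, hP⟩
  obtain ⟨c, d, w, rfl, r, hr, h1⟩ := hf P
  refine ⟨c, d, ⟨w.1, w.2, hP⟩, rfl, r, hr, ?_⟩
  filter_upwards [h1] with x hx hD
  obtain ⟨m, e⟩ := hx hD.1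
  exact ⟨⟨m, by rw [e]; exact h _ hD.2⟩, Subtype.ext e⟩

theorem Biregular.exists_restrict {X Y : AlgSurface} (Φ : Biregular X Y) {U : Set X.Pt}
    {V : Set Y.Pt} (hU : IsOpen U) (hV : IsOpen V) (h : ∀ P, P ∈ U ↔ Φ.toEquiv P ∈ V) :
    ∃ Ψ : Biregular (openSub X U hU) (openSub Y V hV),
      ∀ P, inclusion Y V hV (Ψ.toEquiv P) = Φ.toEquiv (inclusion X U hU P) := by
  have h' : ∀ Q ∈ V, Φ.toEquiv.symm Q ∈ U := fun Q hQ => by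
    rw [h, Equiv.apply_symm_apply]; exact hQ
  exact ⟨⟨⟨fun P => ⟨Φ.toEquiv P.1, (h P.1).1 P.2⟩, fun Q => ⟨Φ.toEquiv.symm Q.1, h' Q.1 Q.2⟩,
    fun P => Subtype.ext (Φ.toEquiv.symm_apply_apply P.1),
    fun Q => Subtype.ext (Φ.toEquiv.apply_symm_apply Q.1)⟩,
    Φ.regular_toFun.restrict hU hV fun P => (h P).1,
    Φ.regular_invFun.restrict hV hU h'⟩, fun P => rfl⟩

/-! ### Closures of curves -/

/-- An open set that contains a point of a line in a chart contains almost all its points. -/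
theorem finite_line_notMem {X : AlgSurface} {U : Set X.Pt} (hU : IsOpen U) (c : X.Chart)
    (a b : A2) (e : ℂ) (h : a + e • b ∈ X.dom c) (hw : X.par c ⟨_, h⟩ ∈ U) :
    {s : ℂ | ¬ ∃ h : a + s • b ∈ X.dom c, X.par c ⟨_, h⟩ ∈ U}.Finite := by
  obtain ⟨g, h1, h2⟩ := (hU c ⟨_, h⟩ hw).and (X.dom_open c _ h)
  -- The restriction to the line of a polynomial defining the neighbourhood. It is nonzero at the
  -- parameter `e`, and its finitely many roots contain all exceptional parameters.
  let p : Polynomial ℂ := aeval (fun k => Polynomial.C (a k) + Polynomial.X * Polynomial.C (b k)) g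
  have hp : ∀ s, p.eval s = eval (a + s • b) g := by
    intro s
    have := MvPolynomial.map_aeval (fun k => Polynomial.C (a k) + Polynomial.X * Polynomial.C (b k))
      (Polynomial.evalRingHom s) g
    rw [Polynomial.coe_evalRingHom] at this
    rw [this, MvPolynomial.eval]
    congr 2
    · ext
      simp
    · ext k
      simpa using mul_comm (b k) s
  have hp0 : p ≠ 0 := by
    intro h0
    rw [← hp e, h0] at h1
    simp at h1
  refine (p.roots.toFinset.finite_toSet).subset fun s hs => ?_
  simp only [Finset.mem_coe, Multiset.mem_toFinset, Polynomial.mem_roots hp0, Polynomial.IsRoot]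
  by_contra hne
  rw [hp] at hne
  obtain ⟨h3, h4⟩ := h2 _ hne
  exact hs ⟨h4, h3 h4⟩

/-- A point on a line in a chart is in the closure of any set that contains almost all the other
points of the line. -/
theorem mem_closure_of_line {X : AlgSurface} {S : Set X.Pt} (c : X.Chart) (a b : A2)
    (e : ℂ) (h : a + e • b ∈ X.dom c)
    (hS : {s : ℂ | ∃ h : a + s • b ∈ X.dom c, X.par c ⟨_, h⟩ ∉ S}.Finite) :
    X.par c ⟨_, h⟩ ∈ closure S := by
  rw [mem_closure_iff]
  intro U hU hw
  obtain ⟨s, hs⟩ := ((finite_line_notMem hU c a b e h hw).union hS).infinite_compl.nonempty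
  rw [Set.mem_compl_iff, Set.mem_union, not_or] at hs
  obtain ⟨m, hm⟩ := not_not.1 hs.1
  exact ⟨_, hm, by_contra fun h' => hs.2 ⟨m, h'⟩⟩

end

section

/-! ### Separatedness -/

theorem A2_parallel {u u' : A2} (hu : u ≠ 0) (hu' : u' ≠ 0) (h : u 0 * u' 1 = u 1 * u' 0) :
    ∃ s : ℂ, s ≠ 0 ∧ u' = s • u := by
  have key : ∀ j, u j ≠ 0 → (∀ i, u' i * u j = u i * u' j) → ∃ s : ℂ, s ≠ 0 ∧ u' = s • u := by
    intro j hj h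
    have he : u' = (u' j / u j) • u := by
      funext i
      rw [Pi.smul_apply, smul_eq_mul, div_mul_eq_mul_div, eq_div_iff hj, h i, mul_comm]
    refine ⟨_, fun h0 => hu' ?_, he⟩
    rw [he, h0, zero_smul]
  rcases A2_ne_zero u hu with h0 | h0
  · exact key 0 h0 fun i => by fin_cases i <;> simp <;> first | ring1 | linear_combination h
  · exact key 1 h0 fun i => by fin_cases i <;> simp <;> first | ring1 | linear_combination -h

/-- Equality of points becomes a system of polynomial equations in the two sets of homogeneous
coordinates: proportional vectors on the base, and equal ratios in the fibre, twisted by the n-th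
power of the base coordinates. Such equations survive passage to a limit. -/
theorem hirz_mk_eq_iff (n : ℕ) (x x' : HirzCoord) :
    Quotient.mk (hirzSetoid n) x = Quotient.mk (hirzSetoid n) x' ↔
      x.1.1 0 * x'.1.1 1 = x.1.1 1 * x'.1.1 0 ∧
      ∀ j, x'.1.2 0 * x.1.2 1 * x.1.1 j ^ n = x.1.2 0 * x'.1.2 1 * x'.1.1 j ^ n := by
  rw [Quotient.eq]
  constructor
  · rintro ⟨s, m, hs, hm, h1, h2, h3⟩
    rw [h1, h2, h3]
    refine ⟨?_, fun j => ?_⟩ <;> simp only [Pi.smul_apply, smul_eq_mul] <;> ring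
  · rintro ⟨h1, h2⟩
    obtain ⟨s, hs0, hs⟩ := A2_parallel x.2.1 x'.2.1 h1
    have h3 : x'.1.2 0 * x.1.2 1 = x.1.2 0 * x'.1.2 1 * s ^ n := by
      obtain ⟨j, hj⟩ : ∃ j, x.1.1 j ≠ 0 := Function.ne_iff.1 x.2.1
      have := h2 j
      rw [hs, Pi.smul_apply, smul_eq_mul, mul_pow, ← mul_assoc] at this
      exact mul_right_cancel₀ (pow_ne_zero n hj) this
    by_cases hx : x.1.2 1 = 0
    · have hx0 : x.1.2 0 ≠ 0 := (A2_ne_zero _ x.2.2).resolve_right (not_not.2 hx)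
      have hx1 : x'.1.2 1 = 0 := by
        rw [hx, mul_zero, eq_comm, mul_eq_zero, mul_eq_zero] at h3
        exact (h3.resolve_right (pow_ne_zero n hs0)).resolve_left hx0
      have hx2 : x'.1.2 0 ≠ 0 := (A2_ne_zero _ x'.2.2).resolve_right (not_not.2 hx1)
      -- On the section where the second fibre coordinate vanishes, the second torus factor can only
      -- be read off from the first fibre coordinate.
      refine ⟨s, x'.1.2 0 / (x.1.2 0 * s ^ n), hs0, by positivity, hs, ?_,
        by rw [hx, hx1, mul_zero]⟩
      field_simp
    · have he : x'.1.2 0 = s ^ n * (x'.1.2 1 / x.1.2 1) * x.1.2 0 := by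
        field_simp
        linear_combination h3
      refine ⟨s, x'.1.2 1 / x.1.2 1, hs0, ?_, hs, he, by field_simp⟩
      intro h0
      rw [h0, mul_zero, zero_mul] at he
      rw [div_eq_zero_iff, or_iff_left hx] at h0
      exact (A2_ne_zero _ x'.2.2).elim (· he) (· h0)

theorem regAt_hirzHom (c : Fin 4) {r : A2 → A2} {w : A2} (hr : ∀ k, RegAt (fun x => r x k) w)
    (j : Fin 2) : RegAt (fun x => (hirzHom c (r x)).1.1 j) w ∧
      RegAt (fun x => (hirzHom c (r x)).1.2 j) w := by
  fin_cases c <;> fin_cases j <;> simp [hirzHom, RegAt.const, hr]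

/-- The equations of `hirz_mk_eq_iff` hold generically between regular functions, hence at the
point. -/
theorem hirz_isSeparated (n : ℕ) : IsSeparated (hirz n) := by
  intro d d' w r r' hr hr' h h' hg
  have hg' : ∀ᶠ x in genericFilter, hirzPar n d (r x) = hirzPar n d' (r' x) :=
    hg.mono fun x hx => by
      obtain ⟨_, _, e⟩ := hx
      exact e
  have a := regAt_hirzHom d hr
  have b := regAt_hirzHom d' hr'
  refine (hirz_mk_eq_iff n _ _).2 ⟨?_, fun j => ?_⟩
  · exact ((a 0).1.mul (b 1).1).eq_of_generic ((a 1).1.mul (b 0).1)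
      (hg'.mono fun x hx => ((hirz_mk_eq_iff n _ _).1 hx).1)
  · exact (((b 0).2.mul (a 1).2).mul ((a j).1.pow n)).eq_of_generic
      (((a 0).2.mul (b 1).2).mul ((b j).1.pow n))
      (hg'.mono fun x hx => ((hirz_mk_eq_iff n _ _).1 hx).2 j)

/-! ### Separatedness of blow ups. -/

section BlowUp

variable {X : AlgSurface} {I : Type} {p : I → (c : X.Chart) × X.dom c}

/-- The chart of the base under a chart of the blow up. -/
def baseChart (p : I → (c : X.Chart) × X.dom c) : X.Chart ⊕ (I × Fin 2) → X.Chart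
  | .inl c => c
  | .inr (i, _) => (p i).1

/-- The blow down map in charts. -/
def baseMap (p : I → (c : X.Chart) × X.dom c) : X.Chart ⊕ (I × Fin 2) → A2 → A2
  | .inl _ => id
  | .inr (i, k) => blowMap (p i).2 k

theorem regAt_baseMap (c : X.Chart ⊕ (I × Fin 2)) (w : A2) (l : Fin 2) :
    RegAt (fun x => baseMap p c x l) w := by
  rcases c with c | ⟨i, k⟩
  · exact RegAt.coord l w
  · exact regAt_blowMap _ k w l

theorem baseMap_mem {c : X.Chart ⊕ (I × Fin 2)} {w : A2} (h : w ∈ blowUpDom X p c) :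
    baseMap p c w ∈ X.dom (baseChart p c) := by
  rcases c with c | ⟨i, k⟩ <;> exact h.1

theorem inr_mk_eq (i : I) {v w : A2} (hv : v ≠ 0) (hw : w ≠ 0) (a : ℂ) (h : a • w = v) :
    (.inr (i, Projectivization.mk ℂ v hv) : BlowUpPt X p) =
      .inr (i, Projectivization.mk ℂ w hw) :=
  congrArg (fun l => (.inr (i, l) : BlowUpPt X p)) ((Projectivization.mk_eq_mk_iff' _ _ _ _ _).2
    ⟨a, h⟩)

theorem exceptional_chart (i : I) (k : Fin 2) (w : A2) (hw : w k = 0) :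
    ∃ h : w ∈ blowUpDom X p (.inr (i, k)), blowUpPar X p (.inr (i, k)) ⟨w, h⟩ =
      .inr (i, Projectivization.mk ℂ (dir k w) (dir_ne_zero k w)) := by
  have hb : blowMap (p i).2 k w = (p i).2 := (blowMap_eq_iff _ _ _).2 hw
  exact ⟨⟨by rw [hb]; exact (p i).2.2, fun h => absurd hw h⟩, blowUpPar_exc _ hw⟩

variable [Finite I]

theorem blowDown_par (c : X.Chart ⊕ (I × Fin 2)) (w : blowUpDom X p c) :
    blowDown X p (blowUpPar X p c w) = X.par (baseChart p c) ⟨_, baseMap_mem w.2⟩ := by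
  rcases c with c | ⟨i, k⟩
  · rfl
  · by_cases h : w.1 k = 0
    · rw [blowUpPar_exc w h]
      refine congrArg (X.par (p i).1) (Subtype.ext ?_)
      exact ((blowMap_eq_iff _ _ _).2 h).symm
    · rw [blowUpPar_gen w h]
      rfl

theorem mem_exceptional_iff (i : I) (P : (blowUp X p).Pt) (hp : Function.Injective (centre X p)) :
    P ∈ exceptional X p i ↔ blowDown X p P = centre X p i := by
  constructor
  · rintro ⟨l, rfl⟩
    rfl
  · rcases P with ⟨x, hx⟩ | ⟨j, l⟩
    · exact fun h => absurd h (hx i)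
    · intro h
      obtain rfl := hp h
      exact ⟨l, rfl⟩

theorem blowDown_inj {P Q : (blowUp X p).Pt} (hP : ∀ i, blowDown X p P ≠ centre X p i)
    (h : blowDown X p P = blowDown X p Q) : P = Q := by
  rcases P with ⟨x, hx⟩ | ⟨j, l⟩
  · rcases Q with ⟨y, hy⟩ | ⟨j, l⟩
    · exact congrArg Sum.inl (Subtype.ext h)
    · exact absurd h (hP j)
  · exact absurd rfl (hP j)

theorem exists_blowDown_eq {x : X.Pt} (hx : ∀ i, x ≠ centre X p i) :
    ∃ P : (blowUp X p).Pt, blowDown X p P = x := ⟨.inl ⟨x, hx⟩, rfl⟩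

/-- Separatedness of `X` identifies the images under the blow down, which suffices away from the
centres. Over a centre both charts belong to the same exceptional line. In a common chart the
coordinates agree by density; in opposite charts the two direction coordinates are reciprocal
generically, hence also at the point, and so define the same direction. -/
theorem blowUpPar_eq_of_generic (hX : IsSeparated X) (hp : Function.Injective (centre X p))
    (d d' : X.Chart ⊕ (I × Fin 2)) (w : A2) (r r' : A2 → A2)
    (hr : ∀ k, RegAt (fun x => r x k) w) (hr' : ∀ k, RegAt (fun x => r' x k) w)
    (h : r w ∈ blowUpDom X p d) (h' : r' w ∈ blowUpDom X p d')
    (hg : ∀ᶠ x in genericFilter, ∃ (hx : r x ∈ blowUpDom X p d) (hx' : r' x ∈ blowUpDom X p d'),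
      blowUpPar X p d ⟨r x, hx⟩ = blowUpPar X p d' ⟨r' x, hx'⟩) :
    blowUpPar X p d ⟨r w, h⟩ = blowUpPar X p d' ⟨r' w, h'⟩ := by
  have hbase : blowDown X p (blowUpPar X p d ⟨r w, h⟩) =
      blowDown X p (blowUpPar X p d' ⟨r' w, h'⟩) := by
    refine (blowDown_par d _).trans (.trans ?_ (blowDown_par d' _).symm)
    refine hX _ _ w (fun x => baseMap p d (r x)) (fun x => baseMap p d' (r' x))
      (fun k => RegAt.comp (s := fun x => baseMap p d x k) hr (regAt_baseMap d _ k))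
      (fun k => RegAt.comp (s := fun x => baseMap p d' x k) hr' (regAt_baseMap d' _ k)) _ _ ?_
    refine hg.mono fun x hx => ?_
    obtain ⟨m, m', e⟩ := hx
    exact ⟨_, _, (blowDown_par d _).symm.trans ((congrArg (blowDown X p) e).trans
      (blowDown_par d' _))⟩
  by_cases hP : ∀ i, blowDown X p (blowUpPar X p d ⟨r w, h⟩) ≠ centre X p i
  · exact blowDown_inj hP hbase
  push Not at hP
  obtain ⟨i, hi⟩ := hP
  obtain ⟨l, hl⟩ := (mem_exceptional_iff i _ hp).2 hi
  obtain ⟨l', hl'⟩ := (mem_exceptional_iff i _ hp).2 (hbase.symm.trans hi)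
  -- Only the two charts attached to the centre `i` reach its exceptional line.
  have key : ∀ (c : X.Chart ⊕ (I × Fin 2)) (v : blowUpDom X p c) (m : Projectivization ℂ A2),
      .inr (i, m) = blowUpPar X p c v → ∃ k, c = .inr (i, k) := by
    rintro (c | ⟨j, k⟩) v m hm
    · cases hm
    · by_cases hv : v.1 k = 0
      · rw [blowUpPar_exc v hv] at hm
        cases hm
        exact ⟨k, rfl⟩
      · rw [blowUpPar_gen v hv] at hm
        cases hm
  obtain ⟨k, rfl⟩ := key _ _ _ hl
  obtain ⟨k', rfl⟩ := key _ _ _ hl'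
  by_cases hk : k = k'
  · subst hk
    have he : r w = r' w := by
      funext a
      refine (hr a).eq_of_generic (hr' a) (hg.mono fun x hx => ?_)
      obtain ⟨m, m', e⟩ := hx
      exact congrFun (congrArg Subtype.val (blowUpPar_inj _ e)) a
    exact congrArg _ (Subtype.ext he)
  · have hkk : ∀ a, a = k ∨ a = k' := by omega
    have hw0 : r w k = 0 := by
      by_contra h0
      have := hl.trans (blowUpPar_gen ⟨r w, h⟩ h0)
      cases this
    have hw0' : r' w k' = 0 := by
      by_contra h0
      have := hl'.trans (blowUpPar_gen ⟨r' w, h'⟩ h0)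
      cases this
    -- Slope times inverse slope. This is an identity of regular functions, so checking it
    -- generically is enough.
    have hm : r w k' * r' w k = 1 := by
      refine ((hr k').mul (hr' k)).eq_of_generic (RegAt.const 1 w) (hg.mono fun x hx => ?_)
      obtain ⟨m, m', e⟩ := hx
      have e' : blowUpPar X p (.inr (i, k)) ⟨r x, m⟩ = blowUpPar X p (.inr (i, k')) ⟨r' x, m'⟩ := e
      by_cases h0 : r x k = 0 <;> by_cases h0' : r' x k' = 0
      · rw [blowUpPar_exc _ h0, blowUpPar_exc _ h0'] at e'
        have h1 := (Prod.mk.inj (Sum.inr.inj e')).2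
        rw [Projectivization.mk_eq_mk_iff'] at h1
        obtain ⟨a, ha⟩ := h1
        have h2 := congrFun ha k
        have h3 := congrFun ha k'
        simp only [dir, Pi.smul_apply, smul_eq_mul, Function.update_self,
          Function.update_of_ne hk, Function.update_of_ne (Ne.symm hk)] at h2 h3
        rw [← h3, mul_one, h2]
      · rw [blowUpPar_exc _ h0, blowUpPar_gen _ h0'] at e'
        cases e'
      · rw [blowUpPar_gen _ h0, blowUpPar_exc _ h0'] at e'
        cases e'
      · rw [blowUpPar_gen _ h0, blowUpPar_gen _ h0'] at e'
        have h1 := congrArg Subtype.val (X.par_inj _ (congrArg Subtype.val (Sum.inl.inj e')))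
        have h2 := congrFun h1 k
        have h3 := congrFun h1 k'
        simp only [blowMap, dir, Pi.add_apply, add_right_inj, Pi.smul_apply, smul_eq_mul,
          Function.update_self, Function.update_of_ne hk,
          Function.update_of_ne (Ne.symm hk), mul_one] at h2 h3
        have : r' x k' * (r x k' * r' x k) = r' x k' * 1 := by
          rw [mul_one]
          linear_combination h3 - r x k' * h2
        exact mul_left_cancel₀ h0' this
    refine (blowUpPar_exc ⟨r w, h⟩ hw0).trans (.trans ?_ (blowUpPar_exc ⟨r' w, h'⟩ hw0').symm)
    congr 2
    rw [Projectivization.mk_eq_mk_iff']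
    refine ⟨r w k', funext fun a => ?_⟩
    rcases hkk a with rfl | rfl
    · simpa [dir, hk] using hm
    · simp [dir, Ne.symm hk]

theorem blowUp_isSeparated (hX : IsSeparated X) (hp : Function.Injective (centre X p)) :
    IsSeparated (blowUp X p) := blowUpPar_eq_of_generic hX hp

/-! ### Exceptional lines -/

/-- In each of its own two charts the line is the zero locus of a coordinate, and it does not meet
the other charts. -/
theorem isClosed_exceptional (i : I) : IsClosed (exceptional X p i) := by
  rw [← isOpen_compl_iff]
  refine isOpen_zariski.2 fun c w hw => ?_
  rcases c with c | ⟨j, k⟩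
  · refine Filter.Eventually.of_forall fun x h => ?_
    rintro ⟨l, hl⟩
    cases hl
  · by_cases hj : j = i
    · subst hj
      have hk : w.1 k ≠ 0 := fun h0 => hw ⟨_, (blowUpPar_exc w h0).symm⟩
      filter_upwards [(RegAt.coord k w.1).eventually_ne hk] with x hx h
      rintro ⟨l, hl⟩
      have := hl.trans (blowUpPar_gen ⟨x, h⟩ hx)
      cases this
    · refine Filter.Eventually.of_forall fun x h => ?_
      rintro ⟨l, hl⟩
      by_cases h0 : x k = 0
      · have := hl.trans (blowUpPar_exc ⟨x, h⟩ h0)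
        cases this
        exact hj rfl
      · have := hl.trans (blowUpPar_gen ⟨x, h⟩ h0)
        cases this

/-- The point of the exceptional line with direction `(1, s)`. -/
def excPt (p : I → (c : X.Chart) × X.dom c) (i : I) (s : ℂ) : (blowUp X p).Pt :=
  .inr (i, Projectivization.mk ℂ (dir 0 ![0, s]) (dir_ne_zero _ _))

theorem exceptional_cases (i : I) (P : (blowUp X p).Pt) (hP : P ∈ exceptional X p i) :
    (∃ s, P = excPt p i s) ∨
      P = .inr (i, Projectivization.mk ℂ (dir 1 ![0, 0]) (dir_ne_zero _ _)) := by
  obtain ⟨l, rfl⟩ := hP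
  induction l using Projectivization.ind with
  | h v hv =>
    by_cases h : v 0 = 0
    · right
      have h1 : v 1 ≠ 0 := (A2_ne_zero v hv).resolve_left (not_not.2 h)
      refine inr_mk_eq i _ _ (v 1) (funext fun a => ?_)
      fin_cases a <;> simp [dir, h]
    · left
      refine ⟨v 1 / v 0, ?_⟩
      refine inr_mk_eq i _ _ (v 0) (funext fun a => ?_)
      fin_cases a <;> simp [dir]
      field_simp

/-- An open set that meets an exceptional line contains almost all its points. -/
theorem finite_excPt_notMem (i : I) {U : Set (blowUp X p).Pt} (hU : IsOpen U)
    (h : (exceptional X p i ∩ U).Nonempty) : {s | excPt p i s ∉ U}.Finite := by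
  obtain ⟨P, hP, hPU⟩ := h
  rcases exceptional_cases i P hP with ⟨s, rfl⟩ | rfl
  · have key : ∀ s, ∃ h : ![0, 0] + s • ![0, 1] ∈ blowUpDom X p (.inr (i, 0)),
        blowUpPar X p (.inr (i, 0)) ⟨_, h⟩ = excPt p i s := fun s => by
      obtain ⟨hd, he⟩ := exceptional_chart (p := p) i 0 (![0, 0] + s • ![0, 1]) (by simp)
      refine ⟨hd, he.trans (inr_mk_eq i _ _ 1 (funext fun a => ?_))⟩
      fin_cases a <;> simp [dir]
    obtain ⟨hd, he⟩ := key s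
    refine (finite_line_notMem hU (.inr (i, 0)) _ _ s hd (Set.mem_of_eq_of_mem he hPU)).subset ?_
    rintro s' hs' ⟨_, hU'⟩
    exact hs' (Set.mem_of_eq_of_mem (key s').2.symm hU')
  · have key : ∀ s, ∃ h : ![0, 0] + s • ![1, 0] ∈ blowUpDom X p (.inr (i, 1)),
        blowUpPar X p (.inr (i, 1)) ⟨_, h⟩ =
          .inr (i, Projectivization.mk ℂ (dir 1 ![s, 0]) (dir_ne_zero _ _)) := fun s => by
      obtain ⟨hd, he⟩ := exceptional_chart (p := p) i 1 (![0, 0] + s • ![1, 0]) (by simp)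
      refine ⟨hd, he.trans (inr_mk_eq i _ _ 1 (funext fun a => ?_))⟩
      fin_cases a <;> simp [dir]
    obtain ⟨hd, he⟩ := key 0
    have hf := finite_line_notMem hU (.inr (i, 1)) _ _ 0 hd (Set.mem_of_eq_of_mem he hPU)
    -- The vertical direction is visible only in the second chart, whose parameter is the inverse
    -- slope. The finite exceptional set is therefore inverted, and slope 0, which that chart
    -- misses, is added.
    refine ((hf.image fun s => s⁻¹).union (Set.finite_singleton 0)).subset fun s' hs' => ?_
    by_cases h0 : s' = 0
    · exact .inr h0
    · refine .inl ⟨s'⁻¹, ?_, inv_inv _⟩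
      rintro ⟨_, hU'⟩
      refine hs' (Set.mem_of_eq_of_mem (.trans ?_ (key s'⁻¹).2.symm) hU')
      refine inr_mk_eq i _ _ s' (funext fun a => ?_)
      fin_cases a <;> simp [dir, h0]

theorem exceptional_nonempty (i : I) : (exceptional X p i).Nonempty :=
  ⟨excPt p i 0, _, rfl⟩

/-- Each of two open sets meeting the line omits only finitely many slopes, and ℂ is infinite. -/
theorem isIrreducible_exceptional (i : I) : IsIrreducible (exceptional X p i) := by
  refine ⟨exceptional_nonempty i, fun U V hU hV h1 h2 => ?_⟩
  obtain ⟨s, hs⟩ :=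
    ((finite_excPt_notMem i hU h1).union (finite_excPt_notMem i hV h2)).infinite_compl.nonempty
  rw [Set.mem_compl_iff, Set.mem_union, not_or] at hs
  exact ⟨excPt p i s, ⟨_, rfl⟩, not_not.1 hs.1, not_not.1 hs.2⟩

end BlowUp

end

section

/-! ### Curves in homogeneous coordinates -/

/-- The point with given homogeneous coordinates. -/
def hirzMk (n : ℕ) (x : HirzCoord) : (hirz n).Pt := Quotient.mk (hirzSetoid n) x

theorem hirzMk_eq_iff (n : ℕ) (x x' : HirzCoord) :
    hirzMk n x = hirzMk n x' ↔ x.1.1 0 * x'.1.1 1 = x.1.1 1 * x'.1.1 0 ∧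
      ∀ j, x'.1.2 0 * x.1.2 1 * x.1.1 j ^ n = x.1.2 0 * x'.1.2 1 * x'.1.1 j ^ n :=
  hirz_mk_eq_iff n x x'

theorem exists_hirzMk {n : ℕ} (P : (hirz n).Pt) : ∃ x, P = hirzMk n x :=
  (Quotient.exists_rep P).imp fun _ h => h.symm

/-- Equivalent homogeneous coordinates differ by the torus action. -/
theorem hirzMk_torus {n : ℕ} {x x' : HirzCoord} (h : hirzMk n x = hirzMk n x') :
    ∃ s m : ℂ, s ≠ 0 ∧ m ≠ 0 ∧ (x'.1.1 0 = s * x.1.1 0 ∧ x'.1.1 1 = s * x.1.1 1) ∧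
      x'.1.2 0 = s ^ n * m * x.1.2 0 ∧ x'.1.2 1 = m * x.1.2 1 := by
  obtain ⟨s, m, hs, hm, h1, h2, h3⟩ := Quotient.exact h
  exact ⟨s, m, hs, hm, ⟨by rw [h1]; rfl, by rw [h1]; rfl⟩, h2, h3⟩

/-- The number of the chart with first coordinate `1 / u` if `e` and `u` otherwise and second
coordinate `1 / v` (up to a power of `u`) if `f` and `v` otherwise. -/
def chartNo : Bool → Bool → Fin 4
  | false, false => 0
  | false, true => 1
  | true, false => 2
  | true, true => 3

/-- Homogeneous coordinates on the projective line from an affine coordinate. -/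
def affineVec : Bool → ℂ → A2
  | false, y => ![y, 1]
  | true, y => ![1, y]

theorem hirzHom_chartNo (e f : Bool) (x : A2) :
    (hirzHom (chartNo e f) x).1 = (affineVec e (x 0), affineVec f (x 1)) := by
  cases e <;> cases f <;> rfl

/-- A cell decomposition: a chart at infinity is used only for points that really lie at infinity.
Case distinctions thus have no overlaps, and the coordinate at infinity is known to be 0. -/
theorem hirz_cases {n : ℕ} (P : (hirz n).Pt) : ∃ e f x, P = hirzMk n (hirzHom (chartNo e f) x) ∧
    (e = true → x 0 = 0) ∧ (f = true → x 1 = 0) := by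
  obtain ⟨⟨⟨u, w⟩, hu, hw⟩, rfl⟩ := exists_hirzMk P
  dsimp only at hu hw
  by_cases h : u 1 = 0 <;> by_cases h' : w 1 = 0
  · refine ⟨true, true, ![0, 0], (hirzMk_eq_iff _ _ _).2 ?_, by simp⟩
    simp [hirzHom_chartNo, affineVec, h, h']
  · have h0 := (A2_ne_zero u hu).resolve_right (not_not.2 h)
    refine ⟨true, false, ![0, w 0 / (w 1 * u 0 ^ n)], (hirzMk_eq_iff _ _ _).2 ?_, by simp⟩
    simp only [hirzHom_chartNo, affineVec]
    refine ⟨by simp [h], fun j => ?_⟩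
    fin_cases j
    · simp
      field_simp
    -- Here the base coordinate is 0, and its n-th power is 1 for n = 0 but 0 otherwise.
    · rcases n with _ | n
      · simp
        field_simp
      · simp [h]
  · refine ⟨false, true, ![u 0 / u 1, 0], (hirzMk_eq_iff _ _ _).2 ?_, by simp⟩
    simp only [hirzHom_chartNo, affineVec]
    refine ⟨?_, fun j => ?_⟩
    · simp
      field_simp
    · simp [h']
  · refine ⟨false, false, ![u 0 / u 1, w 0 / (w 1 * u 1 ^ n)], (hirzMk_eq_iff _ _ _).2 ?_, by simp⟩
    simp only [hirzHom_chartNo, affineVec]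
    refine ⟨?_, fun j => ?_⟩
    · simp
      field_simp
    · fin_cases j
      · simp [div_pow]
        field_simp
      · simp
        field_simp

theorem vec_eta (z : A2) : ![z 0, z 1] = z := funext fun k => by fin_cases k <;> rfl

theorem hirzPt_eq (n : ℕ) (c : Fin 4) (z : A2) :
    hirzPt n c (z 0) (z 1) = hirzMk n (hirzHom c z) :=
  congrArg (fun z => hirzMk n (hirzHom c z)) (vec_eta z)

theorem hirzPt_mk (n : ℕ) (c : Fin 4) (x y : ℂ) :
    hirzPt n c x y = hirzMk n (hirzHom c ![x, y]) := rfl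

theorem centre_mk {n : ℕ} {I : Type} {p : I → (c : (hirz n).Chart) × (hirz n).dom c} {i : I}
    {c : Fin 4} {x y : ℂ} (h : p i = chartPt n c x y) :
    centre (hirz n) p i = hirzMk n (hirzHom c ![x, y]) := by
  unfold centre
  rw [h]
  rfl

theorem hirzMk_mem_chartLocus {n : ℕ} {c : Fin 4} {f : ℂ → ℂ → Prop} {z : A2}
    (h : f (z 0) (z 1)) : hirzMk n (hirzHom c z) ∈ chartLocus n c f :=
  ⟨z 0, z 1, h, (hirzPt_eq n c z).symm⟩

/-- A condition on homogeneous coordinates that is invariant under the torus. -/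
def TorusInvariant (n : ℕ) (p : HirzCoord → Prop) : Prop :=
  ∀ (s m : ℂ) (x x' : HirzCoord), s ≠ 0 → m ≠ 0 → x'.1.1 0 = s * x.1.1 0 →
    x'.1.1 1 = s * x.1.1 1 → x'.1.2 0 = s ^ n * m * x.1.2 0 → x'.1.2 1 = m * x.1.2 1 → p x → p x'

theorem TorusInvariant.congr {n : ℕ} {p : HirzCoord → Prop} (hp : TorusInvariant n p)
    {x x' : HirzCoord} (h : hirzMk n x = hirzMk n x') (hx : p x) : p x' := by
  obtain ⟨s, m, hs, hm, ⟨h1, h2⟩, h3, h4⟩ := hirzMk_torus h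
  exact hp s m x x' hs hm h1 h2 h3 h4 hx

/-- Translates loci defined chart by chart into homogeneous equations. By torus invariance any
representative serves in one direction, and the cells of `hirz_cases` suffice in the other. -/
theorem hirzMk_mem_iff {n : ℕ} {S : Set (hirz n).Pt} {p : HirzCoord → Prop}
    (hp : TorusInvariant n p)
    (h1 : ∀ P ∈ S, ∃ c z, P = hirzMk n (hirzHom c z) ∧ p (hirzHom c z))
    (h2 : ∀ e f z, (e = true → z 0 = 0) → (f = true → z 1 = 0) → p (hirzHom (chartNo e f) z) →
      hirzMk n (hirzHom (chartNo e f) z) ∈ S) (x : HirzCoord) : hirzMk n x ∈ S ↔ p x := by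
  constructor
  · intro h
    obtain ⟨c, z, hz, hpz⟩ := h1 _ h
    exact hp.congr hz.symm hpz
  · intro h
    obtain ⟨e, f, z, hz, he, hf⟩ := hirz_cases (hirzMk n x)
    rw [hz]
    exact h2 e f z he hf (hp.congr hz h)

theorem hirzMk_mem_vLine (n : ℕ) (a : ℂ) (x : HirzCoord) :
    hirzMk n x ∈ vLine n a ↔ x.1.1 0 = a * x.1.1 1 := by
  refine hirzMk_mem_iff (p := fun x => x.1.1 0 = a * x.1.1 1) ?_ ?_ ?_ x
  · intro s m x x' hs hm h1 h2 h3 h4 h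
    linear_combination h1 - a * h2 + s * h
  · rintro P (⟨x, y, h, rfl⟩ | ⟨x, y, h, rfl⟩)
    · exact ⟨0, ![x, y], rfl, by simp [hirzHom, h]⟩
    · exact ⟨1, ![x, y], rfl, by simp [hirzHom, h]⟩
  · intro e f z he hf h
    cases e
    · have hz : z 0 = a := by simpa [hirzHom_chartNo, affineVec] using h
      cases f
      · exact .inl (hirzMk_mem_chartLocus (f := fun x _ => x = a) hz)
      · exact .inr (hirzMk_mem_chartLocus (f := fun x _ => x = a) hz)
    · simp [hirzHom_chartNo, affineVec, he] at h

theorem hirzMk_mem_vLineInf (n : ℕ) (x : HirzCoord) :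
    hirzMk n x ∈ vLineInf n ↔ x.1.1 1 = 0 := by
  refine hirzMk_mem_iff (p := fun x => x.1.1 1 = 0) ?_ ?_ ?_ x
  · intro s m x x' hs hm h1 h2 h3 h4 h
    linear_combination h2 + s * h
  · rintro P (⟨x, y, h, rfl⟩ | ⟨x, y, h, rfl⟩)
    · exact ⟨2, ![x, y], rfl, by simp [hirzHom, h]⟩
    · exact ⟨3, ![x, y], rfl, by simp [hirzHom, h]⟩
  · intro e f z he hf h
    cases e
    · simp [hirzHom_chartNo, affineVec] at h
    · cases f
      · exact .inl (hirzMk_mem_chartLocus (f := fun x _ => x = 0) (he rfl))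
      · exact .inr (hirzMk_mem_chartLocus (f := fun x _ => x = 0) (he rfl))

theorem hirzMk_mem_hLineZero (n : ℕ) (x : HirzCoord) :
    hirzMk n x ∈ hLineZero n ↔ x.1.2 0 = 0 := by
  refine hirzMk_mem_iff (p := fun x => x.1.2 0 = 0) ?_ ?_ ?_ x
  · intro s m x x' hs hm h1 h2 h3 h4 h
    linear_combination h3 + s ^ n * m * h
  · rintro P (⟨x, y, h, rfl⟩ | ⟨x, y, h, rfl⟩)
    · exact ⟨0, ![x, y], rfl, by simp [hirzHom, h]⟩
    · exact ⟨2, ![x, y], rfl, by simp [hirzHom, h]⟩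
  · intro e f z he hf h
    cases f
    · have hz : z 1 = 0 := by simpa [hirzHom_chartNo, affineVec] using h
      cases e
      · exact .inl (hirzMk_mem_chartLocus (f := fun _ y => y = 0) hz)
      · exact .inr (hirzMk_mem_chartLocus (f := fun _ y => y = 0) hz)
    · simp [hirzHom_chartNo, affineVec] at h

theorem hirzMk_mem_hLineInf (n : ℕ) (x : HirzCoord) :
    hirzMk n x ∈ hLineInf n ↔ x.1.2 1 = 0 := by
  refine hirzMk_mem_iff (p := fun x => x.1.2 1 = 0) ?_ ?_ ?_ x
  · intro s m x x' hs hm h1 h2 h3 h4 h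
    linear_combination h4 + m * h
  · rintro P (⟨x, y, h, rfl⟩ | ⟨x, y, h, rfl⟩)
    · exact ⟨1, ![x, y], rfl, by simp [hirzHom, h]⟩
    · exact ⟨3, ![x, y], rfl, by simp [hirzHom, h]⟩
  · intro e f z he hf h
    cases f
    · simp [hirzHom_chartNo, affineVec] at h
    · cases e
      · exact .inl (hirzMk_mem_chartLocus (f := fun _ y => y = 0) (hf rfl))
      · exact .inr (hirzMk_mem_chartLocus (f := fun _ y => y = 0) (hf rfl))

/-- The binary quadratic form with roots `a` and `b`. -/
def quad (a b : ℂ) (u : A2) : ℂ := (u 0 - a * u 1) * (u 0 - b * u 1)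

theorem hirzMk_mem_curveC {q : ℂ} (hq1 : q ≠ 1) (t : ℂ) (x : HirzCoord) :
    hirzMk 2 x ∈ curveC q t ↔ (q - 1) * x.1.2 0 + quad 1 t x.1.1 * x.1.2 1 = 0 := by
  have hq : 1 - q ≠ 0 := sub_ne_zero.2 hq1.symm
  refine hirzMk_mem_iff
    (p := fun x => (q - 1) * x.1.2 0 + quad 1 t x.1.1 * x.1.2 1 = 0) ?_ ?_ ?_ x
  · intro s m x x' hs hm h1 h2 h3 h4 h
    simp only [quad] at h ⊢
    rw [h1, h2, h3, h4]
    linear_combination s ^ 2 * m * h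
  · rintro P ((⟨x, y, h, rfl⟩ | ⟨x, y, h, rfl⟩) | ⟨x, y, h, rfl⟩)
    · refine ⟨0, ![x, y], rfl, ?_⟩
      simp [hirzHom, quad]
      linear_combination h
    · refine ⟨1, ![x, y], rfl, ?_⟩
      simp [hirzHom, quad]
      linear_combination h
    · refine ⟨3, ![x, y], rfl, ?_⟩
      simp [hirzHom, quad]
      linear_combination h
  · intro e f z he hf h
    cases f
    · cases e
      · refine .inl (.inl (hirzMk_mem_chartLocus ?_))
        simp [hirzHom_chartNo, affineVec, quad] at h
        linear_combination h
      -- No locus in chart 2 enters the definition of the curve. Its only point at u = ∞ has v₂ =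
      -- 1/(1 - q), which is finite and nonzero, so it is seen in chart 3 with v₃ = 1 - q.
      · have hz : z = ![0, (1 - q)⁻¹] := by
          rw [← vec_eta z, he rfl]
          simp [hirzHom_chartNo, affineVec, quad, he] at h
          congr 2
          rw [eq_comm, inv_eq_iff_eq_inv, ← inv_eq_iff_eq_inv, inv_eq_of_mul_eq_one_left]
          linear_combination -h
        refine .inr ⟨0, 1 - q, by simp, ?_⟩
        rw [hz, hirzPt_mk, hirzMk_eq_iff]
        simp [hirzHom, chartNo, hq]
    · simp [hirzHom_chartNo, affineVec, quad, hf, sub_ne_zero.2 hq1] at h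

/-! ### The correspondence between the two surfaces -/

/-- The homogeneous equation of the closure of the graph of the birational map. -/
def CorrEq (q t : ℂ) (Θ : Idx → ℂ) (x x' : HirzCoord) : Prop :=
  x.1.1 0 * x'.1.1 1 = x.1.1 1 * x'.1.1 0 ∧
    x.1.2 0 * (q * ((q - 1) * x'.1.2 0 + quad 1 t x'.1.1 * x'.1.2 1)) =
      quad (t * Θ .t) (t * (Θ .t)⁻¹) x'.1.1 * x.1.2 1 * x'.1.2 1

/-- The closure of the graph of the birational map. -/
def Corr (q t : ℂ) (Θ : Idx → ℂ) (P : (hirz 0).Pt) (Q : (hirz 2).Pt) : Prop :=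
  ∃ x x', hirzMk 0 x = P ∧ hirzMk 2 x' = Q ∧ CorrEq q t Θ x x'

/-- Both sides of the equation have the same weight under each of the two tori, because both
quadratic forms are evaluated at the base coordinates of the second point. Any representatives may
therefore be used. -/
theorem corr_iff (q t : ℂ) (Θ : Idx → ℂ) (x x' : HirzCoord) :
    Corr q t Θ (hirzMk 0 x) (hirzMk 2 x') ↔ CorrEq q t Θ x x' := by
  constructor
  · rintro ⟨y, y', hy, hy', h, h'⟩
    obtain ⟨s, m, hs, hm, ⟨h1, h2⟩, h3, h4⟩ := hirzMk_torus hy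
    obtain ⟨s', m', hs', hm', ⟨h1', h2'⟩, h3', h4'⟩ := hirzMk_torus hy'
    unfold CorrEq quad at *
    rw [h1, h2, h3, h4, h1', h2', h3', h4']
    refine ⟨by linear_combination s * s' * h, ?_⟩
    linear_combination m * m' * s' ^ 2 * h'
  · exact fun h => ⟨x, x', rfl, rfl, h⟩

/-- The conditions on the parameters. -/
structure Admissible (q t : ℂ) (Θ : Idx → ℂ) : Prop where
  q_ne_zero : q ≠ 0
  q_ne_one : q ≠ 1
  ne_zero : ∀ i, Θ i ≠ 0
  sq_zero : Θ .zero ^ 2 ≠ 1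
  sq_one : Θ .one ^ 2 ≠ 1
  sq_t : Θ .t ^ 2 ≠ 1
  sq_inf : Θ .inf ^ 2 ≠ q
  t_ne_zero : t ≠ 0
  notMem : t ∉ excludedSet q Θ

variable {q t : ℂ} {Θ : Idx → ℂ}

theorem gammaPt_t (s : Bool) : gammaPt q t Θ (.t, s) = chartPt 0 0 (tNode t Θ s) 0 := by
  cases s <;> rfl

theorem betaPt_t (s : Bool) : betaPt q t Θ (.t, s) =
    chartPt 2 0 (tNode t Θ s) (-((tNode t Θ s - 1) * (tNode t Θ s - t)) / (q - 1)) := by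
  cases s <;> simp only [betaPt, tNode] <;> congr 1 <;> ring

theorem quad_tNode (u : A2) (s : Bool) : quad (t * Θ .t) (t * (Θ .t)⁻¹) u =
    (u 0 - tNode t Θ s * u 1) * (u 0 - tNode t Θ (!s) * u 1) := by
  cases s <;> simp only [quad, tNode, Bool.not_false, Bool.not_true]
  ring

theorem quad_eq_zero {u : A2} : quad (t * Θ .t) (t * (Θ .t)⁻¹) u = 0 ↔
    ∃ s, u 0 = tNode t Θ s * u 1 := by
  simp only [quad, mul_eq_zero, sub_eq_zero, Bool.exists_bool, tNode]

theorem eq_gamma_t {x : HirzCoord} (h : x.1.2 0 = 0)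
    (hx : quad (t * Θ .t) (t * (Θ .t)⁻¹) x.1.1 = 0) :
    ∃ s, hirzMk 0 x = centre (hirz 0) (gammaPt q t Θ) (.t, s) := by
  obtain ⟨s, hs⟩ := quad_eq_zero.1 hx
  refine ⟨s, ?_⟩
  rw [centre_mk (gammaPt_t s), hirzMk_eq_iff]
  simp [hirzHom, h, hs, mul_comm]

/-- Each degenerate fibre meets C in exactly one point, and β_t^± is that point. -/
theorem eq_beta_t (hq1 : q ≠ 1) {x : HirzCoord}
    (h : (q - 1) * x.1.2 0 + quad 1 t x.1.1 * x.1.2 1 = 0)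
    (hx : quad (t * Θ .t) (t * (Θ .t)⁻¹) x.1.1 = 0) :
    ∃ s, hirzMk 2 x = centre (hirz 2) (betaPt q t Θ) (.t, s) := by
  obtain ⟨s, hs⟩ := quad_eq_zero.1 hx
  refine ⟨s, ?_⟩
  rw [centre_mk (betaPt_t s), hirzMk_eq_iff]
  have hq : q - 1 ≠ 0 := sub_ne_zero.2 hq1
  simp only [hirzHom, quad] at h ⊢
  rw [hs] at h ⊢
  refine ⟨by simp [mul_comm], fun j => ?_⟩
  fin_cases j <;> simp <;> field_simp
  · rw [hs]
    linear_combination - tNode t Θ s ^ 2 * h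
  · linear_combination - h

/-- For fixed `P` the equation is linear in the fibre coordinates of `Q`. The linear form vanishes
identically only when z = 0 and A = 0, which are the two points γ_t^±. -/
theorem Corr.unique_right (hq0 : q ≠ 0) (hq1 : q ≠ 1) {P : (hirz 0).Pt} {Q Q' : (hirz 2).Pt}
    (hP : ∀ s, P ≠ centre (hirz 0) (gammaPt q t Θ) (.t, s)) (h : Corr q t Θ P Q)
    (h' : Corr q t Θ P Q') : Q = Q' := by
  have hq : q - 1 ≠ 0 := sub_ne_zero.2 hq1
  obtain ⟨x, rfl⟩ := exists_hirzMk P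
  obtain ⟨y, rfl⟩ := exists_hirzMk Q
  obtain ⟨z, rfl⟩ := exists_hirzMk Q'
  obtain ⟨h1, h2⟩ := (corr_iff ..).1 h
  obtain ⟨h1', h2'⟩ := (corr_iff ..).1 h'
  obtain ⟨a, ha, hy⟩ := A2_parallel x.2.1 y.2.1 h1
  obtain ⟨b, hb, hz⟩ := A2_parallel x.2.1 z.2.1 h1'
  simp only [quad, hy, hz, Pi.smul_apply, smul_eq_mul] at h2 h2'
  rw [hirzMk_eq_iff]
  simp only [hy, hz, Pi.smul_apply, smul_eq_mul]
  refine ⟨by ring, fun j => ?_⟩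
  -- Once the base coordinates are expressed through those of `P`, equality in the fibre is the
  -- vanishing of one determinant. For z = 0 both points have v = ∞; otherwise the determinant
  -- results from eliminating between the two equations.
  suffices hdet : y.1.2 0 * (b ^ 2 * z.1.2 1) - z.1.2 0 * (a ^ 2 * y.1.2 1) = 0 by
    linear_combination -x.1.1 j ^ 2 * hdet
  by_cases hx : x.1.2 0 = 0
  · have hA : quad (t * Θ .t) (t * (Θ .t)⁻¹) x.1.1 ≠ 0 := fun h0 => by
      obtain ⟨s, hs⟩ := eq_gamma_t (q := q) hx h0
      exact hP s hs
    have hx1 : x.1.2 1 ≠ 0 := (A2_ne_zero _ x.2.2).resolve_left (not_not.2 hx)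
    have key : ∀ c w : ℂ, c ≠ 0 → c ^ 2 * (quad (t * Θ .t) (t * (Θ .t)⁻¹) x.1.1 * x.1.2 1 * w) = 0 →
        w = 0 := by
      intro c w hc h
      simpa [hc, hA, hx1] using h
    rw [key a (y.1.2 1) ha (by rw [quad]; linear_combination -h2 + q * ((q - 1) * y.1.2 0 +
        (a * x.1.1 0 - 1 * (a * x.1.1 1)) * (a * x.1.1 0 - t * (a * x.1.1 1)) * y.1.2 1) * hx),
      key b (z.1.2 1) hb (by rw [quad]; linear_combination -h2' + q * ((q - 1) * z.1.2 0 +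
        (b * x.1.1 0 - 1 * (b * x.1.1 1)) * (b * x.1.1 0 - t * (b * x.1.1 1)) * z.1.2 1) * hx)]
    ring
  · refine (mul_eq_zero.1 (?_ : x.1.2 0 * (q * (q - 1)) * _ = 0)).resolve_left
      (mul_ne_zero hx (mul_ne_zero hq0 hq))
    linear_combination b ^ 2 * z.1.2 1 * h2 - a ^ 2 * y.1.2 1 * h2'

/-- For fixed `Q` the equation is linear in the fibre coordinates of `P`, with coefficients q D and
A times the second fibre coordinate of `Q`. The latter is nonzero when D = 0, so both coefficients
vanish only at β_t^±. -/
theorem Corr.unique_left (hq0 : q ≠ 0) (hq1 : q ≠ 1) {P P' : (hirz 0).Pt} {Q : (hirz 2).Pt}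
    (hQ : ∀ s, Q ≠ centre (hirz 2) (betaPt q t Θ) (.t, s)) (h : Corr q t Θ P Q)
    (h' : Corr q t Θ P' Q) : P = P' := by
  have hq : q - 1 ≠ 0 := sub_ne_zero.2 hq1
  obtain ⟨x, rfl⟩ := exists_hirzMk Q
  obtain ⟨y, rfl⟩ := exists_hirzMk P
  obtain ⟨z, rfl⟩ := exists_hirzMk P'
  obtain ⟨h1, h2⟩ := (corr_iff ..).1 h
  obtain ⟨h1', h2'⟩ := (corr_iff ..).1 h'
  obtain ⟨a, ha, hy⟩ := A2_parallel y.2.1 x.2.1 h1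
  obtain ⟨b, hb, hz⟩ := A2_parallel z.2.1 x.2.1 h1'
  rw [hirzMk_eq_iff]
  have h3 : ∀ j, a * y.1.1 j = b * z.1.1 j := fun j => by
    have := congrFun (hy.symm.trans hz) j
    simpa using this
  refine ⟨mul_left_cancel₀ ha (by linear_combination z.1.1 1 * h3 0 - z.1.1 0 * h3 1), fun j => ?_⟩
  rw [pow_zero, pow_zero, mul_one, mul_one]
  by_cases hD : (q - 1) * x.1.2 0 + quad 1 t x.1.1 * x.1.2 1 = 0
  · have hA : quad (t * Θ .t) (t * (Θ .t)⁻¹) x.1.1 ≠ 0 := fun h0 => by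
      obtain ⟨s, hs⟩ := eq_beta_t (q := q) hq1 hD h0
      exact hQ s hs
    have hx1 : x.1.2 1 ≠ 0 := fun h0 => by
      rw [h0, mul_zero, add_zero, mul_eq_zero, or_iff_right hq] at hD
      exact (A2_ne_zero _ x.2.2).elim (· hD) (· h0)
    rw [hD, mul_zero, mul_zero] at h2 h2'
    have hy1 : y.1.2 1 = 0 := by simpa [hA, hx1] using h2.symm
    have hz1 : z.1.2 1 = 0 := by simpa [hA, hx1] using h2'.symm
    rw [hy1, hz1]
    ring
  · refine mul_left_cancel₀ (mul_ne_zero hq0 hD) ?_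
    linear_combination y.1.2 1 * h2' - z.1.2 1 * h2

end

section

variable {q t : ℂ} {Θ : Idx → ℂ}

/-! ### The centres are distinct -/

/-- The first coordinate of `γ_1^±` and of `β_1^±`. -/
def oneNode (Θ : Idx → ℂ) : Bool → ℂ
  | false => (Θ .one)⁻¹
  | true => Θ .one

/-- An equality would write t as a product of signed powers of Θ_1 and Θ_t, an element of the
excluded set with exponent 0 of q. -/
theorem oneNode_ne_tNode (H : Admissible q t Θ) (s s' : Bool) :
    oneNode Θ s ≠ tNode t Θ s' := by
  intro h
  have h1 := H.ne_zero .one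
  have ht := H.ne_zero .t
  refine H.notMem ?_
  cases s <;> cases s' <;> simp only [oneNode, tNode] at h
  · refine ⟨-1, -1, 0, by simp, by simp, .inl ?_⟩
    simp only [zpow_neg, zpow_one, zpow_zero, h]
    field_simp
  · refine ⟨-1, 1, 0, by simp, by simp, .inl ?_⟩
    simp only [zpow_neg, zpow_one, zpow_zero, h]
    field_simp
  · refine ⟨1, -1, 0, by simp, by simp, .inl ?_⟩
    simp only [zpow_neg, zpow_one, zpow_zero, h]
    field_simp
  · refine ⟨1, 1, 0, by simp, by simp, .inl ?_⟩
    simp only [zpow_one, zpow_zero, h]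
    field_simp

theorem inv_ne_self {a : ℂ} (ha : a ≠ 0) (h : a ^ 2 ≠ 1) : a⁻¹ ≠ a := by
  intro h'
  apply h
  rw [pow_two]
  nth_rw 1 [← h']
  exact inv_mul_cancel₀ ha

theorem tNode_not_ne (H : Admissible q t Θ) (s : Bool) : tNode t Θ s ≠ tNode t Θ (!s) := by
  have h := inv_ne_self (H.ne_zero .t) H.sq_t
  intro h'
  cases s
  · exact h (mul_left_cancel₀ H.t_ne_zero h').symm
  · exact h (mul_left_cancel₀ H.t_ne_zero h')

theorem tNode_injective (H : Admissible q t Θ) : Function.Injective (tNode t Θ) := by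
  intro s s' h
  by_contra hs
  obtain rfl : s' = !s := Bool.eq_not_iff.2 (Ne.symm hs)
  exact tNode_not_ne H s h

theorem oneNode_injective (H : Admissible q t Θ) : Function.Injective (oneNode Θ) := by
  have h := inv_ne_self (H.ne_zero .one) H.sq_one
  intro s s' hs
  cases s <;> cases s' <;> first | rfl | exact absurd hs h | exact absurd hs h.symm

theorem tNode_ne_zero (H : Admissible q t Θ) (s : Bool) : tNode t Θ s ≠ 0 := by
  cases s <;> simp [tNode, H.t_ne_zero, H.ne_zero]

theorem oneNode_ne_zero (H : Admissible q t Θ) (s : Bool) : oneNode Θ s ≠ 0 := by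
  cases s <;> simp [oneNode, H.ne_zero]

/-- The second coordinate of `γ_0^±`. -/
def gammaZero (q t : ℂ) (Θ : Idx → ℂ) : Bool → ℂ
  | false => t * Θ .zero / q
  | true => t * (Θ .zero)⁻¹ / q

/-- The second coordinate of `γ_∞^±`. -/
def gammaInf (q : ℂ) (Θ : Idx → ℂ) : Bool → ℂ
  | false => (Θ .inf)⁻¹
  | true => Θ .inf / q

/-- The second coordinate of `β_0^±`. -/
def betaZero (q t : ℂ) (Θ : Idx → ℂ) : Bool → ℂ
  | false => t * ((Θ .zero)⁻¹ - 1) / (q - 1)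
  | true => t * (Θ .zero - 1) / (q - 1)

/-- The second coordinate of `β_∞^±`. -/
def betaInf (q : ℂ) (Θ : Idx → ℂ) : Bool → ℂ
  | false => ((Θ .inf)⁻¹ - 1) / (q - 1)
  | true => (Θ .inf - q) / (q * (q - 1))

theorem gammaPt_zero (s : Bool) : gammaPt q t Θ (.zero, s) = chartPt 0 0 0 (gammaZero q t Θ s) := by
  cases s <;> rfl

theorem gammaPt_one (s : Bool) : gammaPt q t Θ (.one, s) = chartPt 0 1 (oneNode Θ s) 0 := by
  cases s <;> rfl

theorem gammaPt_inf (s : Bool) : gammaPt q t Θ (.inf, s) = chartPt 0 2 0 (gammaInf q Θ s) := by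
  cases s <;> rfl

theorem betaPt_zero (s : Bool) : betaPt q t Θ (.zero, s) = chartPt 2 0 0 (betaZero q t Θ s) := by
  cases s <;> rfl

theorem betaPt_one (s : Bool) : betaPt q t Θ (.one, s) =
    chartPt 2 0 (oneNode Θ s) (-((oneNode Θ s - 1) * (oneNode Θ s - t)) / (q - 1)) := by
  cases s <;> simp only [betaPt, oneNode] <;> congr 1 <;> ring

theorem betaPt_inf (s : Bool) : betaPt q t Θ (.inf, s) = chartPt 2 2 0 (betaInf q Θ s) := by
  cases s <;> rfl

/-- The graph equation q z D = A on the fibre y = 0, where A = t² and B = t. -/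
theorem gammaZero_mul_betaZero (H : Admissible q t Θ) (s : Bool) :
    gammaZero q t Θ s * (q * ((q - 1) * betaZero q t Θ s + t)) = t ^ 2 := by
  have h := H.q_ne_zero
  have h' := sub_ne_zero.2 H.q_ne_one
  have h0 := H.ne_zero .zero
  cases s <;> simp only [gammaZero, betaZero] <;> field_simp <;> ring

/-- The graph equation at y = ∞, where A and B reduce to their leading coefficient 1. The pairing
reverses the sign, which is why the two exceptional lines at infinity are interchanged. -/
theorem gammaInf_mul_betaInf (H : Admissible q t Θ) (s : Bool) :
    gammaInf q Θ s * (q * ((q - 1) * betaInf q Θ (!s) + 1)) = 1 := by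
  have h := H.q_ne_zero
  have h' := sub_ne_zero.2 H.q_ne_one
  have h0 := H.ne_zero .inf
  cases s <;> simp only [gammaInf, betaInf, Bool.not_false, Bool.not_true] <;> field_simp <;> ring

theorem gammaZero_injective (H : Admissible q t Θ) : Function.Injective (gammaZero q t Θ) := by
  have h := inv_ne_self (H.ne_zero .zero) H.sq_zero
  intro s s' hs
  have hq := H.q_ne_zero
  have ht := H.t_ne_zero
  cases s <;> cases s' <;> simp only [gammaZero, div_left_inj' hq] at hs <;>
    first | rfl | exact absurd (mul_left_cancel₀ ht hs) h |
      exact absurd (mul_left_cancel₀ ht hs) h.symm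

theorem gammaInf_injective (H : Admissible q t Θ) : Function.Injective (gammaInf q Θ) := by
  have hq := H.q_ne_zero
  have h0 := H.ne_zero .inf
  have h : (Θ .inf)⁻¹ ≠ Θ .inf / q := by
    intro h
    field_simp at h
    exact H.sq_inf h.symm
  intro s s' hs
  cases s <;> cases s' <;> first | rfl | exact absurd hs h | exact absurd hs h.symm

/-- The product identity determines each γ from its β: the factor containing β is nonzero, since the
product is t². Distinctness thus passes from the γ's to the β's. -/
theorem betaZero_injective (H : Admissible q t Θ) : Function.Injective (betaZero q t Θ) := by
  intro s s' hs
  have h1 := gammaZero_mul_betaZero H s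
  have h2 := gammaZero_mul_betaZero H s'
  rw [← hs] at h2
  have ht := pow_ne_zero 2 H.t_ne_zero
  refine gammaZero_injective H (mul_right_cancel₀ (fun h0 => ?_) (h1.trans h2.symm))
  rw [h0, mul_zero] at h1
  exact ht h1.symm

theorem betaInf_injective (H : Admissible q t Θ) : Function.Injective (betaInf q Θ) := by
  intro s s' hs
  have h1 := gammaInf_mul_betaInf H (!s)
  have h2 := gammaInf_mul_betaInf H (!s')
  rw [Bool.not_not] at h1 h2
  rw [← hs] at h2
  have := gammaInf_injective H (mul_right_cancel₀ (fun h0 => ?_) (h1.trans h2.symm))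
  · simpa using this
  · rw [h0, mul_zero] at h1
    exact zero_ne_one h1

theorem gamma_injective (H : Admissible q t Θ) :
    Function.Injective (centre (hirz 0) (gammaPt q t Θ)) := by
  have h1 := oneNode_ne_zero H
  have h2 := tNode_ne_zero H
  have h3 := oneNode_ne_tNode H
  rintro ⟨i, s⟩ ⟨j, s'⟩ h
  rcases i with _ | _ | _ | _ <;> rcases j with _ | _ | _ | _ <;>
    simp only [centre_mk (gammaPt_zero _), centre_mk (gammaPt_one _), centre_mk (gammaPt_t _),
      centre_mk (gammaPt_inf _), hirzMk_eq_iff] at h <;>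
    simp [hirzHom, h1, h2, h3, (h1 _).symm, (h2 _).symm, (h3 _ _).symm] at h
  · rw [gammaZero_injective H h.symm]
  · rw [oneNode_injective H h]
  · rw [tNode_injective H h]
  · rw [gammaInf_injective H h.symm]

theorem beta_injective (H : Admissible q t Θ) :
    Function.Injective (centre (hirz 2) (betaPt q t Θ)) := by
  have h1 := oneNode_ne_zero H
  have h2 := tNode_ne_zero H
  have h3 := oneNode_ne_tNode H
  rintro ⟨i, s⟩ ⟨j, s'⟩ h
  rcases i with _ | _ | _ | _ <;> rcases j with _ | _ | _ | _ <;>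
    simp only [centre_mk (betaPt_zero _), centre_mk (betaPt_one _), centre_mk (betaPt_t _),
      centre_mk (betaPt_inf _), hirzMk_eq_iff] at h <;>
    simp [hirzHom, h1, h2, h3, (h1 _).symm, (h2 _).symm, (h3 _ _).symm] at h
  · rw [betaZero_injective H h.symm]
  · rw [oneNode_injective H h.1]
  · rw [tNode_injective H h.1]
  · rw [betaInf_injective H h.symm]

/-- The index of the centre in the second surface that corresponds to a centre in the first. -/
def corrIdx : Idx × Bool → Idx × Bool
  | (.inf, s) => (.inf, !s)
  | i => i

theorem corrIdx_corrIdx (i : Idx × Bool) : corrIdx (corrIdx i) = i := by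
  rcases i with ⟨_ | _ | _ | _, s⟩ <;> simp [corrIdx]

/-- Over 0 and ∞ this is given by the two product identities. The points γ_1^± lie on z = ∞ and the
points β_1^± on C, so both sides of the equation vanish. -/
theorem corr_centre (H : Admissible q t Θ) (i : Idx × Bool) (hi : ∀ s, i ≠ (.t, s)) :
    Corr q t Θ (centre (hirz 0) (gammaPt q t Θ) i)
      (centre (hirz 2) (betaPt q t Θ) (corrIdx i)) := by
  have hq := sub_ne_zero.2 H.q_ne_one
  have ht := H.ne_zero .t
  rcases i with ⟨_ | _ | _ | _, s⟩ <;> simp only [corrIdx]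
  · rw [centre_mk (gammaPt_zero s), centre_mk (betaPt_zero s), corr_iff]
    have := gammaZero_mul_betaZero H s
    simp [CorrEq, hirzHom, quad]
    field_simp
    linear_combination this
  · rw [centre_mk (gammaPt_one s), centre_mk (betaPt_one s), corr_iff]
    simp [CorrEq, hirzHom, quad]
    right
    field_simp
    ring
  · exact absurd rfl (hi s)
  · rw [centre_mk (gammaPt_inf s), centre_mk (betaPt_inf _), corr_iff]
    have := gammaInf_mul_betaInf H s
    simp [CorrEq, hirzHom, quad]
    linear_combination this

end

section

/-! ### Lifting correspondences to blow ups -/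

section Charts

variable {n : ℕ} {I : Type} (p : I → (c : (hirz n).Chart) × (hirz n).dom c)

/-- Homogeneous coordinates of the image under the blow down map of a point in a chart. -/
def baseHom (c : Fin 4 ⊕ (I × Fin 2)) (x : A2) : HirzCoord :=
  hirzHom (baseChart p c) (baseMap p c x)

variable {p}

theorem blowMap_zero (a x : A2) : blowMap a 0 x = ![a 0 + x 0, a 1 + x 0 * x 1] := by
  funext k
  fin_cases k <;> simp [blowMap, dir]

theorem blowMap_one (a x : A2) : blowMap a 1 x = ![a 0 + x 1 * x 0, a 1 + x 1] := by
  funext k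
  fin_cases k <;> simp [blowMap, dir]

theorem baseHom_zero {i : I} {c : Fin 4} {a b : ℂ} (h : p i = chartPt n c a b) (x : A2) :
    baseHom p (.inr (i, 0)) x = hirzHom c ![a + x 0, b + x 0 * x 1] := by
  simp only [baseHom, baseChart, baseMap, blowMap_zero]
  rw [h]
  rfl

theorem baseHom_one {i : I} {c : Fin 4} {a b : ℂ} (h : p i = chartPt n c a b) (x : A2) :
    baseHom p (.inr (i, 1)) x = hirzHom c ![a + x 1 * x 0, b + x 1] := by
  simp only [baseHom, baseChart, baseMap, blowMap_one]
  rw [h]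
  rfl

theorem mem_blowUpDom_of_eq_zero {X : AlgSurface} {p : I → (c : X.Chart) × X.dom c} (i : I)
    {k : Fin 2} {w : A2} (hw : w k = 0) : w ∈ blowUpDom X p (.inr (i, k)) :=
  (exceptional_chart i k w hw).fst

theorem vec_congr {a b c d : ℂ} (h : a = c) (h' : b = d) : (![a, b] : A2) = ![c, d] := by
  rw [h, h']

end Charts

section Lift

variable {n m : ℕ} {I J : Type} [Finite I] [Finite J] (K : (hirz n).Pt → (hirz m).Pt → Prop)
  (p : I → (c : (hirz n).Chart) × (hirz n).dom c) (p' : J → (c : (hirz m).Chart) × (hirz m).dom c)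

/-- The correspondence between two blow ups, outside of the exceptional lines. -/
def LiftRel (P : (blowUp (hirz n) p).Pt) (Q : (blowUp (hirz m) p').Pt) : Prop :=
  K (blowDown _ p P) (blowDown _ p' Q) ∧ (∀ i, blowDown _ p P ≠ centre _ p i) ∧
    ∀ j, blowDown _ p' Q ≠ centre _ p' j

variable {K p p'}

theorem Extends.mono {X Y : AlgSurface} {ρ ρ' : X.Pt → Y.Pt → Prop} (h : ∀ P Q, ρ P Q → ρ' P Q)
    {P : X.Pt} {Q : Y.Pt} (hρ : Extends X Y ρ P Q) : Extends X Y ρ' P Q := by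
  obtain ⟨c, d, w, r, hr, h1, h2, h3, h4⟩ := hρ
  refine ⟨c, d, w, r, hr, h1, h2, h3, h4.mono fun x hx => ?_⟩
  obtain ⟨hx, hx', e⟩ := hx
  exact ⟨hx, hx', h _ _ e⟩

theorem extends_flip {P : (blowUp (hirz n) p).Pt} {Q : (blowUp (hirz m) p').Pt}
    (h : Extends _ _ (LiftRel (flip K) p' p) Q P) : Extends _ _ (flip (LiftRel K p p')) Q P :=
  h.mono fun _ _ h => ⟨h.1, h.2.2, h.2.1⟩

theorem blowDown_par_hirz (c : Fin 4 ⊕ (I × Fin 2)) (w : blowUpDom (hirz n) p c) :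
    blowDown (hirz n) p (blowUpPar (hirz n) p c w) = hirzMk n (baseHom p c w) :=
  blowDown_par (X := hirz n) c w

theorem blowDown_par_ne {X : AlgSurface} {p : I → (c : X.Chart) × X.dom c}
    (c : X.Chart ⊕ (I × Fin 2)) (w : blowUpDom X p c)
    (h : ∀ i k, c = .inr (i, k) → w.1 k ≠ 0) (j : I) :
    blowDown X p (blowUpPar X p c w) ≠ centre X p j := by
  rcases c with c | ⟨i, k⟩
  · exact w.2.2 j
  · rw [blowUpPar_gen w (h i k rfl)]
    exact w.2.2 (h i k rfl) j

/-- The working criterion for germs: a formula regular at the point, a value in the target chart,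
generic values off the exceptional line, and the correspondence checked generically after blowing
down. -/
theorem extends_of_charts (c : Fin 4 ⊕ (I × Fin 2)) (d : Fin 4 ⊕ (J × Fin 2)) (r : A2 → A2)
    {w : A2} (hw : w ∈ blowUpDom (hirz n) p c) (hr : ∀ k, RegAt (fun x => r x k) w)
    (h : r w ∈ blowUpDom (hirz m) p' d)
    (hd : ∀ j k, d = .inr (j, k) → ∀ᶠ x in genericFilter, r x k ≠ 0)
    (hK : ∀ᶠ x in genericFilter, K (hirzMk n (baseHom p c x)) (hirzMk m (baseHom p' d (r x)))) :
    Extends (blowUp (hirz n) p) (blowUp (hirz m) p') (LiftRel K p p')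
      (blowUpPar (hirz n) p c ⟨w, hw⟩) (blowUpPar (hirz m) p' d ⟨r w, h⟩) := by
  have hc : ∀ᶠ x : A2 in genericFilter, ∀ i k, c = .inr (i, k) → x k ≠ 0 := by
    rcases c with c | ⟨i, k⟩
    · simp
    · filter_upwards [generic_coord_ne k 0] with x hx i' k' e
      cases e
      exact hx
  have hd' : ∀ᶠ x : A2 in genericFilter, ∀ j k, d = .inr (j, k) → r x k ≠ 0 := by
    rcases d with d | ⟨j, k⟩
    · simp
    · filter_upwards [hd j k rfl] with x hx j' k' e
      cases e
      exact hx
  refine ⟨c, d, ⟨w, hw⟩, r, h, hr, rfl, rfl, ?_⟩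
  filter_upwards [hc, hd', hK, genericFilter_le w (blowUpDom_open (X := hirz n) c w hw),
    genericFilter_le w ((tendsto_zNhds hr).eventually
      (blowUpDom_open (X := hirz m) d _ h))] with x h1 h2 h3 h4 h5
  refine ⟨h4, h5, ?_, blowDown_par_ne (X := hirz n) c ⟨x, h4⟩ h1,
    blowDown_par_ne (X := hirz m) d ⟨r x, h5⟩ h2⟩
  exact (congrArg₂ K (blowDown_par_hirz c ⟨x, h4⟩) (blowDown_par_hirz d ⟨r x, h5⟩)).mpr h3

/-- A pair of mutually inverse regular maps in charts that preserve the first coordinate and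
satisfy the correspondence `K`. -/
def LocalIso (K : (hirz n).Pt → (hirz m).Pt → Prop) (c d : Fin 4) (w w' : A2) : Prop :=
  ∃ r r' : A2 → A2, (∀ k, RegAt (fun x => r x k) w) ∧ (∀ k, RegAt (fun x => r' x k) w') ∧
    r w = w' ∧ r' w' = w ∧ (∀ x, r x 0 = x 0) ∧ (∀ x, r' x 0 = x 0) ∧
    (∀ᶠ x in zNhds w, K (hirzMk n (hirzHom c x)) (hirzMk m (hirzHom d (r x))) ∧ r' (r x) = x) ∧
    ∀ᶠ x in zNhds w', K (hirzMk n (hirzHom c (r' x))) (hirzMk m (hirzHom d x)) ∧ r (r' x) = x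

theorem LocalIso.symm {c d : Fin 4} {w w' : A2} (h : LocalIso K c d w w') :
    LocalIso (flip K) d c w' w := by
  obtain ⟨r, r', h1, h2, h3, h4, h5, h6, h7, h8⟩ := h
  exact ⟨r', r, h2, h1, h4, h3, h6, h5, h8, h7⟩

theorem LocalIso.corr {c d : Fin 4} {w w' : A2} (h : LocalIso K c d w w') :
    K (hirzMk n (hirzHom c w)) (hirzMk m (hirzHom d w')) := by
  obtain ⟨r, r', h1, h2, h3, h4, h5, h6, h7, h8⟩ := h
  rw [← h3]
  exact (mem_zNhds_self h7).1

theorem exists_blowUpPar_inl {P : (blowUp (hirz n) p).Pt} {c : Fin 4} {w : A2}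
    (h : blowDown _ p P = hirzMk n (hirzHom c w)) (hP : ∀ i, blowDown _ p P ≠ centre _ p i) :
    ∃ hw : w ∈ blowUpDom (hirz n) p (.inl c), P = blowUpPar (hirz n) p (.inl c) ⟨w, hw⟩ := by
  rw [h] at hP
  exact ⟨⟨trivial, hP⟩, (blowDown_inj (P := blowUpPar (hirz n) p (.inl c) ⟨w, ⟨trivial, hP⟩⟩)
    hP h.symm).symm⟩

theorem LocalIso.extends {c d : Fin 4} {w w' : A2} (h : LocalIso K c d w w')
    {P : (blowUp (hirz n) p).Pt} {Q : (blowUp (hirz m) p').Pt}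
    (hP : ∀ i, blowDown _ p P ≠ centre _ p i) (hQ : ∀ j, blowDown _ p' Q ≠ centre _ p' j)
    (hPw : blowDown _ p P = hirzMk n (hirzHom c w))
    (hQw : blowDown _ p' Q = hirzMk m (hirzHom d w')) :
    Extends _ _ (LiftRel K p p') P Q := by
  obtain ⟨hw, rfl⟩ := exists_blowUpPar_inl hPw hP
  obtain ⟨hw', rfl⟩ := exists_blowUpPar_inl hQw hQ
  obtain ⟨r, r', h1, h2, rfl, h4, h5, h6, h7, h8⟩ := h
  exact extends_of_charts (.inl c) (.inl d) r hw h1 hw' (by simp)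
    (genericFilter_le w (h7.mono fun x hx => hx.1))

/-- A first order expansion with polynomial coefficients: P - P(w) lies in the ideal generated by
the two coordinate differences. On the blow up these differences share a factor that can then be
divided out. -/
theorem MvPolynomial.exists_hadamard (P : MvPolynomial (Fin 2) ℂ) (w : A2) :
    ∃ A B : MvPolynomial (Fin 2) ℂ, ∀ x : A2,
      eval x P - eval w P = eval x A * (x 1 - w 1) + eval x B * (x 0 - w 0) := by
  induction P using MvPolynomial.induction_on with
  | C a => exact ⟨0, 0, by simp⟩
  | add P Q hP hQ =>
    obtain ⟨A, B, h⟩ := hP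
    obtain ⟨A', B', h'⟩ := hQ
    refine ⟨A + A', B + B', fun x => ?_⟩
    simp only [map_add]
    linear_combination h x + h' x
  | mul_X P k hP =>
    obtain ⟨A, B, h⟩ := hP
    fin_cases k
    · refine ⟨A * X 0, B * X 0 + C (eval w P), fun x => ?_⟩
      simp
      linear_combination x 0 * h x
    · refine ⟨A * X 1 + C (eval w P), B * X 1, fun x => ?_⟩
      simp
      linear_combination x 1 * h x

theorem RegAt.exists_hadamard {r : A2 → ℂ} {w : A2} (hr : RegAt r w) :
    ∃ a b : A2 → ℂ, RegAt a w ∧ RegAt b w ∧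
      ∀ᶠ x in zNhds w, r x - r w = a x * (x 1 - w 1) + b x * (x 0 - w 0) := by
  obtain ⟨P, g, hg, h⟩ := hr
  -- The numerator of r - r(w) over the denominator g · g(w); it vanishes at `w`.
  obtain ⟨A, B, hAB⟩ := MvPolynomial.exists_hadamard (P * C (eval w g) - C (eval w P) * g) w
  have hd : RegAt (fun x => eval x g * eval w g) w := (RegAt.poly g w).mul (RegAt.const _ w)
  refine ⟨fun x => eval x A / (eval x g * eval w g), fun x => eval x B / (eval x g * eval w g),
    (RegAt.poly A w).div hd (mul_ne_zero hg hg), (RegAt.poly B w).div hd (mul_ne_zero hg hg), ?_⟩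
  filter_upwards [h, zNhds_ne w g hg] with x hx hx'
  rw [hx, mem_zNhds_self h]
  have := hAB x
  simp only [map_sub, map_mul, eval_C] at this
  field_simp
  linear_combination this

/-- The map fixes the first coordinate, so its behaviour on directions is governed by the expansion
of the second. The coefficient `a` is nonzero at `w` because the inverse map, restricted to the
fibre through `w`, has the reciprocal coefficient. -/
theorem LocalIso.exists_linear {c d : Fin 4} {w w' : A2} (h : LocalIso K c d w w') :
    ∃ a b : A2 → ℂ, RegAt a w ∧ RegAt b w ∧ a w ≠ 0 ∧ ∀ᶠ x in zNhds w,
      K (hirzMk n (hirzHom c x))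
        (hirzMk m (hirzHom d ![x 0, w' 1 + (a x * (x 1 - w 1) + b x * (x 0 - w 0))])) := by
  obtain ⟨r, r', h1, h2, rfl, h4, h5, h6, h7, h8⟩ := h
  obtain ⟨a, b, ha, hb, hab⟩ := (h1 1).exists_hadamard
  obtain ⟨a', b', ha', hb', hab'⟩ := (h2 1).exists_hadamard
  refine ⟨a, b, ha, hb, fun h0 => ?_, ?_⟩
  · obtain ⟨s, hs0, hs1⟩ : ∃ s : A2 → A2, (∀ x, s x 0 = w 0) ∧ ∀ x, s x 1 = x 1 :=
      ⟨fun x => ![w 0, x 1], fun _ => rfl, fun _ => rfl⟩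
    have hs : ∀ k, RegAt (fun x => s x k) w := fun k => by
      fin_cases k
      · simpa only [Fin.zero_eta, hs0] using RegAt.const _ w
      · simpa only [Fin.mk_one, hs1] using RegAt.coord 1 w
    have hsw : s w = w := by
      rw [← vec_eta (s w), hs0, hs1, vec_eta]
    have hts := tendsto_zNhds hs
    rw [hsw] at hts
    have hrs : ∀ k, RegAt (fun x => r (s x) k) w := fun k =>
      RegAt.comp (s := fun x => r x k) hs (by rw [hsw]; exact h1 k)
    have has : RegAt (fun x => a (s x)) w := RegAt.comp hs (by rw [hsw]; exact ha)
    have has' : RegAt (fun x => a' (r (s x))) w := RegAt.comp (r := fun x => r (s x)) hrs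
      (by rw [hsw]; exact ha')
    -- The map `s` retracts the plane onto the fibre, where the differences of first coordinates
    -- vanish. Composing the two expansions gives a'·a·(x₁ - w₁) = x₁ - w₁, and the factor x₁ - w₁
    -- cancels generically.
    have key := (has'.mul has).eq_of_generic (RegAt.const 1 w) ?_
    · rw [hsw, h0, mul_zero] at key
      exact zero_ne_one key
    · filter_upwards [generic_coord_ne 1 (w 1), genericFilter_le w (hts.eventually hab),
        genericFilter_le w (hts.eventually ((tendsto_zNhds h1).eventually hab')),
        genericFilter_le w (hts.eventually h7)] with x hx hx1 hx2 hx3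
      rw [hs0, hs1] at hx1
      rw [hx3.2, h4, h5, h5, hs0, hs1, hx1] at hx2
      refine mul_right_cancel₀ (sub_ne_zero.2 hx) ?_
      linear_combination -hx2
  · filter_upwards [h7, hab] with x hx hx'
    rw [← hx', add_sub_cancel, ← h5 x, vec_eta]
    exact hx.1

theorem excPt_eq_par (i : I) (s : ℂ) : ∃ h : ![0, s] ∈ blowUpDom (hirz n) p (.inr (i, 0)),
    excPt p i s = blowUpPar (hirz n) p (.inr (i, 0)) ⟨![0, s], h⟩ := by
  obtain ⟨h, e⟩ := exceptional_chart (p := p) i 0 ![0, s] rfl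
  exact ⟨h, e.symm⟩

/-- The correspondence extends along the exceptional lines over corresponding centres. -/
theorem LocalIso.exists_extends {c d : Fin 4} {a b b' : ℂ}
    (h : LocalIso K c d ![a, b] ![a, b']) {i : I} {j : J} (hi : p i = chartPt n c a b)
    (hj : p' j = chartPt m d a b') {P : (blowUp (hirz n) p).Pt} (hP : P ∈ exceptional _ p i) :
    ∃ Q, Extends _ _ (LiftRel K p p') P Q := by
  obtain ⟨α, β, hα, hβ, h0, hK⟩ := h.exists_linear
  simp only [Matrix.cons_val_zero, Matrix.cons_val_one] at hK
  rcases exceptional_cases i P hP with ⟨s, rfl⟩ | rfl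
  · obtain ⟨hw, e⟩ := excPt_eq_par (p := p) i s
    rw [e]
    obtain ⟨l, hl0, hl1⟩ : ∃ l : A2 → A2, (∀ x, l x 0 = a + x 0) ∧
        ∀ x, l x 1 = b + x 0 * x 1 :=
      ⟨fun x => ![a + x 0, b + x 0 * x 1], fun _ => rfl, fun _ => rfl⟩
    have hl : ∀ w k, RegAt (fun x => l x k) w := fun w k => by
      fin_cases k
      · simpa only [Fin.zero_eta, hl0] using (RegAt.const _ _).add (RegAt.coord 0 _)
      · simpa only [Fin.mk_one, hl1] using
          (RegAt.const _ _).add ((RegAt.coord 0 _).mul (RegAt.coord 1 _))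
    have hlw : l ![0, s] = ![a, b] := by
      rw [← vec_eta (l _), hl0, hl1]
      simp
    have hαl : RegAt (fun x => α (l x)) ![0, s] := RegAt.comp (hl _) (by rw [hlw]; exact hα)
    have hβl : RegAt (fun x => β (l x)) ![0, s] := RegAt.comp (hl _) (by rw [hlw]; exact hβ)
    -- With displacement (h, h·m), the image displacement is (h, h(αm + β)), so slopes change by m ↦
    -- αm + β.
    refine ⟨_, extends_of_charts (.inr (i, 0)) (.inr (j, 0))
      (fun x => ![x 0, α (l x) * x 1 + β (l x)]) hw (fun k => ?_) ?_ ?_ ?_⟩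
    · fin_cases k
      · exact RegAt.coord 0 _
      · exact (hαl.mul (RegAt.coord 1 _)).add hβl
    · exact mem_blowUpDom_of_eq_zero j rfl
    · intro _ _ e
      cases e
      exact generic_coord_ne 0 0
    · have ht := tendsto_zNhds (hl ![0, s])
      rw [hlw] at ht
      filter_upwards [genericFilter_le _ (ht.eventually hK)] with x hx
      rw [baseHom_zero hi, baseHom_zero hj, ← hl0, ← hl1, vec_eta]
      simp only [Matrix.cons_val_zero, Matrix.cons_val_one]
      rw [← hl0]
      convert hx using 5
      rw [hl0, hl1]
      ring
  · obtain ⟨hw, e⟩ := exceptional_chart (p := p) i 1 ![0, 0] rfl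
    rw [← e]
    obtain ⟨l, hl0, hl1⟩ : ∃ l : A2 → A2, (∀ x, l x 0 = a + x 1 * x 0) ∧
        ∀ x, l x 1 = b + x 1 :=
      ⟨fun x => ![a + x 1 * x 0, b + x 1], fun _ => rfl, fun _ => rfl⟩
    have hl : ∀ w k, RegAt (fun x => l x k) w := fun w k => by
      fin_cases k
      · simpa only [Fin.zero_eta, hl0] using
          (RegAt.const _ _).add ((RegAt.coord 1 _).mul (RegAt.coord 0 _))
      · simpa only [Fin.mk_one, hl1] using (RegAt.const _ _).add (RegAt.coord 1 _)
    have hlw : l ![0, 0] = ![a, b] := by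
      rw [← vec_eta (l _), hl0, hl1]
      simp
    have hαl : RegAt (fun x => α (l x)) ![0, 0] := RegAt.comp (hl _) (by rw [hlw]; exact hα)
    have hβl : RegAt (fun x => β (l x)) ![0, 0] := RegAt.comp (hl _) (by rw [hlw]; exact hβ)
    -- With displacement (h·n, h), the second coordinate moves by h(α + βn) and the inverse slope
    -- becomes n/(α + βn). The denominator is nonzero at n = 0 because α is nonzero at the centre.
    have hγ : RegAt (fun x => α (l x) + β (l x) * x 0) ![0, 0] :=
      hαl.add (hβl.mul (RegAt.coord 0 _))
    have hγ0 : α (l ![0, 0]) + β (l ![0, 0]) * ![(0 : ℂ), 0] 0 ≠ 0 := by simpa [hlw] using h0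
    refine ⟨_, extends_of_charts (.inr (i, 1)) (.inr (j, 1))
      (fun x => ![x 0 / (α (l x) + β (l x) * x 0), x 1 * (α (l x) + β (l x) * x 0)])
      hw (fun k => ?_) ?_ ?_ ?_⟩
    · fin_cases k
      · exact (RegAt.coord 0 _).div hγ hγ0
      · exact (RegAt.coord 1 _).mul hγ
    · exact mem_blowUpDom_of_eq_zero j (by simp)
    · intro _ _ e
      cases e
      filter_upwards [generic_coord_ne 1 0, hγ.generic_ne hγ0] with x hx hx'
      exact mul_ne_zero hx hx'
    · have ht := tendsto_zNhds (hl ![0, 0])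
      rw [hlw] at ht
      filter_upwards [genericFilter_le _ (ht.eventually hK), hγ.generic_ne hγ0] with x hx hx'
      rw [baseHom_one hi, baseHom_one hj, ← hl0, ← hl1, vec_eta]
      simp only [Matrix.cons_val_zero, Matrix.cons_val_one]
      have e0 : a + x 1 * (α (l x) + β (l x) * x 0) * (x 0 / (α (l x) + β (l x) * x 0)) =
          l x 0 := by
        rw [mul_assoc, mul_div_cancel₀ _ hx', hl0]
      rw [e0]
      convert hx using 5
      rw [hl0, hl1]
      ring

end Lift

end

section

variable {q t : ℂ} {Θ : Idx → ℂ}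

/-! ### The correspondence in charts -/

theorem regAt_vec {a b : A2 → ℂ} {w : A2} (ha : RegAt a w) (hb : RegAt b w) (k : Fin 2) :
    RegAt (fun x => (![a x, b x] : A2) k) w := by
  fin_cases k
  · exact ha
  · exact hb

theorem regAt_quad (a b : ℂ) (e : Bool) (w : A2) :
    RegAt (fun x => quad a b (affineVec e (x 0))) w := by
  have hc := RegAt.coord 0 w
  cases e
  · simpa [quad, affineVec] using (hc.sub (RegAt.const a w)).mul (hc.sub (RegAt.const b w))
  · simpa [quad, affineVec] using ((RegAt.const 1 w).sub ((RegAt.const a w).mul hc)).mul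
      ((RegAt.const 1 w).sub ((RegAt.const b w).mul hc))

/-- One form of the graph equation serves both at finite y and at y = ∞: the degree of the quadratic
forms matches the twist of the second surface, so the chart at infinity only replaces (y, 1) by (1,
1/y). -/
theorem corr_chart_iff (e f f' : Bool) {x x' : A2} (h : x' 0 = x 0) :
    Corr q t Θ (hirzMk 0 (hirzHom (chartNo e f) x)) (hirzMk 2 (hirzHom (chartNo e f') x')) ↔
      affineVec f (x 1) 0 * (q * ((q - 1) * affineVec f' (x' 1) 0 +
        quad 1 t (affineVec e (x 0)) * affineVec f' (x' 1) 1)) =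
      quad (t * Θ .t) (t * (Θ .t)⁻¹) (affineVec e (x 0)) * affineVec f (x 1) 1 *
        affineVec f' (x' 1) 1 := by
  rw [corr_iff, CorrEq, hirzHom_chartNo, hirzHom_chartNo, h, and_iff_right (mul_comm _ _)]

/-! ### Fractional linear maps in the fibres, where A is nonzero. -/

section Mobius

variable {K : (hirz 0).Pt → (hirz 2).Pt → Prop} {c d : Fin 4} {A B : ℂ → ℂ}

/-- Both z and D are nonzero because their product is a nonzero multiple of A. The equation can then
be solved for either variable. -/
theorem localIso_finite_finite (hq0 : q ≠ 0) (hq1 : q - 1 ≠ 0)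
    (hA : ∀ w, RegAt (fun x => A (x 0)) w) (hB : ∀ w, RegAt (fun x => B (x 0)) w)
    (hK : ∀ x x' : A2, x' 0 = x 0 → x 1 * (q * ((q - 1) * x' 1 + B (x 0))) = A (x 0) →
      K (hirzMk 0 (hirzHom c x)) (hirzMk 2 (hirzHom d x')))
    {w w' : A2} (h0 : w' 0 = w 0) (hAw : A (w 0) ≠ 0)
    (h : w 1 * (q * ((q - 1) * w' 1 + B (w 0))) = A (w 0)) : LocalIso K c d w w' := by
  have hw1 : w 1 ≠ 0 := fun h1 => hAw (by rw [← h, h1, zero_mul])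
  have hD : q * ((q - 1) * w' 1 + B (w' 0)) ≠ 0 := fun h1 =>
    hAw (by rw [← h, ← h0, h1, mul_zero])
  have hAw' : A (w' 0) ≠ 0 := by rwa [h0]
  have hD' : RegAt (fun x => q * ((q - 1) * x 1 + B (x 0))) w' :=
    (RegAt.const q w').mul (((RegAt.const _ w').mul (RegAt.coord 1 w')).add (hB w'))
  refine ⟨fun x => ![x 0, (A (x 0) / (q * x 1) - B (x 0)) / (q - 1)],
    fun x => ![x 0, A (x 0) / (q * ((q - 1) * x 1 + B (x 0)))],
    regAt_vec (RegAt.coord 0 w) ((((hA w).div ((RegAt.const q w).mul (RegAt.coord 1 w))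
      (mul_ne_zero hq0 hw1)).sub (hB w)).div (RegAt.const _ w) hq1),
    regAt_vec (RegAt.coord 0 w') ((hA w').div hD' hD), ?_, ?_, fun _ => rfl, fun _ => rfl, ?_, ?_⟩
  · rw [← vec_eta w']
    refine vec_congr h0.symm ?_
    rw [← h]
    field_simp
    ring
  · rw [← vec_eta w]
    refine vec_congr h0 ?_
    rw [div_eq_iff hD, h0, h]
  · filter_upwards [(RegAt.coord 1 w).eventually_ne hw1, (hA w).eventually_ne hAw] with x h1 h2
    refine ⟨hK _ _ rfl ?_, ?_⟩
    · simp only [Matrix.cons_val_one, Matrix.cons_val_zero]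
      field_simp
      ring
    · rw [← vec_eta x]
      refine vec_congr rfl ?_
      simp only [Matrix.cons_val_one, Matrix.cons_val_zero]
      rw [mul_div_cancel₀ _ hq1, sub_add_cancel]
      field_simp
  · filter_upwards [hD'.eventually_ne hD, (hA w').eventually_ne hAw'] with x h1 h2
    refine ⟨hK _ _ rfl ?_, ?_⟩
    · simp only [Matrix.cons_val_one, Matrix.cons_val_zero]
      rw [div_mul_cancel₀ _ h1]
    · rw [← vec_eta x]
      refine vec_congr rfl ?_
      simp only [Matrix.cons_val_one, Matrix.cons_val_zero]
      have h3 := right_ne_zero_of_mul h1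
      field_simp
      ring

/-- The case z = 0, v = ∞. In terms of z and v₁ = 1/v the equation z q((q - 1) + B v₁) = A v₁ can be
solved either way near the origin, since A and q(q - 1) are nonzero. -/
theorem localIso_finite_inf (hq0 : q ≠ 0) (hq1 : q - 1 ≠ 0)
    (hA : ∀ w, RegAt (fun x => A (x 0)) w) (hB : ∀ w, RegAt (fun x => B (x 0)) w)
    (hK : ∀ x x' : A2, x' 0 = x 0 → x 1 * (q * ((q - 1) + B (x 0) * x' 1)) = A (x 0) * x' 1 →
      K (hirzMk 0 (hirzHom c x)) (hirzMk 2 (hirzHom d x')))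
    {w w' : A2} (h0 : w' 0 = w 0) (hAw : A (w 0) ≠ 0) (hw1 : w 1 = 0) (hw1' : w' 1 = 0) :
    LocalIso K c d w w' := by
  have hAw' : A (w' 0) ≠ 0 := by rwa [h0]
  have hD : A (w 0) - q * B (w 0) * w 1 ≠ 0 := by rwa [hw1, mul_zero, sub_zero]
  have hD' : q * ((q - 1) + B (w' 0) * w' 1) ≠ 0 := by
    rw [hw1', mul_zero, add_zero]
    exact mul_ne_zero hq0 hq1
  have rD : RegAt (fun x => A (x 0) - q * B (x 0) * x 1) w :=
    (hA w).sub (((RegAt.const q w).mul (hB w)).mul (RegAt.coord 1 w))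
  have rD' : RegAt (fun x => q * ((q - 1) + B (x 0) * x 1)) w' :=
    (RegAt.const q w').mul ((RegAt.const _ w').add ((hB w').mul (RegAt.coord 1 w')))
  refine ⟨fun x => ![x 0, (q - 1) * q * x 1 / (A (x 0) - q * B (x 0) * x 1)],
    fun x => ![x 0, A (x 0) * x 1 / (q * ((q - 1) + B (x 0) * x 1))],
    regAt_vec (RegAt.coord 0 w) (((RegAt.const _ w).mul (RegAt.coord 1 w)).div rD hD),
    regAt_vec (RegAt.coord 0 w') (((hA w').mul (RegAt.coord 1 w')).div rD' hD'),
    ?_, ?_, fun _ => rfl, fun _ => rfl, ?_, ?_⟩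
  · rw [← vec_eta w']
    refine vec_congr h0.symm ?_
    rw [hw1, hw1', mul_zero, zero_div]
  · rw [← vec_eta w]
    refine vec_congr h0 ?_
    rw [hw1, hw1', mul_zero, zero_div]
  · filter_upwards [rD.eventually_ne hD, (hA w).eventually_ne hAw] with x h1 h2
    have h3 : q * ((q - 1) + B (x 0) * ((q - 1) * q * x 1 / (A (x 0) - q * B (x 0) * x 1))) =
        q * (q - 1) * A (x 0) / (A (x 0) - q * B (x 0) * x 1) := by
      field_simp
      ring
    refine ⟨hK _ _ rfl ?_, ?_⟩
    · simp only [Matrix.cons_val_one, Matrix.cons_val_zero]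
      rw [h3]
      field_simp
    · rw [← vec_eta x]
      refine vec_congr rfl ?_
      simp only [Matrix.cons_val_one, Matrix.cons_val_zero]
      rw [h3]
      field_simp
      exact mul_div_cancel_right₀ _ (by convert h1 using 1; ring)
  · filter_upwards [rD'.eventually_ne hD', (hA w').eventually_ne hAw'] with x h1 h2
    have h3 : A (x 0) - q * B (x 0) * (A (x 0) * x 1 / (q * ((q - 1) + B (x 0) * x 1))) =
        q * (q - 1) * A (x 0) / (q * ((q - 1) + B (x 0) * x 1)) := by
      rw [eq_div_iff h1, sub_mul, mul_assoc, div_mul_cancel₀ _ h1]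
      ring
    refine ⟨hK _ _ rfl ?_, ?_⟩
    · simp only [Matrix.cons_val_one, Matrix.cons_val_zero]
      rw [div_mul_cancel₀ _ h1]
    · rw [← vec_eta x]
      refine vec_congr rfl ?_
      simp only [Matrix.cons_val_one, Matrix.cons_val_zero]
      rw [h3]
      have h4 := right_ne_zero_of_mul h1
      field_simp
      exact mul_div_cancel_right₀ _ (by convert h4 using 1; ring)

/-- With 1/z in place of z the equation is affine in both unknowns. This covers z = ∞, where v lies
on C and is finite, so no chart with both second coordinates inverted is needed. -/
theorem localIso_inf_finite (hq0 : q ≠ 0) (hq1 : q - 1 ≠ 0)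
    (hA : ∀ w, RegAt (fun x => A (x 0)) w) (hB : ∀ w, RegAt (fun x => B (x 0)) w)
    (hK : ∀ x x' : A2, x' 0 = x 0 → q * ((q - 1) * x' 1 + B (x 0)) = A (x 0) * x 1 →
      K (hirzMk 0 (hirzHom c x)) (hirzMk 2 (hirzHom d x')))
    {w w' : A2} (h0 : w' 0 = w 0) (hAw : A (w 0) ≠ 0)
    (h : q * ((q - 1) * w' 1 + B (w 0)) = A (w 0) * w 1) : LocalIso K c d w w' := by
  have hAw' : A (w' 0) ≠ 0 := by rwa [h0]
  refine ⟨fun x => ![x 0, (A (x 0) * x 1 / q - B (x 0)) / (q - 1)],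
    fun x => ![x 0, q * ((q - 1) * x 1 + B (x 0)) / A (x 0)],
    regAt_vec (RegAt.coord 0 w) (((((hA w).mul (RegAt.coord 1 w)).div (RegAt.const q w) hq0).sub
      (hB w)).div (RegAt.const _ w) hq1),
    regAt_vec (RegAt.coord 0 w') (((RegAt.const q w').mul (((RegAt.const _ w').mul
      (RegAt.coord 1 w')).add (hB w'))).div (hA w') hAw'),
    ?_, ?_, fun _ => rfl, fun _ => rfl, ?_, ?_⟩
  · rw [← vec_eta w']
    refine vec_congr h0.symm ?_
    rw [← h]
    field_simp
    ring
  · rw [← vec_eta w]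
    refine vec_congr h0 ?_
    rw [h0, h, mul_div_cancel_left₀ _ hAw]
  · filter_upwards [(hA w).eventually_ne hAw] with x h2
    have h3 : q * ((q - 1) * ((A (x 0) * x 1 / q - B (x 0)) / (q - 1)) + B (x 0)) =
        A (x 0) * x 1 := by
      rw [mul_div_cancel₀ _ hq1, sub_add_cancel, mul_div_cancel₀ _ hq0]
    refine ⟨hK _ _ rfl h3, ?_⟩
    rw [← vec_eta x]
    refine vec_congr rfl ?_
    simp only [Matrix.cons_val_one, Matrix.cons_val_zero]
    rw [h3, mul_div_cancel_left₀ _ h2]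
  · filter_upwards [(hA w').eventually_ne hAw'] with x h2
    refine ⟨hK _ _ rfl ?_, ?_⟩
    · simp only [Matrix.cons_val_one, Matrix.cons_val_zero]
      rw [mul_div_cancel₀ _ h2]
    · rw [← vec_eta x]
      refine vec_congr rfl ?_
      simp only [Matrix.cons_val_one, Matrix.cons_val_zero]
      rw [mul_div_cancel₀ _ h2]
      field_simp
      ring

end Mobius

theorem localIso_ff (H : Admissible q t Θ) (e : Bool) {w w' : A2} (h0 : w' 0 = w 0)
    (hA : quad (t * Θ .t) (t * (Θ .t)⁻¹) (affineVec e (w 0)) ≠ 0)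
    (h : w 1 * (q * ((q - 1) * w' 1 + quad 1 t (affineVec e (w 0)))) =
      quad (t * Θ .t) (t * (Θ .t)⁻¹) (affineVec e (w 0))) :
    LocalIso (Corr q t Θ) (chartNo e false) (chartNo e false) w w' :=
  localIso_finite_finite (A := fun y => quad _ _ (affineVec e y))
    (B := fun y => quad _ _ (affineVec e y)) H.q_ne_zero (sub_ne_zero.2 H.q_ne_one)
    (regAt_quad _ _ e) (regAt_quad _ _ e)
    (fun x x' hx hx' => (corr_chart_iff e false false hx).2 (by simpa [affineVec] using hx'))
    h0 hA h

theorem localIso_fi (H : Admissible q t Θ) (e : Bool) {w w' : A2} (h0 : w' 0 = w 0)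
    (hA : quad (t * Θ .t) (t * (Θ .t)⁻¹) (affineVec e (w 0)) ≠ 0) (h1 : w 1 = 0) (h2 : w' 1 = 0) :
    LocalIso (Corr q t Θ) (chartNo e false) (chartNo e true) w w' :=
  localIso_finite_inf (A := fun y => quad _ _ (affineVec e y))
    (B := fun y => quad _ _ (affineVec e y)) H.q_ne_zero (sub_ne_zero.2 H.q_ne_one)
    (regAt_quad _ _ e) (regAt_quad _ _ e)
    (fun x x' hx hx' => (corr_chart_iff e false true hx).2 (by simpa [affineVec] using hx'))
    h0 hA h1 h2

theorem localIso_if (H : Admissible q t Θ) (e : Bool) {w w' : A2} (h0 : w' 0 = w 0)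
    (hA : quad (t * Θ .t) (t * (Θ .t)⁻¹) (affineVec e (w 0)) ≠ 0)
    (h : q * ((q - 1) * w' 1 + quad 1 t (affineVec e (w 0))) =
      quad (t * Θ .t) (t * (Θ .t)⁻¹) (affineVec e (w 0)) * w 1) :
    LocalIso (Corr q t Θ) (chartNo e true) (chartNo e false) w w' :=
  localIso_inf_finite (A := fun y => quad _ _ (affineVec e y))
    (B := fun y => quad _ _ (affineVec e y)) H.q_ne_zero (sub_ne_zero.2 H.q_ne_one)
    (regAt_quad _ _ e) (regAt_quad _ _ e)
    (fun x x' hx hx' => (corr_chart_iff e true false hx).2 (by simpa [affineVec] using hx'))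
    h0 hA h

end

section

variable {q t : ℂ} {Θ : Idx → ℂ}

/-! ### The fibres over `t Θ_t` and `t / Θ_t` -/

section Node

variable (s : Bool) {x x' : A2}

theorem corr_ff (h : x' 0 = x 0)
    (h' : x 1 * (q * ((q - 1) * x' 1 + (x 0 - 1) * (x 0 - t))) =
      (x 0 - tNode t Θ s) * (x 0 - tNode t Θ (!s))) :
    Corr q t Θ (hirzMk 0 (hirzHom 0 x)) (hirzMk 2 (hirzHom 0 x')) :=
  (corr_chart_iff false false false h).2 (by
    rw [quad_tNode _ s]; simpa [affineVec, quad] using h')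

theorem corr_fi (h : x' 0 = x 0)
    (h' : x 1 * (q * ((q - 1) + (x 0 - 1) * (x 0 - t) * x' 1)) =
      (x 0 - tNode t Θ s) * (x 0 - tNode t Θ (!s)) * x' 1) :
    Corr q t Θ (hirzMk 0 (hirzHom 0 x)) (hirzMk 2 (hirzHom 1 x')) :=
  (corr_chart_iff false false true h).2 (by
    rw [quad_tNode _ s]; simpa [affineVec, quad] using h')

theorem corr_if (h : x' 0 = x 0)
    (h' : q * ((q - 1) * x' 1 + (x 0 - 1) * (x 0 - t)) =
      (x 0 - tNode t Θ s) * (x 0 - tNode t Θ (!s)) * x 1) :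
    Corr q t Θ (hirzMk 0 (hirzHom 1 x)) (hirzMk 2 (hirzHom 0 x')) :=
  (corr_chart_iff false true false h).2 (by
    rw [quad_tNode _ s]; simpa [affineVec, quad] using h')

end Node

/-- The correspondence between the blown up surfaces, outside of the exceptional lines. -/
abbrev graphRel (q t : ℂ) (Θ : Idx → ℂ) :
    (sakaiSurface q t Θ).Pt → (modSurface q t Θ).Pt → Prop :=
  LiftRel (Corr q t Θ) (gammaPt q t Θ) (betaPt q t Θ)

/-- The only centre on a degenerate fibre is γ_t^±, and it lies on z = 0. -/
theorem gamma_ne_of_vLine (H : Admissible q t Θ) {s : Bool} {x : HirzCoord}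
    (hx : x.1.1 0 = tNode t Θ s * x.1.1 1) (h : x.1.2 0 ≠ 0) (i : Idx × Bool) :
    hirzMk 0 x ≠ centre (hirz 0) (gammaPt q t Θ) i := by
  have h1 := oneNode_ne_tNode H
  have h2 := tNode_ne_zero H
  intro e
  have hm : centre (hirz 0) (gammaPt q t Θ) i ∈ vLine 0 (tNode t Θ s) :=
    e ▸ (hirzMk_mem_vLine _ _ _).2 hx
  rcases i with ⟨_ | _ | _ | _, s'⟩
  · rw [centre_mk (gammaPt_zero s'), hirzMk_mem_vLine] at hm
    simp [hirzHom, (h2 _).symm] at hm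
  · rw [centre_mk (gammaPt_one s'), hirzMk_mem_vLine] at hm
    simp [hirzHom, h1] at hm
  · have hz : hirzMk 0 x ∈ hLineZero 0 := by
      rw [e, centre_mk (gammaPt_t s'), hirzMk_mem_hLineZero]
      simp [hirzHom]
    exact h ((hirzMk_mem_hLineZero _ _).1 hz)
  · rw [centre_mk (gammaPt_inf s'), hirzMk_mem_vLine] at hm
    simp [hirzHom] at hm

/-- The only centre on a degenerate fibre is β_t^±, and it lies on C. -/
theorem beta_ne_of_vLine (H : Admissible q t Θ) {s : Bool} {x : HirzCoord}
    (hx : x.1.1 0 = tNode t Θ s * x.1.1 1)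
    (h : (q - 1) * x.1.2 0 + quad 1 t x.1.1 * x.1.2 1 ≠ 0) (i : Idx × Bool) :
    hirzMk 2 x ≠ centre (hirz 2) (betaPt q t Θ) i := by
  have h1 := oneNode_ne_tNode H
  have h2 := tNode_ne_zero H
  have hq := sub_ne_zero.2 H.q_ne_one
  intro e
  have hm : centre (hirz 2) (betaPt q t Θ) i ∈ vLine 2 (tNode t Θ s) :=
    e ▸ (hirzMk_mem_vLine _ _ _).2 hx
  rcases i with ⟨_ | _ | _ | _, s'⟩
  · rw [centre_mk (betaPt_zero s'), hirzMk_mem_vLine] at hm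
    simp [hirzHom, (h2 _).symm] at hm
  · rw [centre_mk (betaPt_one s'), hirzMk_mem_vLine] at hm
    simp [hirzHom, h1] at hm
  · have hz : hirzMk 2 x ∈ curveC q t := by
      rw [e, centre_mk (betaPt_t s'), hirzMk_mem_curveC H.q_ne_one]
      simp [hirzHom, quad]
      field_simp
      ring
    exact h ((hirzMk_mem_curveC H.q_ne_one _ _).1 hz)
  · rw [centre_mk (betaPt_inf s'), hirzMk_mem_vLine] at hm
    simp [hirzHom] at hm

/-- The data of an elementary transformation in the fibres over `y₀`: the correspondence is
`q z ((q - 1) v + (y - 1) (y - t)) = (y - y₀) (y - y₁)`, the centre in the first surface is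
`(y₀, 0)` and the centre in the second surface is `(y₀, v₀)`. -/
structure IsNode {I J : Type} (K : (hirz 0).Pt → (hirz 2).Pt → Prop)
    (p : I → (c : (hirz 0).Chart) × (hirz 0).dom c) (p' : J → (c : (hirz 2).Chart) × (hirz 2).dom c)
    (i : I) (j : J) (q t y₀ y₁ v₀ : ℂ) : Prop where
  q0 : q ≠ 0
  q1 : q - 1 ≠ 0
  ne : y₀ - y₁ ≠ 0
  left : p i = chartPt 0 0 y₀ 0
  right : p' j = chartPt 2 0 y₀ v₀
  v_eq : (q - 1) * v₀ = -((y₀ - 1) * (y₀ - t))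
  ff : ∀ x x' : A2, x' 0 = x 0 →
    x 1 * (q * ((q - 1) * x' 1 + (x 0 - 1) * (x 0 - t))) = (x 0 - y₀) * (x 0 - y₁) →
    K (hirzMk 0 (hirzHom 0 x)) (hirzMk 2 (hirzHom 0 x'))
  fi : ∀ x x' : A2, x' 0 = x 0 →
    x 1 * (q * ((q - 1) + (x 0 - 1) * (x 0 - t) * x' 1)) = (x 0 - y₀) * (x 0 - y₁) * x' 1 →
    K (hirzMk 0 (hirzHom 0 x)) (hirzMk 2 (hirzHom 1 x'))
  inf : ∀ x x' : A2, x' 0 = x 0 →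
    q * ((q - 1) * x' 1 + (x 0 - 1) * (x 0 - t)) = (x 0 - y₀) * (x 0 - y₁) * x 1 →
    K (hirzMk 0 (hirzHom 1 x)) (hirzMk 2 (hirzHom 0 x'))
  left_ne : ∀ x : HirzCoord, x.1.1 0 = y₀ * x.1.1 1 → x.1.2 0 ≠ 0 → ∀ i,
    hirzMk 0 x ≠ centre (hirz 0) p i
  right_ne : ∀ x : HirzCoord, x.1.1 0 = y₀ * x.1.1 1 →
    (q - 1) * x.1.2 0 + quad 1 t x.1.1 * x.1.2 1 ≠ 0 → ∀ j, hirzMk 2 x ≠ centre (hirz 2) p' j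

theorem isNode (H : Admissible q t Θ) (s : Bool) : IsNode (Corr q t Θ) (gammaPt q t Θ)
    (betaPt q t Θ) (.t, s) (.t, s) q t (tNode t Θ s) (tNode t Θ (!s))
    (-((tNode t Θ s - 1) * (tNode t Θ s - t)) / (q - 1)) where
  q0 := H.q_ne_zero
  q1 := sub_ne_zero.2 H.q_ne_one
  ne := sub_ne_zero.2 (tNode_not_ne H s)
  left := gammaPt_t s
  right := betaPt_t s
  v_eq := mul_div_cancel₀ _ (sub_ne_zero.2 H.q_ne_one)
  ff _ _ := corr_ff s
  fi _ _ := corr_fi s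
  inf _ _ := corr_if s
  left_ne _ := gamma_ne_of_vLine H
  right_ne _ := beta_ne_of_vLine H

theorem baseHom_inl {n : ℕ} {I : Type} (p : I → (c : (hirz n).Chart) × (hirz n).dom c) (c : Fin 4)
    (x : A2) : baseHom p (.inl c) x = hirzHom c x := rfl

theorem mem_inl {n : ℕ} {I : Type} {p : I → (c : (hirz n).Chart) × (hirz n).dom c} {c : Fin 4}
    {w : A2} (h : ∀ i, hirzMk n (hirzHom c w) ≠ centre (hirz n) p i) :
    w ∈ blowUpDom (hirz n) p (.inl c) := ⟨trivial, h⟩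

/-! ### The elementary transformation at a node, in charts. -/

section

variable {I J : Type} [Finite I] [Finite J] {K : (hirz 0).Pt → (hirz 2).Pt → Prop}
  {p : I → (c : (hirz 0).Chart) × (hirz 0).dom c} {p' : J → (c : (hirz 2).Chart) × (hirz 2).dom c}
  {i : I} {j : J} {y₀ y₁ v₀ : ℂ}

/-- A fibre point with z finite and nonzero goes to a direction at β. Put v = v₀ + (y - y₀)m; since
B(y) - B(y₀) = (y - y₀)(y + y₀ - 1 - t), the factor y - y₀ cancels from the graph equation and m is
determined regularly. -/
theorem IsNode.exists_extends_node_ff (N : IsNode K p p' i j q t y₀ y₁ v₀)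
    {P : (blowUp (hirz 0) p).Pt} {w : A2} (hP : ∀ i, blowDown _ p P ≠ centre _ p i)
    (hw : blowDown _ p P = hirzMk 0 (hirzHom 0 w))
    (h0 : w 0 = y₀) (h1 : w 1 ≠ 0) : ∃ Q, Extends _ _ (LiftRel K p p') P Q := by
  have hq0 := N.q0
  have hq1 := N.q1
  have hβ := N.v_eq
  obtain ⟨hd, rfl⟩ := exists_blowUpPar_inl hw hP
  refine ⟨_, extends_of_charts (.inl 0) (.inr (j, 0)) (fun x => ![x 0 - y₀,
    ((x 0 - y₁) / (q * x 1) - (x 0 + y₀ - 1 - t)) / (q - 1)]) hd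
    (regAt_vec ?_ ?_) ?_ ?_ ?_⟩
  · exact (RegAt.coord 0 _).sub (RegAt.const _ _)
  · have hx := RegAt.coord 0 w
    have hc : ∀ a, RegAt (fun _ => a) w := fun a => RegAt.const a w
    exact (((hx.sub (hc _)).div ((hc _).mul (RegAt.coord 1 w)) (mul_ne_zero hq0 h1)).sub
      (((hx.add (hc _)).sub (hc _)).sub (hc _))).div (hc _) hq1
  · exact mem_blowUpDom_of_eq_zero _ (sub_eq_zero.2 h0)
  · intro _ _ e
    cases e
    exact (generic_coord_ne 0 (y₀)).mono fun x hx => sub_ne_zero.2 hx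
  · filter_upwards [generic_coord_ne 1 0] with x hx
    rw [baseHom_inl, baseHom_zero N.right]
    refine N.ff _ _ ?_ ?_
    · simp
    · simp only [Matrix.cons_val_zero, Matrix.cons_val_one]
      rw [mul_add (q - 1), hβ]
      field_simp
      ring

/-- The same slope written in 1/z, so that the point z = ∞ of the fibre is included. -/
theorem IsNode.exists_extends_node_if (N : IsNode K p p' i j q t y₀ y₁ v₀)
    {P : (blowUp (hirz 0) p).Pt} {w : A2} (hP : ∀ i, blowDown _ p P ≠ centre _ p i)
    (hw : blowDown _ p P = hirzMk 0 (hirzHom 1 w))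
    (h0 : w 0 = y₀) : ∃ Q, Extends _ _ (LiftRel K p p') P Q := by
  have hq0 := N.q0
  have hq1 := N.q1
  have hβ := N.v_eq
  obtain ⟨hd, rfl⟩ := exists_blowUpPar_inl hw hP
  refine ⟨_, extends_of_charts (.inl 1) (.inr (j, 0)) (fun x => ![x 0 - y₀,
    ((x 0 - y₁) * x 1 / q - (x 0 + y₀ - 1 - t)) / (q - 1)]) hd
    (regAt_vec ?_ ?_) ?_ ?_ ?_⟩
  · exact (RegAt.coord 0 _).sub (RegAt.const _ _)
  · have hx := RegAt.coord 0 w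
    have hc : ∀ a, RegAt (fun _ => a) w := fun a => RegAt.const a w
    exact ((((hx.sub (hc _)).mul (RegAt.coord 1 w)).div (hc _) hq0).sub
      (((hx.add (hc _)).sub (hc _)).sub (hc _))).div (hc _) hq1
  · exact mem_blowUpDom_of_eq_zero _ (sub_eq_zero.2 h0)
  · intro _ _ e
    cases e
    exact (generic_coord_ne 0 (y₀)).mono fun x hx => sub_ne_zero.2 hx
  · refine Filter.Eventually.of_forall fun x => ?_
    rw [baseHom_inl, baseHom_zero N.right]
    refine N.inf _ _ ?_ ?_
    · simp
    · simp only [Matrix.cons_val_zero, Matrix.cons_val_one]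
      rw [mul_add (q - 1), hβ]
      field_simp
      ring

/-- With z = (y - y₀)m the graph equation becomes q m D = y - y₁, whose right-hand side is nonzero
on the fibre y = y₀. The slope m thus determines a point of that fibre off C; slope 0 gives v = ∞.
-/
theorem IsNode.exists_extends_excPt (N : IsNode K p p' i j q t y₀ y₁ v₀) (m : ℂ) :
    ∃ Q, Extends _ _ (LiftRel K p p') (excPt p i m) Q := by
  have hq0 := N.q0
  have hq1 := N.q1
  have hss := N.ne
  obtain ⟨hd, e⟩ := excPt_eq_par (p := p) i m
  rw [e]
  have hx := RegAt.coord 0 ![0, m]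
  have hx1 := RegAt.coord 1 ![0, m]
  have hc : ∀ a, RegAt (fun _ => a) ![0, m] := fun a => RegAt.const a _
  by_cases hm : m = 0
  · subst hm
    have hA : y₀ + ![(0 : ℂ), 0] 0 - y₁ - q * (y₀ + ![(0 : ℂ), 0] 0 - 1) *
        (y₀ + ![(0 : ℂ), 0] 0 - t) * ![(0 : ℂ), 0] 1 ≠ 0 := by
      simpa using hss
    have rA : RegAt (fun x => y₀ + x 0 - y₁ - q * (y₀ + x 0 - 1) *
        (y₀ + x 0 - t) * x 1) ![0, 0] :=
      (((hc _).add hx).sub (hc _)).sub ((((hc q).mul (((hc _).add hx).sub (hc _))).mul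
        (((hc _).add hx).sub (hc _))).mul hx1)
    refine ⟨_, extends_of_charts (.inr (i, 0)) (.inl 1) (fun x => ![y₀ + x 0,
      (q - 1) * q * x 1 / (y₀ + x 0 - y₁ - q * (y₀ + x 0 - 1) *
        (y₀ + x 0 - t) * x 1)]) hd (regAt_vec ?_ ?_) ?_ ?_ ?_⟩
    · exact (hc _).add hx
    · exact ((hc _).mul hx1).div rA hA
    · refine mem_inl (N.right_ne _ ?_ ?_)
      · simp [hirzHom]
      · simp [hirzHom, hq1]
    · intro _ _ e
      cases e
    · filter_upwards [rA.generic_ne hA] with x hx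
      rw [baseHom_inl, baseHom_zero N.left]
      refine N.fi _ _ ?_ ?_
      · simp
      · simp only [Matrix.cons_val_zero, Matrix.cons_val_one]
        obtain ⟨A, hA⟩ : ∃ A, A = y₀ + x 0 - y₁ - q * (y₀ + x 0 - 1) * (y₀ + x 0 - t) * x 1 :=
          ⟨_, rfl⟩
        rw [← hA] at hx ⊢
        field_simp
        linear_combination (x 0 * x 1) * hA
  · refine ⟨_, extends_of_charts (.inr (i, 0)) (.inl 0) (fun x => ![y₀ + x 0,
      ((y₀ + x 0 - y₁) / (q * x 1) - (y₀ + x 0 - 1) *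
        (y₀ + x 0 - t)) / (q - 1)]) hd (regAt_vec ?_ ?_) ?_ ?_ ?_⟩
    · exact (hc _).add hx
    · exact (((((hc _).add hx).sub (hc _)).div ((hc _).mul hx1) (mul_ne_zero hq0 hm)).sub
        ((((hc _).add hx).sub (hc _)).mul (((hc _).add hx).sub (hc _)))).div (hc _) hq1
    · refine mem_inl (N.right_ne _ ?_ ?_)
      · simp [hirzHom]
      · have : (y₀ - y₁) / (q * m) ≠ 0 := div_ne_zero hss (mul_ne_zero hq0 hm)
        simpa [hirzHom, quad, mul_div_cancel₀ _ hq1] using this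
    · intro _ _ e
      cases e
    · filter_upwards [generic_coord_ne 1 0] with x hx
      rw [baseHom_inl, baseHom_zero N.left]
      refine N.ff _ _ ?_ ?_
      · simp
      · simp only [Matrix.cons_val_zero, Matrix.cons_val_one]
        field_simp
        ring

/-- The vertical direction at γ is where the exceptional line meets the strict transform of the
fibre, and it corresponds to the vertical direction at β. With y - y₀ = z n one finds v - v₀ = n D,
where this D is a unit at the origin because y₀ ≠ y₁, and the inverse slope at β is z/D. -/
theorem IsNode.exists_extends_vertical (N : IsNode K p p' i j q t y₀ y₁ v₀) :
    ∃ Q, Extends (blowUp (hirz 0) p) _ (LiftRel K p p')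
      (.inr (i, Projectivization.mk ℂ (dir 1 ![0, 0]) (dir_ne_zero _ _))) Q := by
  have hq0 := N.q0
  have hq1 := N.q1
  have hβ := N.v_eq
  have hss := N.ne
  obtain ⟨hd, e⟩ := exceptional_chart (p := p) i 1 ![0, 0] rfl
  rw [← e]
  have hx := RegAt.coord 0 ![0, 0]
  have hx1 := RegAt.coord 1 ![0, 0]
  have hc : ∀ a, RegAt (fun _ => a) ![0, 0] := fun a => RegAt.const a _
  obtain ⟨D, hD⟩ : ∃ D : A2 → ℂ, ∀ x, D x = ((y₀ + x 1 * x 0 - y₁) / q -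
    x 1 * (y₀ + x 1 * x 0 + y₀ - 1 - t)) / (q - 1) := ⟨_, fun _ => rfl⟩
  have rD : RegAt D ![0, 0] := by
    refine RegAt.congr ?_ (Filter.Eventually.of_forall hD)
    have h := (hc (y₀)).add (hx1.mul hx)
    exact (((h.sub (hc _)).div (hc _) hq0).sub (hx1.mul (((h.add (hc _)).sub (hc _)).sub
      (hc _)))).div (hc _) hq1
  have hD0 : D ![0, 0] ≠ 0 := by
    rw [hD]
    simpa using ⟨⟨hss, hq0⟩, hq1⟩
  refine ⟨_, extends_of_charts (.inr (i, 1)) (.inr (j, 1))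
    (fun x => ![x 1 / D x, x 0 * D x]) hd (regAt_vec ?_ ?_) ?_ ?_ ?_⟩
  · exact hx1.div rD hD0
  · exact hx.mul rD
  · exact mem_blowUpDom_of_eq_zero _ (by simp)
  · intro _ _ e
    cases e
    filter_upwards [generic_coord_ne 0 0, rD.generic_ne hD0] with x h1 h2
    exact mul_ne_zero h1 h2
  · filter_upwards [rD.generic_ne hD0] with x h2
    rw [baseHom_one N.left, baseHom_one N.right]
    refine N.ff _ _ ?_ ?_
    · simp only [Matrix.cons_val_zero, Matrix.cons_val_one]
      field_simp
    · simp only [Matrix.cons_val_zero, Matrix.cons_val_one]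
      rw [mul_add (q - 1), hβ, hD]
      field_simp
      ring

/-- A finite fibre point other than β is off C, and z/(y - y₀) = (y - y₁)/(q((q - 1)v + B)) gives
its direction at γ. -/
theorem IsNode.exists_extends_symm_node_ff (N : IsNode K p p' i j q t y₀ y₁ v₀)
    {Q : (blowUp (hirz 2) p').Pt} {w : A2} (hQ : ∀ i, blowDown _ p' Q ≠ centre _ p' i)
    (hw : blowDown _ p' Q = hirzMk 2 (hirzHom 0 w))
    (h0 : w 0 = y₀) : ∃ P, Extends _ _ (flip (LiftRel K p p')) Q P := by
  have hq0 := N.q0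
  have hD : q * ((q - 1) * w 1 + (w 0 - 1) * (w 0 - t)) ≠ 0 := by
    intro h
    refine hQ j ?_
    have h' := (mul_eq_zero.1 h).resolve_left hq0
    rw [hw, centre_mk N.right]
    congr 2
    rw [← vec_eta w]
    refine vec_congr h0 ?_
    refine mul_left_cancel₀ N.q1 ?_
    rw [N.v_eq, ← h0]
    linear_combination h'
  obtain ⟨hd, rfl⟩ := exists_blowUpPar_inl hw hQ
  have hx := RegAt.coord 0 w
  have hc : ∀ a, RegAt (fun _ => a) w := fun a => RegAt.const a w
  have rD : RegAt (fun x => q * ((q - 1) * x 1 + (x 0 - 1) * (x 0 - t))) w :=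
    (hc q).mul (((hc _).mul (RegAt.coord 1 w)).add ((hx.sub (hc _)).mul (hx.sub (hc _))))
  refine ⟨_, extends_flip (extends_of_charts (.inl 0) (.inr (i, 0)) (fun x =>
    ![x 0 - y₀, (x 0 - y₁) /
      (q * ((q - 1) * x 1 + (x 0 - 1) * (x 0 - t)))]) hd (regAt_vec ?_ ?_) ?_ ?_ ?_)⟩
  · exact hx.sub (hc _)
  · exact (hx.sub (hc _)).div rD hD
  · exact mem_blowUpDom_of_eq_zero _ (sub_eq_zero.2 h0)
  · intro _ _ e
    cases e
    exact (generic_coord_ne 0 (y₀)).mono fun x hx => sub_ne_zero.2 hx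
  · filter_upwards [rD.generic_ne hD] with x hx
    rw [flip, baseHom_inl, baseHom_zero N.left]
    refine N.ff _ _ ?_ ?_
    · simp
    · simp only [Matrix.cons_val_zero, Matrix.cons_val_one, add_sub_cancel, zero_add]
      rw [mul_assoc, div_mul_cancel₀ _ hx]

/-- The same slope written in 1/v; it vanishes at v = ∞. -/
theorem IsNode.exists_extends_symm_node_fi (N : IsNode K p p' i j q t y₀ y₁ v₀)
    {Q : (blowUp (hirz 2) p').Pt} {w : A2} (hQ : ∀ i, blowDown _ p' Q ≠ centre _ p' i)
    (hw : blowDown _ p' Q = hirzMk 2 (hirzHom 1 w))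
    (h0 : w 0 = y₀) (h1 : w 1 = 0) :
    ∃ P, Extends _ _ (flip (LiftRel K p p')) Q P := by
  have hD : q * ((q - 1) + (w 0 - 1) * (w 0 - t) * w 1) ≠ 0 := by
    rw [h1, mul_zero, add_zero]
    exact mul_ne_zero N.q0 N.q1
  obtain ⟨hd, rfl⟩ := exists_blowUpPar_inl hw hQ
  have hx := RegAt.coord 0 w
  have hc : ∀ a, RegAt (fun _ => a) w := fun a => RegAt.const a w
  have rD : RegAt (fun x => q * ((q - 1) + (x 0 - 1) * (x 0 - t) * x 1)) w :=
    (hc q).mul ((hc _).add (((hx.sub (hc _)).mul (hx.sub (hc _))).mul (RegAt.coord 1 w)))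
  refine ⟨_, extends_flip (extends_of_charts (.inl 1) (.inr (i, 0)) (fun x =>
    ![x 0 - y₀, (x 0 - y₁) * x 1 /
      (q * ((q - 1) + (x 0 - 1) * (x 0 - t) * x 1))]) hd (regAt_vec ?_ ?_) ?_ ?_ ?_)⟩
  · exact hx.sub (hc _)
  · exact ((hx.sub (hc _)).mul (RegAt.coord 1 w)).div rD hD
  · exact mem_blowUpDom_of_eq_zero _ (sub_eq_zero.2 h0)
  · intro _ _ e
    cases e
    exact (generic_coord_ne 0 (y₀)).mono fun x hx => sub_ne_zero.2 hx
  · filter_upwards [rD.generic_ne hD] with x hx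
    rw [flip, baseHom_inl, baseHom_zero N.left]
    refine N.fi _ _ ?_ ?_
    · simp
    · simp only [Matrix.cons_val_zero, Matrix.cons_val_one, add_sub_cancel, zero_add]
      rw [mul_assoc, div_mul_cancel₀ _ hx, mul_assoc]

/-- Along slope m at β, q((q - 1)v + B) is y - y₀ times the function `D`, so z = (y - y₁)/D. The
slope at which `D` vanishes is that of C, and it goes to z = ∞. -/
theorem IsNode.exists_extends_symm_excPt (N : IsNode K p p' i j q t y₀ y₁ v₀) (m : ℂ) :
    ∃ P, Extends _ _ (flip (LiftRel K p p')) (excPt p' j m) P := by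
  have hq0 := N.q0
  have hβ := N.v_eq
  have hss := N.ne
  obtain ⟨hd, e⟩ := excPt_eq_par (p := p') j m
  rw [e]
  have hx := RegAt.coord 0 ![0, m]
  have hx1 := RegAt.coord 1 ![0, m]
  have hc : ∀ a, RegAt (fun _ => a) ![0, m] := fun a => RegAt.const a _
  obtain ⟨D, hD⟩ : ∃ D : A2 → ℂ, ∀ x, D x = q * ((q - 1) * x 1 +
    (y₀ + x 0 + y₀ - 1 - t)) := ⟨_, fun _ => rfl⟩
  have rD : RegAt D ![0, m] := by
    refine RegAt.congr ?_ (Filter.Eventually.of_forall hD)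
    exact (hc q).mul (((hc _).mul hx1).add (((((hc _).add hx).add (hc _)).sub (hc _)).sub (hc _)))
  have hDx : ∀ x : A2, q * ((q - 1) * (v₀ + x 0 * x 1) +
      (y₀ + x 0 - 1) * (y₀ + x 0 - t)) = x 0 * D x := fun x => by
    rw [mul_add (q - 1), hβ, hD]
    ring
  by_cases hm : D ![0, m] = 0
  · have rA : RegAt (fun x => y₀ + x 0 - y₁) ![0, m] :=
      ((hc _).add hx).sub (hc _)
    have hA : y₀ + ![(0 : ℂ), m] 0 - y₁ ≠ 0 := by simpa using hss
    refine ⟨_, extends_flip (extends_of_charts (.inr (j, 0)) (.inl 1) (fun x =>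
      ![y₀ + x 0, D x / (y₀ + x 0 - y₁)]) hd
      (regAt_vec ?_ ?_) ?_ ?_ ?_)⟩
    · exact (hc _).add hx
    · exact rD.div rA hA
    · refine mem_inl (N.left_ne _ ?_ ?_)
      · simp [hirzHom]
      · simp [hirzHom]
    · intro _ _ e
      cases e
    · filter_upwards [rA.generic_ne hA] with x hx
      rw [flip, baseHom_inl, baseHom_zero N.right]
      refine N.inf _ _ ?_ ?_
      · simp
      · refine (hDx x).trans ?_
        simp only [Matrix.cons_val_zero, Matrix.cons_val_one, add_sub_cancel_left]
        rw [mul_assoc, mul_div_cancel₀ _ hx]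
  · refine ⟨_, extends_flip (extends_of_charts (.inr (j, 0)) (.inl 0) (fun x =>
      ![y₀ + x 0, (y₀ + x 0 - y₁) / D x]) hd
      (regAt_vec ?_ ?_) ?_ ?_ ?_)⟩
    · exact (hc _).add hx
    · exact (((hc _).add hx).sub (hc _)).div rD hm
    · refine mem_inl (N.left_ne _ ?_ ?_)
      · simp [hirzHom]
      · simp [hirzHom, hm, hss]
    · intro _ _ e
      cases e
    · filter_upwards [rD.generic_ne hm] with x hx
      rw [flip, baseHom_inl, baseHom_zero N.right]
      refine N.ff _ _ ?_ ?_
      · simp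
      · refine (congrArg (_ * ·) (hDx x)).trans ?_
        simp only [Matrix.cons_val_zero, Matrix.cons_val_one, add_sub_cancel_left]
        field_simp

/-- Inverts the passage between the two vertical directions: with y - y₀ = (v - v₀)n the factor v -
v₀ cancels, leaving z = n(y - y₁)/D with `D` a unit at the origin. -/
theorem IsNode.exists_extends_symm_vertical (N : IsNode K p p' i j q t y₀ y₁ v₀) :
    ∃ P, Extends (blowUp (hirz 2) p') _ (flip (LiftRel K p p'))
      (.inr (j, Projectivization.mk ℂ (dir 1 ![0, 0]) (dir_ne_zero _ _))) P := by
  have hq0 := N.q0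
  have hq1 := N.q1
  have hβ := N.v_eq
  have hss := N.ne
  obtain ⟨hd, e⟩ := exceptional_chart (p := p') j 1 ![0, 0] rfl
  rw [← e]
  have hx := RegAt.coord 0 ![0, 0]
  have hx1 := RegAt.coord 1 ![0, 0]
  have hc : ∀ a, RegAt (fun _ => a) ![0, 0] := fun a => RegAt.const a _
  obtain ⟨D, hD⟩ : ∃ D : A2 → ℂ, ∀ x, D x = q * ((q - 1) +
    x 0 * (y₀ + x 1 * x 0 + y₀ - 1 - t)) := ⟨_, fun _ => rfl⟩
  have rD : RegAt D ![0, 0] := by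
    refine RegAt.congr ?_ (Filter.Eventually.of_forall hD)
    exact (hc q).mul ((hc _).add (hx.mul (((((hc _).add (hx1.mul hx)).add (hc _)).sub
      (hc _)).sub (hc _))))
  have hD0 : D ![0, 0] ≠ 0 := by
    rw [hD]
    simpa using ⟨hq0, hq1⟩
  have rA : RegAt (fun x => y₀ + x 1 * x 0 - y₁) ![0, 0] :=
    ((hc _).add (hx1.mul hx)).sub (hc _)
  have hA : y₀ + ![(0 : ℂ), 0] 1 * ![(0 : ℂ), 0] 0 - y₁ ≠ 0 := by
    simpa using hss
  refine ⟨_, extends_flip (extends_of_charts (.inr (j, 1)) (.inr (i, 1))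
    (fun x => ![x 1 * D x / (y₀ + x 1 * x 0 - y₁),
      (y₀ + x 1 * x 0 - y₁) * x 0 / D x]) hd (regAt_vec ?_ ?_) ?_ ?_ ?_)⟩
  · exact (hx1.mul rD).div rA hA
  · exact (rA.mul hx).div rD hD0
  · exact mem_blowUpDom_of_eq_zero _ (by simp)
  · intro _ _ e
    cases e
    filter_upwards [generic_coord_ne 0 0, rD.generic_ne hD0, rA.generic_ne hA] with x h1 h2 h3
    exact div_ne_zero (mul_ne_zero h3 h1) h2
  · filter_upwards [rD.generic_ne hD0, rA.generic_ne hA] with x h2 h3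
    rw [flip, baseHom_one N.left, baseHom_one N.right]
    have h4 : (y₀ + x 1 * x 0 - y₁) * x 0 / D x * (x 1 * D x /
        (y₀ + x 1 * x 0 - y₁)) = x 1 * x 0 := by
      rw [div_mul_div_comm, div_eq_iff (mul_ne_zero h2 h3)]
      ring
    have h5 : q * ((q - 1) * (v₀ + x 1) + (y₀ + x 1 * x 0 - 1) *
        (y₀ + x 1 * x 0 - t)) = x 1 * D x := by
      rw [mul_add (q - 1), hβ, hD]
      ring
    refine N.ff _ _ ?_ ?_
    · simp only [Matrix.cons_val_zero, Matrix.cons_val_one]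
      rw [h4]
    · simp only [Matrix.cons_val_zero, Matrix.cons_val_one]
      rw [h4, zero_add]
      refine (congrArg (_ * ·) h5).trans ?_
      rw [div_mul_eq_mul_div, div_eq_iff h2]
      ring

end

end

section

variable {q t : ℂ} {Θ : Idx → ℂ}

/-! ### Existence of the biregular map -/

theorem Corr.mem_vLine_iff {P : (hirz 0).Pt} {Q : (hirz 2).Pt} (h : Corr q t Θ P Q) (a : ℂ) :
    P ∈ vLine 0 a ↔ Q ∈ vLine 2 a := by
  obtain ⟨x, y, rfl, rfl, h, -⟩ := h
  obtain ⟨s, hs, e⟩ := A2_parallel x.2.1 y.2.1 h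
  rw [hirzMk_mem_vLine, hirzMk_mem_vLine, e]
  simp only [Pi.smul_apply, smul_eq_mul]
  exact ⟨fun h' => by linear_combination s * h',
    fun h' => mul_left_cancel₀ hs (by linear_combination h')⟩

theorem Corr.mem_vLineInf_iff {P : (hirz 0).Pt} {Q : (hirz 2).Pt} (h : Corr q t Θ P Q) :
    P ∈ vLineInf 0 ↔ Q ∈ vLineInf 2 := by
  obtain ⟨x, y, rfl, rfl, h, -⟩ := h
  obtain ⟨s, hs, e⟩ := A2_parallel x.2.1 y.2.1 h
  rw [hirzMk_mem_vLineInf, hirzMk_mem_vLineInf, e]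
  simp [hs]

theorem centre_gamma_mem_vLine (s : Bool) :
    centre (hirz 0) (gammaPt q t Θ) (.t, s) ∈ vLine 0 (tNode t Θ s) := by
  rw [centre_mk (gammaPt_t s), hirzMk_mem_vLine]
  simp [hirzHom]

theorem centre_beta_mem_vLine (s : Bool) :
    centre (hirz 2) (betaPt q t Θ) (.t, s) ∈ vLine 2 (tNode t Θ s) := by
  rw [centre_mk (betaPt_t s), hirzMk_mem_vLine]
  simp [hirzHom]

/-- Off the degenerate fibres the partner is explicit: v = ∞ for z = 0, the point of C for z = ∞,
and the solution of the graph equation otherwise. -/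
theorem exists_localIso_left (H : Admissible q t Θ) {P : (hirz 0).Pt}
    (hP : ∀ s, P ∉ vLine 0 (tNode t Θ s)) :
    ∃ c d w w', P = hirzMk 0 (hirzHom c w) ∧ LocalIso (Corr q t Θ) c d w w' := by
  have hq0 := H.q_ne_zero
  have hq1 := sub_ne_zero.2 H.q_ne_one
  obtain ⟨e, f, x, rfl, -, hf⟩ := hirz_cases P
  have hA : quad (t * Θ .t) (t * (Θ .t)⁻¹) (affineVec e (x 0)) ≠ 0 := fun h => by
    obtain ⟨s, hs⟩ := quad_eq_zero.1 h
    exact hP s ((hirzMk_mem_vLine _ _ _).2 (by rwa [hirzHom_chartNo]))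
  generalize hB : quad 1 t (affineVec e (x 0)) = B
  cases f
  · by_cases hx : x 1 = 0
    · exact ⟨_, _, x, ![x 0, 0], rfl, localIso_fi H e rfl hA hx rfl⟩
    · refine ⟨_, _, x, ![x 0, (quad (t * Θ .t) (t * (Θ .t)⁻¹) (affineVec e (x 0)) /
        (q * x 1) - B) / (q - 1)], rfl, localIso_ff H e rfl hA ?_⟩
      rw [hB]
      simp only [Matrix.cons_val_zero, Matrix.cons_val_one]
      rw [mul_div_cancel₀ _ hq1, sub_add_cancel]
      field_simp
  · refine ⟨_, _, x, ![x 0, -B / (q - 1)], rfl, localIso_if H e rfl hA ?_⟩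
    rw [hB, hf rfl]
    simp only [Matrix.cons_val_zero, Matrix.cons_val_one]
    rw [mul_div_cancel₀ _ hq1, neg_add_cancel, mul_zero, mul_zero]

/-- The partner is z = ∞ on C, z = 0 at v = ∞, and A/(qD) otherwise. -/
theorem exists_localIso_right (H : Admissible q t Θ) {Q : (hirz 2).Pt}
    (hQ : ∀ s, Q ∉ vLine 2 (tNode t Θ s)) :
    ∃ c d w w', Q = hirzMk 2 (hirzHom d w') ∧ LocalIso (Corr q t Θ) c d w w' := by
  have hq0 := H.q_ne_zero
  obtain ⟨e, f, x, rfl, -, hf⟩ := hirz_cases Q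
  have hA : quad (t * Θ .t) (t * (Θ .t)⁻¹) (affineVec e (x 0)) ≠ 0 := fun h => by
    obtain ⟨s, hs⟩ := quad_eq_zero.1 h
    exact hQ s ((hirzMk_mem_vLine _ _ _).2 (by rwa [hirzHom_chartNo]))
  cases f
  · by_cases hx : (q - 1) * x 1 + quad 1 t (affineVec e (x 0)) = 0
    · exact ⟨_, _, ![x 0, 0], x, rfl, localIso_if H e rfl hA (by
        simp only [Matrix.cons_val_zero, Matrix.cons_val_one]
        rw [hx, mul_zero, mul_zero])⟩
    · refine ⟨_, _, ![x 0, quad (t * Θ .t) (t * (Θ .t)⁻¹) (affineVec e (x 0)) /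
        (q * ((q - 1) * x 1 + quad 1 t (affineVec e (x 0))))], x, rfl,
        localIso_ff H e rfl hA ?_⟩
      simp only [Matrix.cons_val_zero, Matrix.cons_val_one]
      rw [div_mul_cancel₀ _ (mul_ne_zero hq0 hx)]
  · exact ⟨_, _, ![x 0, 0], x, rfl, localIso_fi H e rfl hA rfl (hf rfl)⟩

/-- Points that correspond to each other are simultaneously centres, outside of the fibres over
`t Θ_t` and `t / Θ_t`. -/
theorem Corr.ne_beta (H : Admissible q t Θ) {P : (hirz 0).Pt} {Q : (hirz 2).Pt}
    (h : Corr q t Θ P Q) (hPt : ∀ s, P ∉ vLine 0 (tNode t Θ s))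
    (hP : ∀ i, P ≠ centre (hirz 0) (gammaPt q t Θ) i) (j : Idx × Bool) :
    Q ≠ centre (hirz 2) (betaPt q t Θ) j := by
  rintro rfl
  have hQ : ∀ s, centre (hirz 2) (betaPt q t Θ) j ≠ centre (hirz 2) (betaPt q t Θ) (.t, s) :=
    fun s e => hPt s ((h.mem_vLine_iff _).2 (e ▸ centre_beta_mem_vLine s))
  have hj : ∀ s, corrIdx j ≠ (.t, s) := fun s e => hQ s (by
    rw [← corrIdx_corrIdx j, e]; rfl)
  have h' := corr_centre H _ hj
  rw [corrIdx_corrIdx] at h'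
  exact hP _ (h.unique_left H.q_ne_zero H.q_ne_one hQ h')

theorem Corr.ne_gamma (H : Admissible q t Θ) {P : (hirz 0).Pt} {Q : (hirz 2).Pt}
    (h : Corr q t Θ P Q) (hQt : ∀ s, Q ∉ vLine 2 (tNode t Θ s))
    (hQ : ∀ i, Q ≠ centre (hirz 2) (betaPt q t Θ) i) (j : Idx × Bool) :
    P ≠ centre (hirz 0) (gammaPt q t Θ) j := by
  rintro rfl
  have hP : ∀ s, centre (hirz 0) (gammaPt q t Θ) j ≠ centre (hirz 0) (gammaPt q t Θ) (.t, s) :=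
    fun s e => hQt s ((h.mem_vLine_iff _).1 (e ▸ centre_gamma_mem_vLine s))
  exact hQ _ (h.unique_right H.q_ne_zero H.q_ne_one hP
    (corr_centre H _ fun s e => hP s (by rw [e])))

/-- On a degenerate fibre the graph equation reduces to z D = 0, which forces P = γ_t or Q = β_t.
Removing the exceptional lines therefore removes these fibres from the relation, which is what makes
it single valued both ways. -/
theorem graphRel_notMem (H : Admissible q t Θ) {P : (sakaiSurface q t Θ).Pt}
    {Q : (modSurface q t Θ).Pt} (h : graphRel q t Θ P Q) (s : Bool) :
    blowDown _ _ P ∉ vLine 0 (tNode t Θ s) := by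
  obtain ⟨h, hP, hQ⟩ := h
  intro hs
  have hs' := (h.mem_vLine_iff _).1 hs
  obtain ⟨x, y, hx, hy, -, h⟩ := h
  rw [← hx] at hs hP
  rw [← hy] at hs' hQ
  rw [hirzMk_mem_vLine] at hs hs'
  have hA := quad_eq_zero.2 ⟨s, hs⟩
  have hA' := quad_eq_zero.2 ⟨s, hs'⟩
  rw [hA', zero_mul, zero_mul, mul_eq_zero, mul_eq_zero, or_iff_right H.q_ne_zero] at h
  rcases h with h | h
  · obtain ⟨s', e⟩ := eq_gamma_t (q := q) h hA
    exact hP _ e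
  · obtain ⟨s', e⟩ := eq_beta_t H.q_ne_one h hA'
    exact hQ _ e

/-- Off the degenerate fibres the partner of a point is unique, so it is the one provided by the
local isomorphism. -/
theorem graphRel_extends (H : Admissible q t Θ) {P : (sakaiSurface q t Θ).Pt}
    {Q : (modSurface q t Θ).Pt} (h : graphRel q t Θ P Q) :
    Extends _ _ (graphRel q t Θ) P Q ∧ Extends _ _ (flip (graphRel q t Θ)) Q P := by
  obtain ⟨c, d, w, w', hw, hl⟩ := exists_localIso_left H (graphRel_notMem H h)
  have hw' : blowDown _ _ Q = hirzMk 2 (hirzHom d w') :=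
    h.1.unique_right H.q_ne_zero H.q_ne_one (fun s => h.2.1 _) (hw ▸ hl.corr)
  exact ⟨hl.extends h.2.1 h.2.2 hw hw', extends_flip (hl.symm.extends h.2.2 h.2.1 hw' hw)⟩

theorem graphRel_unique_right (H : Admissible q t Θ) (P : (sakaiSurface q t Θ).Pt)
    (Q Q' : (modSurface q t Θ).Pt) (h : graphRel q t Θ P Q) (h' : graphRel q t Θ P Q') : Q = Q' :=
  blowDown_inj h.2.2 (h.1.unique_right H.q_ne_zero H.q_ne_one (fun _ => h.2.1 _) h'.1)

theorem graphRel_unique_left (H : Admissible q t Θ) (P P' : (sakaiSurface q t Θ).Pt)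
    (Q : (modSurface q t Θ).Pt) (h : graphRel q t Θ P Q) (h' : graphRel q t Θ P' Q) : P = P' :=
  blowDown_inj h.2.1 (h.1.unique_left H.q_ne_zero H.q_ne_one (fun _ => h.2.2 _) h'.1)

theorem exists_extends_of_ne (H : Admissible q t Θ) {P : (sakaiSurface q t Θ).Pt}
    (hP : ∀ i, blowDown _ _ P ≠ centre _ (gammaPt q t Θ) i) :
    ∃ Q, Extends _ _ (graphRel q t Θ) P Q := by
  by_cases hs : ∀ s, blowDown _ _ P ∉ vLine 0 (tNode t Θ s)
  · obtain ⟨c, d, w, w', hw, hl⟩ := exists_localIso_left H hs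
    have hc := hl.corr
    rw [← hw] at hc
    obtain ⟨Q, hQ⟩ := exists_blowDown_eq (hc.ne_beta H hs hP)
    rw [← hQ] at hc
    exact ⟨Q, (graphRel_extends H ⟨hc, hP, fun j => hQ ▸ (hQ ▸ hc).ne_beta H hs hP j⟩).1⟩
  · push Not at hs
    obtain ⟨s, hs⟩ := hs
    obtain ⟨e, f, x, hx, he, hf⟩ := hirz_cases (blowDown _ _ P)
    rw [hx, hirzMk_mem_vLine, hirzHom_chartNo] at hs
    cases e
    · replace hs : x 0 = tNode t Θ s := by simpa [affineVec] using hs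
      cases f
      · refine (isNode H s).exists_extends_node_ff hP hx hs fun h1 => hP (.t, s) ?_
        rw [hx, centre_mk (gammaPt_t s), ← hs, ← h1, vec_eta]
        rfl
      · exact (isNode H s).exists_extends_node_if hP hx hs
    · simp [affineVec, he] at hs

theorem exists_extends_symm_of_ne (H : Admissible q t Θ) {Q : (modSurface q t Θ).Pt}
    (hQ : ∀ i, blowDown _ _ Q ≠ centre _ (betaPt q t Θ) i) :
    ∃ P, Extends _ _ (flip (graphRel q t Θ)) Q P := by
  by_cases hs : ∀ s, blowDown _ _ Q ∉ vLine 2 (tNode t Θ s)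
  · obtain ⟨c, d, w, w', hw, hl⟩ := exists_localIso_right H hs
    have hc := hl.corr
    rw [← hw] at hc
    obtain ⟨P, hP⟩ := exists_blowDown_eq (hc.ne_gamma H hs hQ)
    rw [← hP] at hc
    exact ⟨P, (graphRel_extends H ⟨hc, fun j => hP ▸ (hP ▸ hc).ne_gamma H hs hQ j, hQ⟩).2⟩
  · push Not at hs
    obtain ⟨s, hs⟩ := hs
    obtain ⟨e, f, x, hx, he, hf⟩ := hirz_cases (blowDown _ _ Q)
    rw [hx, hirzMk_mem_vLine, hirzHom_chartNo] at hs
    cases e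
    · replace hs : x 0 = tNode t Θ s := by simpa [affineVec] using hs
      cases f
      · exact (isNode H s).exists_extends_symm_node_ff hQ hx hs
      · exact (isNode H s).exists_extends_symm_node_fi hQ hx hs (hf rfl)
    · simp [affineVec, he] at hs

theorem localIso_zero (H : Admissible q t Θ) (s : Bool) :
    LocalIso (Corr q t Θ) 0 0 ![0, gammaZero q t Θ s] ![0, betaZero q t Θ s] := by
  have ht := H.ne_zero .t
  have ht0 := H.t_ne_zero
  refine localIso_ff H false rfl ?_ ?_
  · simp [quad, affineVec, ht, ht0]
  · simp only [quad, affineVec, Matrix.cons_val_zero, Matrix.cons_val_one]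
    linear_combination gammaZero_mul_betaZero H s - t ^ 2 * mul_inv_cancel₀ ht

theorem localIso_one (H : Admissible q t Θ) (s : Bool) :
    LocalIso (Corr q t Θ) 1 0 ![oneNode Θ s, 0]
      ![oneNode Θ s, -((oneNode Θ s - 1) * (oneNode Θ s - t)) / (q - 1)] := by
  have hq1 := sub_ne_zero.2 H.q_ne_one
  refine localIso_if H false rfl ?_ ?_
  · rw [Ne, quad_eq_zero]
    rintro ⟨s', h⟩
    exact oneNode_ne_tNode H s s' (by simpa [affineVec] using h)
  · simp only [quad, affineVec, Matrix.cons_val_zero, Matrix.cons_val_one]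
    rw [mul_div_cancel₀ _ hq1]
    ring

theorem localIso_inf (H : Admissible q t Θ) (s : Bool) :
    LocalIso (Corr q t Θ) 2 2 ![0, gammaInf q Θ s] ![0, betaInf q Θ (!s)] := by
  refine localIso_ff H true rfl ?_ ?_
  · simp [quad, affineVec]
  · simp only [quad, affineVec, Matrix.cons_val_zero, Matrix.cons_val_one]
    linear_combination gammaInf_mul_betaInf H s

theorem exists_extends (H : Admissible q t Θ) (P : (sakaiSurface q t Θ).Pt) :
    ∃ Q, Extends _ _ (graphRel q t Θ) P Q := by
  by_cases hP : ∀ i, blowDown _ _ P ≠ centre _ (gammaPt q t Θ) i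
  · exact exists_extends_of_ne H hP
  push Not at hP
  obtain ⟨i, hi⟩ := hP
  rw [← mem_exceptional_iff _ _ (gamma_injective H)] at hi
  rcases i with ⟨_ | _ | _ | _, s⟩
  · exact (localIso_zero H s).exists_extends (gammaPt_zero s) (betaPt_zero s) hi
  · exact (localIso_one H s).exists_extends (gammaPt_one s) (betaPt_one s) hi
  · rcases exceptional_cases _ P hi with ⟨m, rfl⟩ | rfl
    · exact (isNode H s).exists_extends_excPt m
    · exact (isNode H s).exists_extends_vertical
  · exact (localIso_inf H s).exists_extends (gammaPt_inf s) (betaPt_inf _) hi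

theorem exists_extends_symm (H : Admissible q t Θ) (Q : (modSurface q t Θ).Pt) :
    ∃ P, Extends _ _ (flip (graphRel q t Θ)) Q P := by
  by_cases hQ : ∀ i, blowDown _ _ Q ≠ centre _ (betaPt q t Θ) i
  · exact exists_extends_symm_of_ne H hQ
  push Not at hQ
  obtain ⟨i, hi⟩ := hQ
  rw [← mem_exceptional_iff _ _ (beta_injective H)] at hi
  rcases i with ⟨_ | _ | _ | _, s⟩
  · exact ((localIso_zero H s).symm.exists_extends (betaPt_zero s) (gammaPt_zero s) hi).imp
      fun _ => extends_flip
  · exact ((localIso_one H s).symm.exists_extends (betaPt_one s) (gammaPt_one s) hi).imp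
      fun _ => extends_flip
  · rcases exceptional_cases _ Q hi with ⟨m, rfl⟩ | rfl
    · exact (isNode H s).exists_extends_symm_excPt m
    · exact (isNode H s).exists_extends_symm_vertical
  · have h := (localIso_inf H (!s)).symm
    rw [Bool.not_not] at h
    exact (h.exists_extends (betaPt_inf s) (gammaPt_inf _) hi).imp fun _ => extends_flip

/-- The correspondence is given by polynomial equations in homogeneous coordinates. Holding at
generic points of a germ, they hold at every point, including those on exceptional lines. -/
theorem corr_of_extends {P : (sakaiSurface q t Θ).Pt} {Q : (modSurface q t Θ).Pt}
    (h : Extends _ _ (graphRel q t Θ) P Q) : Corr q t Θ (blowDown _ _ P) (blowDown _ _ Q) := by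
  obtain ⟨c, d, w, r, hr, h1, rfl, rfl, h2⟩ := h
  have hl := regAt_hirzHom (baseChart (gammaPt q t Θ) c)
    (regAt_baseMap (p := gammaPt q t Θ) c w.1)
  have hd := regAt_hirzHom (baseChart (betaPt q t Θ) d)
    (r := fun x => baseMap (betaPt q t Θ) d (r x)) (w := w.1) fun k => RegAt.comp h1 (regAt_baseMap d _ k)
  have hc : ∀ a, RegAt (fun _ => a) w.1 := fun a => RegAt.const a _
  have hquad : ∀ a b, RegAt (fun x => quad a b (hirzHom (baseChart (betaPt q t Θ) d)
      (baseMap (betaPt q t Θ) d (r x))).1.1) w.1 := fun a b =>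
    ((hd 0).1.sub ((hc a).mul (hd 1).1)).mul ((hd 0).1.sub ((hc b).mul (hd 1).1))
  have h3 : ∀ᶠ x in genericFilter, CorrEq q t Θ (baseHom (gammaPt q t Θ) c x)
      (baseHom (betaPt q t Θ) d (r x)) := h2.mono fun x hx => by
    obtain ⟨hx, hx', h, -⟩ := hx
    exact (corr_iff ..).1 ((blowDown_par_hirz c ⟨x, hx⟩).symm ▸
      (blowDown_par_hirz d ⟨r x, hx'⟩).symm ▸ h)
  have e1 := blowDown_par_hirz (p := gammaPt q t Θ) c w
  have e2 := blowDown_par_hirz (p := betaPt q t Θ) d ⟨_, hr⟩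
  suffices Corr q t Θ (hirzMk 0 (baseHom (gammaPt q t Θ) c w))
      (hirzMk 2 (baseHom (betaPt q t Θ) d (r w))) by
    rw [← e1, ← e2] at this
    exact this
  refine (corr_iff ..).2 ⟨?_, ?_⟩
  · exact ((hl 0).1.mul (hd 1).1).eq_of_generic ((hl 1).1.mul (hd 0).1) (h3.mono fun x hx => hx.1)
  · exact ((hl 0).2.mul ((hc q).mul (((hc (q - 1)).mul (hd 0).2).add
      ((hquad 1 t).mul (hd 1).2)))).eq_of_generic
      (((hquad _ _).mul (hl 1).2).mul (hd 1).2) (h3.mono fun x hx => hx.2)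

theorem exists_biregular_corr (H : Admissible q t Θ) :
    ∃ Φ : Biregular (sakaiSurface q t Θ) (modSurface q t Θ),
      ∀ P, Corr q t Θ (blowDown _ _ P) (blowDown _ _ (Φ.toEquiv P)) := by
  obtain ⟨Φ, h⟩ := exists_biregular
    (blowUp_isSeparated (hirz_isSeparated 0) (gamma_injective H))
    (blowUp_isSeparated (hirz_isSeparated 2) (beta_injective H))
    (graphRel_unique_right H) (graphRel_unique_left H) (exists_extends H) (exists_extends_symm H)
    fun _ _ => graphRel_extends H
  exact ⟨Φ, fun P => corr_of_extends (h P)⟩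

end

section

variable {q t : ℂ} {Θ : Idx → ℂ}

/-! ### Images of curves -/

theorem Equiv.image_eq_of_mem_iff {α β : Type*} (e : α ≃ β) {S : Set α} {T : Set β}
    (h : ∀ a, a ∈ S ↔ e a ∈ T) : e '' S = T := by
  ext b
  rw [e.image_eq_preimage_symm, Set.mem_preimage, h, e.apply_symm_apply]

/-- The points outside of the centres and of the fibres over `tNode` that lie on a curve. -/
def awayLocus {n : ℕ} (t : ℂ) (Θ : Idx → ℂ) {I : Type} [Finite I]
    (p : I → (c : (hirz n).Chart) × (hirz n).dom c) (Z : Set (hirz n).Pt) :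
    Set (blowUp (hirz n) p).Pt :=
  {P | blowDown _ p P ∈ Z \ Set.range (centre _ p) ∧ ∀ s, blowDown _ p P ∉ vLine n (tNode t Θ s)}

/-- The section at infinity crosses the two degenerate fibres. A crossing point that is not a centre
is a limit along the section itself. -/
theorem mem_closure_awayLocus {n : ℕ} {I : Type} [Finite I]
    {p : I → (c : (hirz n).Chart) × (hirz n).dom c} {P : (blowUp (hirz n) p).Pt}
    (hP : blowDown _ p P ∈ hLineInf n \ Set.range (centre _ p)) :
    P ∈ closure (awayLocus t Θ p (hLineInf n)) := by
  by_cases hs : ∀ s, blowDown _ p P ∉ vLine n (tNode t Θ s)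
  · exact subset_closure ⟨hP, hs⟩
  push Not at hs
  obtain ⟨s, hs⟩ := hs
  obtain ⟨hZ, hc⟩ := hP
  obtain ⟨e, f, x, hx, he, hf⟩ := hirz_cases (blowDown _ _ P)
  rw [hx, hirzMk_mem_vLine, hirzHom_chartNo] at hs
  rw [hx, hirzMk_mem_hLineInf, hirzHom_chartNo] at hZ
  cases e
  · cases f
    · simp [affineVec] at hZ
    · obtain ⟨hd, rfl⟩ := exists_blowUpPar_inl hx fun i h => hc ⟨i, h.symm⟩
      have hl : ∀ m : ℂ, (![0, 0] : A2) + m • ![1, 0] = ![m, 0] := fun m => by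
        funext k
        fin_cases k <;> simp
      have hxl : x = (![0, 0] : A2) + x 0 • ![1, 0] := by
        rw [hl]
        funext k
        fin_cases k
        · rfl
        · exact hf rfl
      have h0 : (![0, 0] : A2) + x 0 • ![1, 0] ∈ blowUpDom (hirz n) p (.inl (1 : Fin 4)) := hxl ▸ hd
      have key := mem_closure_of_line (X := blowUp (hirz n) p)
        (S := awayLocus t Θ p (hLineInf n)) (.inl (1 : Fin 4)) ![0, 0] ![1, 0] (x 0) h0 ?_
      · have hsub : (⟨x, hd⟩ : blowUpDom (hirz n) p (.inl (1 : Fin 4))) = ⟨_, h0⟩ :=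
          Subtype.ext hxl
        exact (congrArg (blowUpPar (hirz n) p (.inl (1 : Fin 4))) hsub) ▸ key
      -- Centres are already outside the chart, so only the two crossing parameters have to be
      -- discarded.
      · refine (Set.finite_range (tNode t Θ)).subset ?_
        rintro m ⟨h, hm⟩
        by_contra hmt
        refine hm ⟨⟨?_, ?_⟩, fun s' hs' => hmt ⟨s', ?_⟩⟩
        · refine (hirzMk_mem_hLineInf n (hirzHom 1 _)).2 ?_
          simp [hirzHom]
        · rintro ⟨i, hi⟩
          exact h.2 i hi.symm
        · have := (hirzMk_mem_vLine n _ (hirzHom 1 _)).1 hs'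
          simpa [hirzHom] using this.symm
  · simp [affineVec, he] at hs

/-! ### Images under a biregular map that respects the correspondence. -/

section Image

variable {Φ : Biregular (sakaiSurface q t Θ) (modSurface q t Θ)}

/-- Off the degenerate fibres the map matches the curves and the centres. Both strict transforms are
closures of these parts, and a homeomorphism commutes with closure. -/
theorem image_strictTransform (H : Admissible q t Θ)
    (hΦ : ∀ P, Corr q t Θ (blowDown _ _ P) (blowDown _ _ (Φ.toEquiv P)))
    {Z : Set (hirz 0).Pt} {Z' : Set (hirz 2).Pt}
    (h : ∀ P Q, Corr q t Θ P Q → (∀ s, P ∉ vLine 0 (tNode t Θ s)) → (P ∈ Z ↔ Q ∈ Z'))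
    (hZ : ∀ P : (sakaiSurface q t Θ).Pt, blowDown _ _ P ∈ Z \ Set.range (centre _ (gammaPt q t Θ)) →
      P ∈ closure (awayLocus t Θ (gammaPt q t Θ) Z))
    (hZ' : ∀ Q : (modSurface q t Θ).Pt, blowDown _ _ Q ∈ Z' \ Set.range (centre _ (betaPt q t Θ)) →
      Q ∈ closure (awayLocus t Θ (betaPt q t Θ) Z')) :
    Φ.toEquiv '' strictTransform (hirz 0) (gammaPt q t Θ) Z =
      strictTransform (hirz 2) (betaPt q t Θ) Z' := by
  have e1 : strictTransform (hirz 0) (gammaPt q t Θ) Z =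
      closure (awayLocus t Θ (gammaPt q t Θ) Z) :=
    (closure_minimal hZ isClosed_closure).antisymm (closure_mono fun P hP => hP.1)
  have e2 : strictTransform (hirz 2) (betaPt q t Θ) Z' =
      closure (awayLocus t Θ (betaPt q t Θ) Z') :=
    (closure_minimal hZ' isClosed_closure).antisymm (closure_mono fun P hP => hP.1)
  have e3 : Φ.toEquiv '' awayLocus t Θ (gammaPt q t Θ) Z = awayLocus t Θ (betaPt q t Θ) Z' := by
    refine Equiv.image_eq_of_mem_iff _ fun P => ?_
    have hs : (∀ s, blowDown _ _ P ∉ vLine 0 (tNode t Θ s)) ↔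
        ∀ s, blowDown _ _ (Φ.toEquiv P) ∉ vLine 2 (tNode t Θ s) :=
      forall_congr' fun s => not_congr ((hΦ P).mem_vLine_iff _)
    constructor
    · rintro ⟨⟨hPZ, hc⟩, hP⟩
      refine ⟨⟨(h _ _ (hΦ P) hP).1 hPZ, ?_⟩, hs.1 hP⟩
      rintro ⟨j, hj⟩
      exact (hΦ P).ne_beta H hP (fun i hi => hc ⟨i, hi.symm⟩) j hj.symm
    · rintro ⟨⟨hQZ, hc⟩, hQ⟩
      refine ⟨⟨(h _ _ (hΦ P) (hs.2 hQ)).2 hQZ, ?_⟩, hs.2 hQ⟩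
      rintro ⟨j, hj⟩
      exact (hΦ P).ne_gamma H hQ (fun i hi => hc ⟨i, hi.symm⟩) j hj.symm
  rw [e1, e2, ← e3]
  exact Φ.toHomeomorph.image_closure _

theorem Corr.hLineZero_iff (H : Admissible q t Θ) {P : (hirz 0).Pt} {Q : (hirz 2).Pt}
    (h : Corr q t Θ P Q) (hs : ∀ s, P ∉ vLine 0 (tNode t Θ s)) :
    P ∈ hLineZero 0 ↔ Q ∈ hLineInf 2 := by
  have hq1 := sub_ne_zero.2 H.q_ne_one
  have hq0 := H.q_ne_zero
  have hs' := fun s => mt (h.mem_vLine_iff (tNode t Θ s)).2 (hs s)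
  obtain ⟨x, y, rfl, rfl, -, h⟩ := h
  have hA : quad (t * Θ .t) (t * (Θ .t)⁻¹) y.1.1 ≠ 0 := fun h => by
    obtain ⟨s, e⟩ := quad_eq_zero.1 h
    exact hs' s ((hirzMk_mem_vLine _ _ _).2 e)
  rw [hirzMk_mem_hLineZero, hirzMk_mem_hLineInf]
  constructor
  · intro h0
    rw [h0, zero_mul, eq_comm] at h
    have h1 := (A2_ne_zero _ x.2.2).resolve_left (not_not.2 h0)
    simpa [hA, h1] using h
  · intro h0
    rw [h0, mul_zero, mul_zero, add_zero] at h
    have h1 := (A2_ne_zero _ y.2.2).resolve_right (not_not.2 h0)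
    simpa [hq0, hq1, h1] using h

theorem Corr.hLineInf_iff (H : Admissible q t Θ) {P : (hirz 0).Pt} {Q : (hirz 2).Pt}
    (h : Corr q t Θ P Q) (hs : ∀ s, P ∉ vLine 0 (tNode t Θ s)) :
    P ∈ hLineInf 0 ↔ Q ∈ curveC q t := by
  have hq1 := sub_ne_zero.2 H.q_ne_one
  have hq0 := H.q_ne_zero
  have hs' := fun s => mt (h.mem_vLine_iff (tNode t Θ s)).2 (hs s)
  obtain ⟨x, y, rfl, rfl, -, h⟩ := h
  have hA : quad (t * Θ .t) (t * (Θ .t)⁻¹) y.1.1 ≠ 0 := fun h => by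
    obtain ⟨s, e⟩ := quad_eq_zero.1 h
    exact hs' s ((hirzMk_mem_vLine _ _ _).2 e)
  rw [hirzMk_mem_hLineInf, hirzMk_mem_curveC H.q_ne_one]
  constructor
  · intro h0
    rw [h0, mul_zero, zero_mul] at h
    have h1 := (A2_ne_zero _ x.2.2).resolve_right (not_not.2 h0)
    exact ((mul_eq_zero.1 ((mul_eq_zero.1 h).resolve_left h1)).resolve_left hq0)
  · intro h0
    have h1 : y.1.2 1 ≠ 0 := fun h1 => by
      rw [h1, mul_zero, add_zero, mul_eq_zero, or_iff_right hq1] at h0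
      exact (A2_ne_zero _ y.2.2).elim (fun h => h h0) fun h => h h1
    rw [h0, mul_zero, mul_zero, eq_comm] at h
    simpa [hA, h1] using h

/-- The components match as z = 0 with v = ∞, z = ∞ with C, y = 0 with u = 0, and y = ∞ with u = ∞.
Only z = ∞ and v = ∞ need the closure argument of `mem_closure_awayLocus`. -/
theorem image_setJ (H : Admissible q t Θ)
    (hΦ : ∀ P, Corr q t Θ (blowDown _ _ P) (blowDown _ _ (Φ.toEquiv P))) :
    Φ.toEquiv '' setJ q t Θ = setI q t Θ := by
  have h0 := tNode_ne_zero H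
  have h1 : ∀ (n : ℕ) (P : (hirz n).Pt), P ∈ vLine n 0 → ∀ s, P ∉ vLine n (tNode t Θ s) := by
    intro n P hP s hs
    obtain ⟨x, rfl⟩ := exists_hirzMk P
    rw [hirzMk_mem_vLine] at hP hs
    rw [zero_mul] at hP
    rw [hP, eq_comm, mul_eq_zero, or_iff_right (h0 s)] at hs
    exact (A2_ne_zero _ x.2.1).elim (fun h => h hP) fun h => h hs
  have h2 : ∀ (n : ℕ) (P : (hirz n).Pt), P ∈ vLineInf n → ∀ s, P ∉ vLine n (tNode t Θ s) := by
    intro n P hP s hs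
    obtain ⟨x, rfl⟩ := exists_hirzMk P
    rw [hirzMk_mem_vLineInf] at hP
    rw [hirzMk_mem_vLine, hP, mul_zero] at hs
    exact (A2_ne_zero _ x.2.1).elim (fun h => h hs) fun h => h hP
  rw [setJ, Set.image_union, Set.image_union, Set.image_union,
    image_strictTransform H hΦ (fun P Q h hs => h.hLineZero_iff H hs) ?_
      fun Q => mem_closure_awayLocus,
    image_strictTransform H hΦ (fun P Q h hs => h.hLineInf_iff H hs)
      (fun Q => mem_closure_awayLocus) ?_,
    image_strictTransform H hΦ (fun P Q h hs => h.mem_vLine_iff 0)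
      (fun P hP => subset_closure ⟨hP, h1 _ _ hP.1⟩) fun P hP => subset_closure ⟨hP, h1 _ _ hP.1⟩,
    image_strictTransform H hΦ (fun P Q h hs => h.mem_vLineInf_iff)
      (fun P hP => subset_closure ⟨hP, h2 _ _ hP.1⟩) fun P hP => subset_closure ⟨hP, h2 _ _ hP.1⟩,
    setI]
  · ext Q
    simp only [Set.mem_union]
    tauto
  -- C meets the degenerate fibres only at β_t^±, which are centres. The next case is alike, with z
  -- = 0 and γ_t^±.
  · intro Q hQ
    refine subset_closure ⟨hQ, fun s hs => ?_⟩
    obtain ⟨x, hx⟩ := exists_hirzMk (blowDown _ _ Q)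
    rw [hx] at hs hQ
    obtain ⟨s', e⟩ := eq_beta_t H.q_ne_one ((hirzMk_mem_curveC H.q_ne_one _ _).1 hQ.1)
      (quad_eq_zero.2 ⟨s, (hirzMk_mem_vLine _ _ _).1 hs⟩)
    exact hQ.2 ⟨_, e.symm⟩
  · intro P hP
    refine subset_closure ⟨hP, fun s hs => ?_⟩
    obtain ⟨x, hx⟩ := exists_hirzMk (blowDown _ _ P)
    rw [hx] at hs hP
    obtain ⟨s', e⟩ := eq_gamma_t (q := q) ((hirzMk_mem_hLineZero _ _).1 hP.1)
      (quad_eq_zero.2 ⟨s, (hirzMk_mem_vLine _ _ _).1 hs⟩)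
    exact hP.2 ⟨_, e.symm⟩

/-- A point lies on the exceptional line exactly when it blows down to the centre, and corresponding
centres determine each other off γ_t^± and β_t^±. -/
theorem image_exceptional (H : Admissible q t Θ)
    (hΦ : ∀ P, Corr q t Θ (blowDown _ _ P) (blowDown _ _ (Φ.toEquiv P))) (i : Idx × Bool)
    (hi : ∀ s, i ≠ (.t, s)) :
    Φ.toEquiv '' exceptional (hirz 0) (gammaPt q t Θ) i =
      exceptional (hirz 2) (betaPt q t Θ) (corrIdx i) := by
  refine Equiv.image_eq_of_mem_iff _ fun P => ?_
  rw [mem_exceptional_iff _ _ (gamma_injective H), mem_exceptional_iff _ _ (beta_injective H)]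
  have hP := hΦ P
  have hc := corr_centre H i hi
  constructor
  · intro h
    rw [h] at hP
    exact hP.unique_right H.q_ne_zero H.q_ne_one (fun s e => hi s (gamma_injective H e)) hc
  · intro h
    rw [h] at hP
    refine hP.unique_left H.q_ne_zero H.q_ne_one (fun s e => hi s ?_) hc
    rw [← corrIdx_corrIdx i, beta_injective H e]
    rfl

theorem eq_gamma_of_mem_vLine {s : Bool} {x : HirzCoord}
    (h : x.1.2 0 = 0) (hx : hirzMk 0 x ∈ vLine 0 (tNode t Θ s)) :
    hirzMk 0 x = centre (hirz 0) (gammaPt q t Θ) (.t, s) := by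
  rw [hirzMk_mem_vLine] at hx
  rw [centre_mk (gammaPt_t s), hirzMk_eq_iff]
  simp [hirzHom, h, hx, mul_comm]

theorem eq_beta_of_mem_vLine (H : Admissible q t Θ) {s : Bool} {x : HirzCoord}
    (h : (q - 1) * x.1.2 0 + quad 1 t x.1.1 * x.1.2 1 = 0)
    (hx : hirzMk 2 x ∈ vLine 2 (tNode t Θ s)) :
    hirzMk 2 x = centre (hirz 2) (betaPt q t Θ) (.t, s) := by
  obtain ⟨s', e⟩ := eq_beta_t H.q_ne_one h (quad_eq_zero.2 ⟨s, (hirzMk_mem_vLine _ _ _).1 hx⟩)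
  rw [e, centre_mk (betaPt_t s'), hirzMk_mem_vLine] at hx
  rw [e, tNode_injective H (show tNode t Θ s' = tNode t Θ s by simpa [hirzHom] using hx)]

/-- The graph equation on the fibre is z D = 0: the correspondence there is the union of {γ} × fibre
and fibre × {β}. -/
theorem Corr.eq_centre_or (H : Admissible q t Θ) {P : (hirz 0).Pt} {Q : (hirz 2).Pt}
    (h : Corr q t Θ P Q) {s : Bool} (hs : P ∈ vLine 0 (tNode t Θ s)) :
    P = centre (hirz 0) (gammaPt q t Θ) (.t, s) ∨ Q = centre (hirz 2) (betaPt q t Θ) (.t, s) := by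
  have hs' := (h.mem_vLine_iff _).1 hs
  obtain ⟨x, y, rfl, rfl, -, h⟩ := h
  rw [quad_eq_zero.2 ⟨s, (hirzMk_mem_vLine _ _ _).1 hs'⟩, zero_mul, zero_mul, mul_eq_zero,
    mul_eq_zero, or_iff_right H.q_ne_zero] at h
  exact h.imp (fun h => eq_gamma_of_mem_vLine h hs) fun h => eq_beta_of_mem_vLine H h hs'

theorem notMem_centre_gamma (H : Admissible q t Θ) {s : Bool} {P : (hirz 0).Pt}
    (hs : P ∈ vLine 0 (tNode t Θ s)) (hP : P ≠ centre (hirz 0) (gammaPt q t Θ) (.t, s)) :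
    P ∉ Set.range (centre (hirz 0) (gammaPt q t Θ)) := by
  rintro ⟨i, hi⟩
  obtain ⟨x, rfl⟩ := exists_hirzMk P
  exact gamma_ne_of_vLine H ((hirzMk_mem_vLine _ _ _).1 hs)
    (fun h => hP (eq_gamma_of_mem_vLine h hs)) i hi.symm

theorem notMem_centre_beta (H : Admissible q t Θ) {s : Bool} {Q : (hirz 2).Pt}
    (hs : Q ∈ vLine 2 (tNode t Θ s)) (hQ : Q ≠ centre (hirz 2) (betaPt q t Θ) (.t, s)) :
    Q ∉ Set.range (centre (hirz 2) (betaPt q t Θ)) := by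
  rintro ⟨i, hi⟩
  obtain ⟨x, rfl⟩ := exists_hirzMk Q
  exact beta_ne_of_vLine H ((hirzMk_mem_vLine _ _ _).1 hs)
    (fun h => hQ (eq_beta_of_mem_vLine H h hs)) i hi.symm

theorem IsIrreducible.subset_or_subset {α : Type*} [TopologicalSpace α] {S A B : Set α}
    (hS : IsIrreducible S) (hA : IsClosed A) (hB : IsClosed B) (h : S ⊆ A ∪ B) :
    S ⊆ A ∨ S ⊆ B :=
  isPreirreducible_iff_isClosed_union_isClosed.1 hS.isPreirreducible A B hA hB h

/-- Fibre points other than γ go to the exceptional line over β, which is closed. Conversely, that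
irreducible line is covered by the images of the exceptional line over γ and of the strict
transform, so one of them contains it. -/
theorem image_strictTransform_vLine (H : Admissible q t Θ)
    (hΦ : ∀ P, Corr q t Θ (blowDown _ _ P) (blowDown _ _ (Φ.toEquiv P))) (s : Bool) :
    Φ.toEquiv '' strictTransform (hirz 0) (gammaPt q t Θ) (vLine 0 (tNode t Θ s)) =
      exceptional (hirz 2) (betaPt q t Θ) (.t, s) := by
  have hγ := gamma_injective H
  have hβ := beta_injective H
  have h1 : ∀ P : (sakaiSurface q t Θ).Pt, blowDown _ _ P ∈ vLine 0 (tNode t Θ s) →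
      blowDown _ _ P ≠ centre _ (gammaPt q t Θ) (.t, s) →
      Φ.toEquiv P ∈ exceptional (hirz 2) (betaPt q t Θ) (.t, s) := fun P hs hP =>
    (mem_exceptional_iff _ _ hβ).2 (((hΦ P).eq_centre_or H hs).resolve_left hP)
  refine Set.Subset.antisymm ?_ ?_
  · rw [Set.image_subset_iff]
    exact closure_minimal (fun P hP => h1 P hP.1 fun h => hP.2 ⟨_, h.symm⟩)
      ((isClosed_exceptional _).preimage Φ.continuous)
  · have h2 : exceptional (hirz 2) (betaPt q t Θ) (.t, s) ⊆
        Φ.toEquiv.symm ⁻¹' exceptional (hirz 0) (gammaPt q t Θ) (.t, s) ∪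
        Φ.toEquiv.symm ⁻¹' strictTransform (hirz 0) (gammaPt q t Θ) (vLine 0 (tNode t Θ s)) := by
      intro Q hQ
      obtain ⟨P, rfl⟩ := Φ.toEquiv.surjective Q
      rw [mem_exceptional_iff _ _ hβ] at hQ
      have hs := (((hΦ P).mem_vLine_iff (tNode t Θ s)).2 (hQ ▸ centre_beta_mem_vLine s))
      rw [Set.mem_union, Set.mem_preimage, Set.mem_preimage, Equiv.symm_apply_apply,
        mem_exceptional_iff _ _ hγ, or_iff_not_imp_left]
      exact fun hP => subset_closure ⟨hs, notMem_centre_gamma H hs hP⟩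
    rcases (isIrreducible_exceptional _).subset_or_subset
      ((isClosed_exceptional _).preimage Φ.continuous_symm)
      (isClosed_closure.preimage Φ.continuous_symm) h2 with h | h
    -- The point z = ∞ of the fibre goes to the exceptional line over β without lying on the one
    -- over γ.
    · exfalso
      have hs : hirzMk 0 (hirzHom 1 ![tNode t Θ s, 0]) ∈ vLine 0 (tNode t Θ s) := by
        rw [hirzMk_mem_vLine]
        simp [hirzHom]
      have hP : ∀ i, hirzMk 0 (hirzHom 1 ![tNode t Θ s, 0]) ≠ centre _ (gammaPt q t Θ) i :=
        gamma_ne_of_vLine H ((hirzMk_mem_vLine _ _ _).1 hs) (by simp [hirzHom])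
      obtain ⟨P, e⟩ := exists_blowDown_eq hP
      rw [← e] at hs hP
      have := h (h1 P hs (hP _))
      rw [Set.mem_preimage, Equiv.symm_apply_apply, mem_exceptional_iff _ _ hγ] at this
      exact hP _ this
    · rw [Φ.toEquiv.image_eq_preimage_symm]
      exact h

/-- The mirror argument for the inverse map; the witness that excludes the wrong component is the
point v = ∞ of the fibre on the second surface. -/
theorem image_exceptional_t (H : Admissible q t Θ)
    (hΦ : ∀ P, Corr q t Θ (blowDown _ _ P) (blowDown _ _ (Φ.toEquiv P))) (s : Bool) :
    Φ.toEquiv '' exceptional (hirz 0) (gammaPt q t Θ) (.t, s) =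
      strictTransform (hirz 2) (betaPt q t Θ) (vLine 2 (tNode t Θ s)) := by
  have hγ := gamma_injective H
  have hβ := beta_injective H
  have h1 : ∀ P : (sakaiSurface q t Θ).Pt,
      blowDown _ _ (Φ.toEquiv P) ∈ vLine 2 (tNode t Θ s) →
      blowDown _ _ (Φ.toEquiv P) ≠ centre _ (betaPt q t Θ) (.t, s) →
      P ∈ exceptional (hirz 0) (gammaPt q t Θ) (.t, s) := fun P hs hP =>
    (mem_exceptional_iff _ _ hγ).2
      (((hΦ P).eq_centre_or H (((hΦ P).mem_vLine_iff _).2 hs)).resolve_right hP)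
  refine Set.Subset.antisymm ?_ ?_
  · rw [Set.image_subset_iff]
    have h2 : exceptional (hirz 0) (gammaPt q t Θ) (.t, s) ⊆
        Φ.toEquiv ⁻¹' exceptional (hirz 2) (betaPt q t Θ) (.t, s) ∪
        Φ.toEquiv ⁻¹' strictTransform (hirz 2) (betaPt q t Θ) (vLine 2 (tNode t Θ s)) := by
      intro P hP
      rw [mem_exceptional_iff _ _ hγ] at hP
      have hs := (((hΦ P).mem_vLine_iff (tNode t Θ s)).1 (hP ▸ centre_gamma_mem_vLine s))
      rw [Set.mem_union, Set.mem_preimage, Set.mem_preimage,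
        mem_exceptional_iff _ _ hβ, or_iff_not_imp_left]
      exact fun hQ => subset_closure ⟨hs, notMem_centre_beta H hs hQ⟩
    refine ((isIrreducible_exceptional _).subset_or_subset
      ((isClosed_exceptional _).preimage Φ.continuous)
      (isClosed_closure.preimage Φ.continuous) h2).resolve_left fun h => ?_
    have hs : hirzMk 2 (hirzHom 1 ![tNode t Θ s, 0]) ∈ vLine 2 (tNode t Θ s) := by
      rw [hirzMk_mem_vLine]
      simp [hirzHom]
    have hQ : ∀ i, hirzMk 2 (hirzHom 1 ![tNode t Θ s, 0]) ≠ centre _ (betaPt q t Θ) i :=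
      beta_ne_of_vLine H ((hirzMk_mem_vLine _ _ _).1 hs)
        (by simpa [hirzHom] using sub_ne_zero.2 H.q_ne_one)
    obtain ⟨Q, e⟩ := exists_blowDown_eq hQ
    obtain ⟨P, rfl⟩ := Φ.toEquiv.surjective Q
    rw [← e] at hs hQ
    exact hQ _ ((mem_exceptional_iff _ _ hβ).1 (h (h1 P hs (hQ _))))
  · rw [Φ.toEquiv.image_eq_preimage_symm]
    refine closure_minimal (fun Q hQ => ?_)
      ((isClosed_exceptional _).preimage Φ.continuous_symm)
    obtain ⟨P, rfl⟩ := Φ.toEquiv.surjective Q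
    rw [Set.mem_preimage, Equiv.symm_apply_apply]
    exact h1 P hQ.1 fun h => hQ.2 ⟨_, h.symm⟩

/-- For z ≠ 0 the point is not γ_t^±, so its partner is unique and it suffices that the stated value
satisfies the graph equation. -/
theorem blowDown_apply (H : Admissible q t Θ)
    (hΦ : ∀ P, Corr q t Θ (blowDown _ _ P) (blowDown _ _ (Φ.toEquiv P)))
    (P : (sakaiSurface q t Θ).Pt) (y z : ℂ) (hz : z ≠ 0)
    (hP : blowDown (hirz 0) (gammaPt q t Θ) P = hirzPt 0 0 y z) :
    blowDown (hirz 2) (betaPt q t Θ) (Φ.toEquiv P) = hirzPt 2 0 y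
      (((y - t * Θ .t) * (y - t * (Θ .t)⁻¹) - q * (y - 1) * (y - t) * z) /
        (q * (q - 1) * z)) := by
  have hq0 := H.q_ne_zero
  have hq1 := sub_ne_zero.2 H.q_ne_one
  have h := hΦ P
  rw [hP] at h
  refine h.unique_right H.q_ne_zero H.q_ne_one (fun s e => ?_) ?_
  · rw [centre_mk (gammaPt_t s), hirzPt_mk, hirzMk_eq_iff] at e
    simp [hirzHom, hz.symm] at e
  · rw [hirzPt_mk, hirzPt_mk, corr_iff]
    simp only [CorrEq, hirzHom, quad]
    -- The identity is polynomial in the second root of A and holds for any value of it.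
    generalize t * (Θ .t)⁻¹ = b
    refine ⟨by simp, ?_⟩
    simp
    field_simp
    ring

end Image

end

end QOkamoto

end

theorem mainTheorem4 (q : ℂ) (hq0 : q ≠ 0) (hq1 : q ≠ 1) (Θ : Idx → ℂ) (hΘ : ∀ i, Θ i ≠ 0)
    (h0 : Θ .zero ^ 2 ≠ 1) (h1 : Θ .one ^ 2 ≠ 1) (ht : Θ .t ^ 2 ≠ 1) (hinf : Θ .inf ^ 2 ≠ q)
    (t : ℂ) (ht0 : t ≠ 0) (htS : t ∉ excludedSet q Θ) :
    ∃ Φ : Biregular (sakaiSurface q t Θ) (modSurface q t Θ),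
      (∀ (P : (sakaiSurface q t Θ).Pt) (y z : ℂ), z ≠ 0 →
        blowDown (hirz 0) (gammaPt q t Θ) P = hirzPt 0 0 y z →
        blowDown (hirz 2) (betaPt q t Θ) (Φ.toEquiv P) = hirzPt 2 0 y
          (((y - t * Θ .t) * (y - t * (Θ .t)⁻¹) - q * (y - 1) * (y - t) * z) /
            (q * (q - 1) * z))) ∧
      (∀ s : Bool,
        Φ.toEquiv '' strictTransform (hirz 0) (gammaPt q t Θ) (vLine 0 (tNode t Θ s)) =
          exceptional (hirz 2) (betaPt q t Θ) (.t, s)) ∧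
      (∀ s : Bool,
        Φ.toEquiv '' exceptional (hirz 0) (gammaPt q t Θ) (.t, s) =
          strictTransform (hirz 2) (betaPt q t Θ) (vLine 2 (tNode t Θ s))) ∧
      (∀ s : Bool,
        Φ.toEquiv '' exceptional (hirz 0) (gammaPt q t Θ) (.zero, s) =
          exceptional (hirz 2) (betaPt q t Θ) (.zero, s)) ∧
      (∀ s : Bool,
        Φ.toEquiv '' exceptional (hirz 0) (gammaPt q t Θ) (.one, s) =
          exceptional (hirz 2) (betaPt q t Θ) (.one, s)) ∧
      (∀ s : Bool,
        Φ.toEquiv '' exceptional (hirz 0) (gammaPt q t Θ) (.inf, s) =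
          exceptional (hirz 2) (betaPt q t Θ) (.inf, !s)) ∧
      Φ.toEquiv '' setJ q t Θ = setI q t Θ ∧
      ∃ Ψ : Biregular (qOka q t Θ) (qOkaMod q t Θ),
        ∀ P, qOkaModIncl q t Θ (Ψ.toEquiv P) = Φ.toEquiv (qOkaIncl q t Θ P) := by
  have H : Admissible q t Θ := ⟨hq0, hq1, hΘ, h0, h1, ht, hinf, ht0, htS⟩
  obtain ⟨Φ, hΦ⟩ := exists_biregular_corr H
  have hJ := image_setJ H hΦ
  refine ⟨Φ, blowDown_apply H hΦ, image_strictTransform_vLine H hΦ, image_exceptional_t H hΦ,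
    fun s => image_exceptional H hΦ (.zero, s) (by simp),
    fun s => image_exceptional H hΦ (.one, s) (by simp),
    fun s => image_exceptional H hΦ (.inf, s) (by simp), hJ,
    Φ.exists_restrict (isOpen_compl_setJ q t Θ) (isOpen_compl_setI q t Θ) fun P => ?_⟩
  rw [Set.mem_compl_iff, Set.mem_compl_iff, ← hJ, Φ.toEquiv.injective.mem_set_image]
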